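/- **Setting.** Let $N\ge 1$ be an integer and $b\in\mathbb C$ with $|b|=1$, $\mathrm{Re}\,b>0$, $\mathrm{Im}\,b>0$. Put $q=\exp[\frac{\pi i}{N}(1+b^2)]$, $\tilde q=\exp[\frac{\pi i}{N}(1+b^{-2})]$ and $$y(\mu,m)=e^{\frac{2\pi i}{N}(-ib\mu-m)},\qquad \tilde y(\mu,m)=e^{\frac{2\pi i}{N}(-ib^{-1}\mu+m)}.$$ On $\mathcal H=L^2(\mathbb R)\otimes\mathbb C^N$ (functions $f(\mu,m)$, $\mu\in\mathbb R$, $m\in\mathbb Z/N$) let $\mathbf y,\tilde{\mathbf y}$ be multiplication by $y,\tilde y$, and let $\mathbf u f(\mu,m)=f(\mu+ib,m-1)$, $\tilde{\mathbf u}f(\mu,m)=f(\mu+ib^{-1},m+1)$. Write $e^{\alpha U+\beta Y}=q^{-\alpha\beta}\mathbf u^\alpha\mathbf y^\beta$ and $e^{\alpha\tilde U+\beta\tilde Y}=\tilde q^{-\alpha\beta}\tilde{\mathbf u}^\alpha\tilde{\mathbf y}^\beta$ for $\alpha,\beta\in\mathbb Z$. Let $\lambda_a=e^{L_a}\in\mathbb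 C^\times$, $a=1,\dots,4$, and $$\begin{aligned} L&=e^{-Y}+e^{Y}+e^{U},\\ L_s&=e^{-L_3-L_4+Y}+e^{L_3+L_4-Y}-e^{L_1-L_2+U+Y}-e^{L_3+L_4+U-Y}-e^{L_1-L_2+U}-e^{L_3+L_4+U},\\ L_t&=e^{-L_2-L_3+Y}+e^{L_2+L_3-Y}-e^{L_2+L_3-U-Y}-e^{-L_1-2L_3-L_4-U+Y}-e^{L_2-L_3-U}-e^{-L_1-L_4-U}; \end{aligned}$$ $L_s,L_t$ are the quantised S-cycle and T-cycle holonomy traces of the 4-holed sphere. $\tilde L,\tilde L_s,\tilde L_t$ are given by the same formulas with $U,Y,q,\lambda_a$ replaced by $\tilde U,\tilde Y,\tilde q,\overline{\lambda_a}$. Call $\lambda$ *quantised* if $\lambda=y(x,k)$ for some $x\in\mathbb R$, $k\in\mathbb Z/N$. Let $$\varphi(Y,\tilde Y)=\Big[\frac{\prod_{j\ge0}(1+q^{2j+1}Y)}{\prod_{j\ge0}(1+\tilde q^{-2j-1}\tilde Y)}\Big]^{-1},\qquad \varphi_c=\varphi(c\,y,\bar c\,\tilde y),$$ and let $T$ be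 multiplication by $(-1)^{m^2}e^{\frac{\pi i}{N}(\mu^2-m^2)}$ and $Vf(\mu,m)=f(-\mu,-m)$. If $\lambda_a=y(\mu_a,m_a)$ and $\lambda_c=y(\mu_c,m_c)$, put $S_{ac}f(\mu,m)=f(\mu+\mu_a+\mu_c,m+m_a+m_c)$ and let $D_{ac}$ be multiplication by $e^{\frac{2\pi i}{N}[(\mu_a+\mu_c)\mu-(m_a+m_c)m]}$. Put $$\mathfrak U_s=D_{34}^{-1}S_{34}\,\varphi_{\lambda_1/(\lambda_2\lambda_3\lambda_4)}\,\varphi_1\,T\quad(\lambda_3,\lambda_4\text{ quantised}),$$ $$\mathfrak U_t=D_{23}^{-1}S_{23}^{-1}T^{-1}V\,\varphi_{1/(\lambda_1\lambda_2\lambda_3\lambda_4)}^{-1}\,\varphi_{\lambda_3^{-2}}^{-1}\quad(\lambda_2,\lambda_3\text{ quantised}).$$ **Domains.** For a Laurent polynomial $X$ in $\mathbf u,\mathbf y$ (or in $\tilde{\mathbf u},\tilde{\mathbf y}$), let $X^{\mathrm{mer}}$ be $X$ acting by analytic continuation on all $f\in\mathcal H$ that are restrictions to $\mathbb R$ of functions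 meromorphic in $\mu\in\mathbb C$ and satisfy $Xf\in\mathcal H$. Let $\overline X$ be the closure of $X$ restricted to $\mathscr W=\mathfrak W\otimes\mathbb C^N$, where $\mathfrak W$ is the span of the functions $e^{-\alpha\mu^2+\beta\mu}P(\mu)$ with $\mathrm{Re}\,\alpha>0$, $\beta\in\mathbb C$ and $P$ a polynomial. For a unitary $W$ of $\mathcal H$ and pairs $(X,\tilde X)$, $(Z,\tilde Z)$ consider: * (E) $WX^{\mathrm{mer}}W^{-1}=Z^{\mathrm{mer}}$ and $W\tilde X^{\mathrm{mer}}W^{-1}=\tilde Z^{\mathrm{mer}}$, including equality of domains; * (D) the set of $f\in\mathrm{dom}\,\overline X\cap\mathrm{dom}\,\overline{\tilde X}$ with $Wf\in\mathrm{dom}\,\overline Z\cap\mathrm{dom}\,\overline{\tilde Z}$ is dense in $\mathcal H$, and $W\overline Xf=\overline ZWf$ whenever $f\in\mathrm{dom}\,\overline X$ and $Wf\in\mathrm{dom}\,\overline Z$, and likewise for the tilded operators; * (C) $W\overline XW^{-1}=\overline Z$ and $W\overline{\tilde X}W^{-1}=\overline{\tilde Z}$, including equality of domains. **Theorem.** The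 tilded operators $\tilde L,\tilde L_s,\tilde L_t$ are the Hermitian conjugates of $L,L_s,L_t$ on $\mathscr W$. Moreover: 1. (S-cycle) If $\lambda_3,\lambda_4$ are quantised, $D_{34}$, $S_{34}$, $\varphi_{\lambda_1/(\lambda_2\lambda_3\lambda_4)}\varphi_1$ and $T$, hence $\mathfrak U_s$, are unitary on $\mathcal H$, and $W=\mathfrak U_s$ satisfies (E) and (D) for $(L_s,\tilde L_s)$ and $(L,\tilde L)$. If moreover $N$ is even and $\lambda_1/\lambda_2$ is quantised, it also satisfies (C). 2. (T-cycle) If $\lambda_2,\lambda_3$ are quantised, $D_{23}$, $S_{23}$, $T$, $V$ and $\varphi_{1/(\lambda_1\lambda_2\lambda_3\lambda_4)}^{-1}\varphi_{\lambda_3^{-2}}^{-1}$, hence $\mathfrak U_t$, are unitary on $\mathcal H$, and $W=\mathfrak U_t$ satisfies (E) and (D) for $(L_t,\tilde L_t)$ and $(L,\tilde L)$. If moreover $N$ is even and $\lambda_1\lambda_4$ is quantised, it also satisfies (C). 3. (A-move) If $\lambda_2,\lambda_3,\lambda_4$ are quantised, then $W=\mathfrak U_s^{-1}\mathfrak U_t$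 satisfies (E) and (D) for $(L_t,\tilde L_t)$ and $(L_s,\tilde L_s)$. If moreover $N$ is even and $\lambda_1$ is quantised, it also satisfies (C). -/

import Mathlib

open MeasureTheory Complex
open scoped ComplexConjugate

namespace LevelN

noncomputable section

/-- The level-`N` Hilbert space `L²(ℝ) ⊗ ℂ^N`, realised as `N` copies of `L²(ℝ)`:
a vector `f` has the components `f m ∈ L²(ℝ)`, `m ∈ ℤ/N`, i.e. it is a function `f(μ, m)`. -/
abbrev Hilb (N : ℕ) [NeZero N] : Type :=
  PiLp 2 (fun _ : ZMod N => Lp ℂ 2 (volume : Measure ℝ))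

/-- Functions `F(μ, m)` of a complex variable `μ` and of `m ∈ ℤ/N`. -/
abbrev Fn (N : ℕ) : Type := ℂ → ZMod N → ℂ

/-- Linear operators on functions `F(μ, m)`. -/
abbrev FnOp (N : ℕ) : Type := Module.End ℂ (Fn N)

/-- The restriction of `F` to real `μ` is (a.e. equal to) the vector `f`. -/
def Rep {N : ℕ} [NeZero N] (F : Fn N) (f : Hilb N) : Prop :=
  ∀ m : ZMod N, (f m : ℝ → ℂ) =ᵐ[volume] fun μ : ℝ => F (μ : ℂ) m

/-! ### Parameters and coordinate functions -/

/-- `q = exp(ħ)`, `ħ = (π i / N)(1 + b²)`. -/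
def q (N : ℕ) (b : ℂ) : ℂ := exp (Real.pi * I / N * (1 + b ^ 2))

/-- `q̃ = exp(ħ̃)`, `ħ̃ = (π i / N)(1 + b⁻²)`. -/
def qt (N : ℕ) (b : ℂ) : ℂ := exp (Real.pi * I / N * (1 + (b⁻¹) ^ 2))

/-- `y(μ, m) = exp[(2π i / N)(-i b μ - m)]`. -/
def y (N : ℕ) (b : ℂ) : Fn N := fun μ m =>
  exp (2 * Real.pi * I / N * (-I * b * μ - (m.val : ℂ)))

/-- `ỹ(μ, m) = exp[(2π i / N)(-i b⁻¹ μ + m)]`. -/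
def yt (N : ℕ) (b : ℂ) : Fn N := fun μ m =>
  exp (2 * Real.pi * I / N * (-I * b⁻¹ * μ + (m.val : ℂ)))

/-- `l` is quantised: `l = exp[(2π i / N)(-i b x - k)]` with `x ∈ ℝ`, `k ∈ ℤ/N`. -/
def Quantised (N : ℕ) (b : ℂ) (l : ℂ) : Prop :=
  ∃ (x : ℝ) (k : ZMod N), l = y N b (x : ℂ) k

/-- The quantum dilogarithm
`φ(Y, Ỹ) = [∏_{j ≥ 0} (1 + q^(2j+1) Y) / ∏_{j ≥ 0} (1 + q̃^(-2j-1) Ỹ)]⁻¹`. -/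
def qdilog (N : ℕ) (b : ℂ) (Y Yt : ℂ) : ℂ :=
  ((∏' j : ℕ, (1 + q N b ^ (2 * j + 1) * Y)) /
    (∏' j : ℕ, (1 + (qt N b)⁻¹ ^ (2 * j + 1) * Yt)))⁻¹

/-! ### Elementary operators on functions -/

/-- Multiplication by a function. -/
def mulOp {N : ℕ} (a : Fn N) : FnOp N where
  toFun F := fun μ m => a μ m * F μ m
  map_add' F G := by ext μ m; simp [mul_add]
  map_smul' c F := by ext μ m; simp [mul_left_comm]

/-- The shift `F(μ, m) ↦ F(μ + z, m + k)`. -/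
def shiftOp {N : ℕ} (z : ℂ) (k : ZMod N) : FnOp N where
  toFun F := fun μ m => F (μ + z) (m + k)
  map_add' F G := by ext μ m; simp
  map_smul' c F := by ext μ m; simp

/-- The parity operator `F(μ, m) ↦ F(-μ, -m)`. -/
def parityOp (N : ℕ) : FnOp N where
  toFun F := fun μ m => F (-μ) (-m)
  map_add' F G := by ext μ m; simp
  map_smul' c F := by ext μ m; simp

/-- The level-`N` T-type Weil operator: multiplication by `(-1)^(m²) exp[(π i / N)(μ² - m²)]`. -/
def weilOp (N : ℕ) : FnOp N := mulOp fun μ m =>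
  (-1) ^ (m.val ^ 2) * exp (Real.pi * I / N * (μ ^ 2 - (m.val : ℂ) ^ 2))

/-- Multiplication by `exp[(2π i / N)(x μ - k m)]`. -/
def phaseOp (N : ℕ) (x : ℝ) (k : ZMod N) : FnOp N := mulOp fun μ m =>
  exp (2 * Real.pi * I / N * (x * μ - (k.val : ℂ) * (m.val : ℂ)))

/-- Multiplication by the quantum dilogarithm `φ(c y, c̄ ỹ)`. -/
def dilogOp (N : ℕ) (b : ℂ) (c : ℂ) : FnOp N := mulOp fun μ m =>
  qdilog N b (c * y N b μ m) (conj c * yt N b μ m)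

/-- Multiplication by `φ(c y, c̄ ỹ)⁻¹`. -/
def dilogInvOp (N : ℕ) (b : ℂ) (c : ℂ) : FnOp N := mulOp fun μ m =>
  (qdilog N b (c * y N b μ m) (conj c * yt N b μ m))⁻¹

/-! ### The quantum torus algebra -/

/-- `exp(α U + β Y) = q^(-αβ) u^α y^β`, where `u F(μ, m) = F(μ + i b, m - 1)`. -/
def weyl (N : ℕ) (b : ℂ) (α β : ℤ) : FnOp N :=
  (q N b ^ (-(α * β))) •
    (shiftOp ((α : ℂ) * (I * b)) (-(α : ZMod N)) * mulOp fun μ m => y N b μ m ^ β)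

/-- `exp(α Ũ + β Ỹ) = q̃^(-αβ) ũ^α ỹ^β`, where `ũ F(μ, m) = F(μ + i b⁻¹, m + 1)`. -/
def weylt (N : ℕ) (b : ℂ) (α β : ℤ) : FnOp N :=
  (qt N b ^ (-(α * β))) •
    (shiftOp ((α : ℂ) * (I * b⁻¹)) (α : ZMod N) * mulOp fun μ m => yt N b μ m ^ β)

/-- `e^(-Y) + e^Y + e^U`, where `E α β = e^(αU + βY)`. -/
def dehnExpr {N : ℕ} (E : ℤ → ℤ → FnOp N) : FnOp N := E 0 (-1) + E 0 1 + E 1 0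

/-- The quantised S-cycle trace, with `lₐ = e^(Lₐ)`:
`e^(-L₃-L₄+Y) + e^(L₃+L₄-Y) - e^(L₁-L₂+U+Y) - e^(L₃+L₄+U-Y) - e^(L₁-L₂+U) - e^(L₃+L₄+U)`. -/
def traceSExpr {N : ℕ} (E : ℤ → ℤ → FnOp N) (l₁ l₂ l₃ l₄ : ℂ) : FnOp N :=
  (l₃ * l₄)⁻¹ • E 0 1 + (l₃ * l₄) • E 0 (-1) - (l₁ / l₂) • E 1 1 - (l₃ * l₄) • E 1 (-1)
    - (l₁ / l₂) • E 1 0 - (l₃ * l₄) • E 1 0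

/-- The quantised T-cycle trace, with `lₐ = e^(Lₐ)`:
`e^(-L₂-L₃+Y) + e^(L₂+L₃-Y) - e^(L₂+L₃-U-Y) - e^(-L₁-2L₃-L₄-U+Y) - e^(L₂-L₃-U) - e^(-L₁-L₄-U)`. -/
def traceTExpr {N : ℕ} (E : ℤ → ℤ → FnOp N) (l₁ l₂ l₃ l₄ : ℂ) : FnOp N :=
  (l₂ * l₃)⁻¹ • E 0 1 + (l₂ * l₃) • E 0 (-1) - (l₂ * l₃) • E (-1) (-1)
    - (l₁ * l₃ ^ 2 * l₄)⁻¹ • E (-1) 1 - (l₂ / l₃) • E (-1) 0 - (l₁ * l₄)⁻¹ • E (-1) 0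

/-- The pair `(L, L̃)`. -/
def pairL (N : ℕ) (b : ℂ) : FnOp N × FnOp N :=
  (dehnExpr (weyl N b), dehnExpr (weylt N b))

/-- The pair `(L_s, L̃_s)`; the tilded parameters are the complex conjugates. -/
def pairS (N : ℕ) (b l₁ l₂ l₃ l₄ : ℂ) : FnOp N × FnOp N :=
  (traceSExpr (weyl N b) l₁ l₂ l₃ l₄,
    traceSExpr (weylt N b) (conj l₁) (conj l₂) (conj l₃) (conj l₄))

/-- The pair `(L_t, L̃_t)`; the tilded parameters are the complex conjugates. -/
def pairT (N : ℕ) (b l₁ l₂ l₃ l₄ : ℂ) : FnOp N × FnOp N :=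
  (traceTExpr (weyl N b) l₁ l₂ l₃ l₄,
    traceTExpr (weylt N b) (conj l₁) (conj l₂) (conj l₃) (conj l₄))

/-! ### Operators on the Hilbert space, given by their graphs -/

/-- Functions that are meromorphic on `ℂ` in `μ`. -/
def merFn (N : ℕ) : Submodule ℂ (Fn N) where
  carrier := {F | ∀ m : ZMod N, Meromorphic fun μ : ℂ => F μ m}
  add_mem' hF hG m := (hF m).add (hG m)
  zero_mem' _ := fun z => MeromorphicAt.const (0 : ℂ) z
  smul_mem' c _ hF m := (hF m).const_smul c

/-- The space `𝒲 = 𝔚 ⊗ ℂ^N`, where `𝔚` is spanned by the functions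
`exp(-α μ² + β μ) P(μ)` with `Re α > 0`, `β ∈ ℂ` and `P` a polynomial. -/
def gaussFn (N : ℕ) : Submodule ℂ (Fn N) :=
  Submodule.span ℂ {F | ∃ (α β : ℂ) (P : Polynomial ℂ) (k : ZMod N), 0 < α.re ∧
    F = fun μ m => if m = k then exp (-α * μ ^ 2 + β * μ) * P.eval μ else 0}

/-- The graph of the operator `X` in the Hilbert space with domain
`{f | f has an extension F ∈ W for which X F is square integrable on ℝ}`. -/
def graphOn {N : ℕ} [NeZero N] (W : Submodule ℂ (Fn N)) (X : FnOp N) :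
    Submodule ℂ (Hilb N × Hilb N) where
  carrier := {p | ∃ F ∈ W, Rep F p.1 ∧ Rep (X F) p.2}
  add_mem' := by
    rintro ⟨f, f'⟩ ⟨g, g'⟩ ⟨F, hF, h1, h2⟩ ⟨G, hG, h3, h4⟩
    refine ⟨F + G, W.add_mem hF hG, fun m => ?_, fun m => ?_⟩
    · filter_upwards [Lp.coeFn_add (f m) (g m), h1 m, h3 m] with x hx e1 e2
      simpa [e1, e2] using hx
    · filter_upwards [Lp.coeFn_add (f' m) (g' m), h2 m, h4 m] with x hx e1 e2
      simpa [e1, e2] using hx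
  zero_mem' := by
    refine ⟨0, W.zero_mem, fun m => ?_, fun m => ?_⟩
    · filter_upwards [Lp.coeFn_zero ℂ 2 (volume : Measure ℝ)] with x hx
      simp
    · filter_upwards [Lp.coeFn_zero ℂ 2 (volume : Measure ℝ)] with x hx
      simp
  smul_mem' := by
    rintro c ⟨f, f'⟩ ⟨F, hF, h1, h2⟩
    refine ⟨c • F, W.smul_mem c hF, fun m => ?_, fun m => ?_⟩
    · filter_upwards [Lp.coeFn_smul c (f m), h1 m] with x hx e1
      simpa [e1] using hx
    · filter_upwards [Lp.coeFn_smul c (f' m), h2 m] with x hx e1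
      simpa [e1] using hx

/-- The operator `X` on its maximal domain of meromorphically continuable vectors:
the shifts in `X` act by analytic continuation. -/
def merGraph {N : ℕ} [NeZero N] (X : FnOp N) : Submodule ℂ (Hilb N × Hilb N) :=
  graphOn (merFn N) X

/-- The operator `X` with the domain `𝒲`. -/
def coreGraph {N : ℕ} [NeZero N] (X : FnOp N) : Submodule ℂ (Hilb N × Hilb N) :=
  graphOn (gaussFn N) X

/-- The closure of the operator `X` with the domain `𝒲`. -/
def closedGraph {N : ℕ} [NeZero N] (X : FnOp N) : Submodule ℂ (Hilb N × Hilb N) :=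
  (coreGraph X).topologicalClosure

/-- The second member of the pair is the Hermitian conjugate of the first one on `𝒲`. -/
def IsConjugatePair {N : ℕ} [NeZero N] (X : FnOp N × FnOp N) : Prop :=
  ∀ f f' g g' : Hilb N, (f, f') ∈ coreGraph X.1 → (g, g') ∈ coreGraph X.2 →
    inner ℂ f' g = inner ℂ f g'

/-! ### Unitaries -/

/-- The unitary `W` acts on vectors by the formula `A`. -/
def Realises {N : ℕ} [NeZero N] (W : Hilb N ≃ₗᵢ[ℂ] Hilb N) (A : FnOp N) : Prop :=
  ∀ (F : Fn N) (f : Hilb N), Rep F f → Rep (A F) (W f)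

/-- `𝔘_s = D₃₄⁻¹ S₃₄ U'_s T`, with the parameters `(xₐ, kₐ)` of `lₐ` for `a = 3, 4`, where
`U'_s = φ(y e^(L₁-L₂-L₃-L₄), …) φ(y, ỹ)`. -/
def IsUs (N : ℕ) [NeZero N] (b l₁ l₂ l₃ l₄ : ℂ) (x₃ x₄ : ℝ) (k₃ k₄ : ZMod N)
    (𝔘 : Hilb N ≃ₗᵢ[ℂ] Hilb N) : Prop :=
  ∃ D S U' T : Hilb N ≃ₗᵢ[ℂ] Hilb N,
    Realises D (phaseOp N (x₃ + x₄) (k₃ + k₄)) ∧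
    Realises S (shiftOp ((x₃ + x₄ : ℝ) : ℂ) (k₃ + k₄)) ∧
    Realises U' (dilogOp N b (l₁ / (l₂ * l₃ * l₄)) * dilogOp N b 1) ∧
    Realises T (weilOp N) ∧
    𝔘 = D⁻¹ * S * U' * T

/-- `𝔘_t = D₂₃⁻¹ S₂₃⁻¹ T⁻¹ V U'_t`, with the parameters `(xₐ, kₐ)` of `lₐ` for `a = 2, 3`, where
`U'_t = φ(e^(-(L₁+L₂+L₃+L₄)) y, …)⁻¹ φ(e^(-2L₃) y, …)⁻¹`. -/
def IsUt (N : ℕ) [NeZero N] (b l₁ l₂ l₃ l₄ : ℂ) (x₂ x₃ : ℝ) (k₂ k₃ : ZMod N)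
    (𝔘 : Hilb N ≃ₗᵢ[ℂ] Hilb N) : Prop :=
  ∃ D S U' T V : Hilb N ≃ₗᵢ[ℂ] Hilb N,
    Realises D (phaseOp N (x₂ + x₃) (k₂ + k₃)) ∧
    Realises S (shiftOp ((x₂ + x₃ : ℝ) : ℂ) (k₂ + k₃)) ∧
    Realises U' (dilogInvOp N b (l₁ * l₂ * l₃ * l₄)⁻¹ * dilogInvOp N b (l₃ ^ 2)⁻¹) ∧
    Realises T (weilOp N) ∧
    Realises V (parityOp N) ∧
    𝔘 = D⁻¹ * S⁻¹ * T⁻¹ * V * U'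

/-! ### Unitary equivalence of pairs of operators -/

/-- `W G W⁻¹ = G'` for operators with graphs `G` and `G'`, including the equality of domains. -/
def Conjugates {N : ℕ} [NeZero N] (W : Hilb N ≃ₗᵢ[ℂ] Hilb N)
    (G G' : Submodule ℂ (Hilb N × Hilb N)) : Prop :=
  ∀ f g : Hilb N, (f, g) ∈ G ↔ (W f, W g) ∈ G'

/-- The domain of the operator with graph `G`. -/
def dom {N : ℕ} [NeZero N] (G : Submodule ℂ (Hilb N × Hilb N)) : Submodule ℂ (Hilb N) :=
  G.map (LinearMap.fst ℂ (Hilb N) (Hilb N))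

/-- `W X W⁻¹ = Z` for both members of the pairs, as operators on the meromorphically
continuable vectors, with equality of domains. -/
def MerEquiv {N : ℕ} [NeZero N] (W : Hilb N ≃ₗᵢ[ℂ] Hilb N) (X Z : FnOp N × FnOp N) : Prop :=
  Conjugates W (merGraph X.1) (merGraph Z.1) ∧ Conjugates W (merGraph X.2) (merGraph Z.2)

/-- For the closed operators: `W X W⁻¹` and `Z` agree wherever both are defined, for both
members of the pairs, and the vectors at which all four operators are defined are dense. -/
def DenseEquiv {N : ℕ} [NeZero N] (W : Hilb N ≃ₗᵢ[ℂ] Hilb N) (X Z : FnOp N × FnOp N) : Prop :=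
  Dense {f : Hilb N | f ∈ dom (closedGraph X.1) ∧ f ∈ dom (closedGraph X.2) ∧
    W f ∈ dom (closedGraph Z.1) ∧ W f ∈ dom (closedGraph Z.2)} ∧
  (∀ f g h : Hilb N, (f, g) ∈ closedGraph X.1 → (W f, h) ∈ closedGraph Z.1 → h = W g) ∧
  (∀ f g h : Hilb N, (f, g) ∈ closedGraph X.2 → (W f, h) ∈ closedGraph Z.2 → h = W g)

/-- `W X W⁻¹ = Z` for both members of the pairs, as closed operators. -/
def ClosedEquiv {N : ℕ} [NeZero N] (W : Hilb N ≃ₗᵢ[ℂ] Hilb N) (X Z : FnOp N × FnOp N) : Prop :=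
  Conjugates W (closedGraph X.1) (closedGraph Z.1) ∧
  Conjugates W (closedGraph X.2) (closedGraph Z.2)

end

end LevelN

/-! The traces are three-term-type difference operators, and the unitaries remove their extra terms.
After conjugation of L_s by T, and directly for L_t, the operator has the form R + ρ π · shift: R is
multiplication by y/a + a/y, the shift is μ ↦ μ ± ib with the matching step in m, and π is a product
of two factors 1 + q^{±1} c y. The functional equation of φ says precisely that such a factor is the
quotient of a shifted to an unshifted dilogarithm (or inverse dilogarithm). Multiplication by the
product M of the two dilogarithmic factors therefore takes R + ρ π · shift to R + ρ · shift
(`twist_S`, `twist_T`), and phases, real shifts, T and parity take the result to L (`semiconj_L_S`,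
`semiconj_L_T`). Since φ satisfies a second functional equation in ỹ, with b⁻¹ for b and the
opposite step in m, the same unitaries treat the tilded operators; `gy` and `gweyl` cover both
cases. As |b| = 1, conjugation exchanges numerator and denominator of φ (`conj_dilogDen`), so |φ| =
1 on ℝ and everything is unitary.

Property (E) follows at once: every factor and its inverse preserve meromorphic functions, and the
intertwining identities hold almost everywhere on ℝ (`Twist.conjugates_merGraph`).

Property (D) rests on duality. Contour shifts show that the tilded operators are adjoint to the
untilded ones on Gaussians (`isConjugatePair_weyl`), and this relation survives closure. If the
intertwining holds on one dense set inside all four domains, testing against that set gives it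
wherever both sides are defined (`denseEquiv_of_dense`). Such a set is found by clearing
denominators: with φ = num/den, multiplication by φ sends den · h to num · h. Both products are
entire, are limits of exponential polynomials, and grow at most like exp(A|z|²)
(`prod_one_add_growth`), so for Gaussians h of large enough rate they lie in the domains of all
closures (`ExpLim.repIn_closedGraph`). Such vectors are dense because the entire factor vanishes
only on a null set (`dense_gauss`). For the A-move the factors of the two cycles are multiplied
together, which yields a common dense set.

Property (C) needs information about poles. For even N and a quantised parameter, the zeros of den
with Im z ≥ -Re b are cancelled by num, except possibly for one simple zero on the line Im z = -Re b
(`dilogNum_eq_zero`). A function analytic in the closed strip swept by the shift, with a Gaussian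
bound, lies in the domain of the closure, by convolution with heat kernels
(`StripGauss.repIn_closedGraph`). Multiplication by M leads from Gaussians to such functions; M⁻¹
may have poles on the far edge of the strip, which are pushed outside and brought back by a limit
(`repIn_mul_inv`). The inclusions of graphs in both directions give equality
(`conjugates_closedGraph_of_stripMult`). -/

namespace LevelN

open Filter Topology

set_option linter.unusedSectionVars false

/-! ### Gaussian bounds -/

/-- `f` is bounded by a Gaussian in the quantity `r`. -/
def GaussBdd {α : Type*} (r : α → ℝ) (f : α → ℂ) : Prop :=
  ∃ C δ : ℝ, 0 < δ ∧ ∀ a, ‖f a‖ ≤ C * Real.exp (-δ * r a ^ 2)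

namespace GaussBdd

variable {α α' : Type*} {r r' : α → ℝ} {f g : α → ℂ}

lemma exists_nonneg (hf : GaussBdd r f) :
    ∃ C δ : ℝ, 0 ≤ C ∧ 0 < δ ∧ ∀ a, ‖f a‖ ≤ C * Real.exp (-δ * r a ^ 2) := by
  obtain ⟨C, δ, hδ, h⟩ := hf
  refine ⟨|C|, δ, abs_nonneg _, hδ, fun a => (h a).trans ?_⟩
  gcongr
  exact le_abs_self C

lemma mono (hf : GaussBdd r f) (h : ∀ a, ‖g a‖ ≤ ‖f a‖) : GaussBdd r g := by
  obtain ⟨C, δ, hδ, hf⟩ := hf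
  exact ⟨C, δ, hδ, fun a => (h a).trans (hf a)⟩

lemma zero : GaussBdd r (fun _ => 0) := ⟨0, 1, one_pos, by simp⟩

lemma add (hf : GaussBdd r f) (hg : GaussBdd r g) : GaussBdd r (fun a => f a + g a) := by
  obtain ⟨C, δ, hC, hδ, hf⟩ := hf.exists_nonneg
  obtain ⟨D, ε, hD, hε, hg⟩ := hg.exists_nonneg
  refine ⟨C + D, min δ ε, lt_min hδ hε, fun a => (norm_add_le _ _).trans ?_⟩
  rw [add_mul]
  refine add_le_add ((hf a).trans ?_) ((hg a).trans ?_)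
  · gcongr
    exact min_le_left _ _
  · gcongr
    exact min_le_right _ _

lemma const_mul (c : ℂ) (hf : GaussBdd r f) : GaussBdd r (fun a => c * f a) := by
  obtain ⟨C, δ, hδ, hf⟩ := hf
  refine ⟨‖c‖ * C, δ, hδ, fun a => ?_⟩
  rw [norm_mul, mul_assoc]
  gcongr
  exact hf a

lemma comp (hf : GaussBdd r f) (φ : α' → α) : GaussBdd (r ∘ φ) (f ∘ φ) := by
  obtain ⟨C, δ, hδ, hf⟩ := hf
  exact ⟨C, δ, hδ, fun a => hf (φ a)⟩

/-- The bound in `r` implies the one in `r'` if `|r'| ≤ K |r| + c`. -/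
lemma change (hf : GaussBdd r f) (K c : ℝ) (h : ∀ a, |r' a| ≤ K * |r a| + c) :
    GaussBdd r' f := by
  obtain ⟨C, δ, hC, hδ, hf⟩ := hf.exists_nonneg
  -- From (K|r| + c)² ≤ 2K²r² + 2c²; `K ^ 2 + 1` in place of `K ^ 2` keeps the new rate meaningful
  -- for `K = 0`.
  refine ⟨C * Real.exp (δ * c ^ 2 / (K ^ 2 + 1)), δ / (2 * (K ^ 2 + 1)), by positivity,
    fun a => (hf a).trans ?_⟩
  rw [mul_assoc, ← Real.exp_add]
  gcongr
  have h1 : r' a ^ 2 ≤ 2 * (K ^ 2 + 1) * r a ^ 2 + 2 * c ^ 2 := by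
    have h2 : r' a ^ 2 ≤ (K * |r a| + c) ^ 2 := by
      rw [← sq_abs (r' a)]
      exact pow_le_pow_left₀ (abs_nonneg _) (h a) 2
    have h3 := sq_nonneg (K * |r a| - c)
    have h4 : |r a| ^ 2 = r a ^ 2 := sq_abs _
    nlinarith [sq_nonneg (r a)]
  have hK : 0 < K ^ 2 + 1 := by positivity
  have h5 : δ / (2 * (K ^ 2 + 1)) * r' a ^ 2 ≤ δ * r a ^ 2 + δ * c ^ 2 / (K ^ 2 + 1) := by
    calc δ / (2 * (K ^ 2 + 1)) * r' a ^ 2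
        ≤ δ / (2 * (K ^ 2 + 1)) * (2 * (K ^ 2 + 1) * r a ^ 2 + 2 * c ^ 2) := by gcongr
      _ = _ := by field_simp
  linarith

/-- Completing the square, c|r| ≤ c²/(2δ) + δr²/2: half of the Gaussian rate pays for any
exponential growth. -/
lemma mul_growth (hf : GaussBdd r f) {C c : ℝ} (hg : ∀ a, ‖g a‖ ≤ C * Real.exp (c * |r a|)) :
    GaussBdd r (fun a => g a * f a) := by
  obtain ⟨D, δ, hD, hδ, hf⟩ := hf.exists_nonneg
  refine ⟨|C| * D * Real.exp (c ^ 2 / (2 * δ)), δ / 2, by positivity, fun a => ?_⟩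
  rw [norm_mul]
  have h1 : ‖g a‖ ≤ |C| * Real.exp (c * |r a|) := (hg a).trans (by gcongr; exact le_abs_self C)
  calc ‖g a‖ * ‖f a‖ ≤ (|C| * Real.exp (c * |r a|)) * (D * Real.exp (-δ * r a ^ 2)) := by
        gcongr
        exact hf a
    _ = |C| * D * Real.exp (c * |r a| + -δ * r a ^ 2) := by rw [Real.exp_add]; ring
    _ ≤ |C| * D * Real.exp (c ^ 2 / (2 * δ) + -(δ / 2) * r a ^ 2) := by
        refine mul_le_mul_of_nonneg_left (Real.exp_le_exp.2 ?_) (by positivity)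
        have h2 : |r a| ^ 2 = r a ^ 2 := sq_abs _
        have h3 : 0 ≤ (c - δ * |r a|) ^ 2 / (2 * δ) := by positivity
        have h4 : (c - δ * |r a|) ^ 2 / (2 * δ)
            = c ^ 2 / (2 * δ) - c * |r a| + δ / 2 * |r a| ^ 2 := by field_simp; ring
        rw [h4, h2] at h3
        linarith
    _ = _ := by rw [Real.exp_add]; ring

lemma mul_bdd (hf : GaussBdd r f) {C : ℝ} (hg : ∀ a, ‖g a‖ ≤ C) :
    GaussBdd r (fun a => g a * f a) :=
  hf.mul_growth (C := C) (c := 0) (by simpa using hg)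

lemma of_exp_neg {δ : ℝ} (hδ : 0 < δ) (hf : ∀ a, ‖f a‖ ≤ Real.exp (-δ * r a ^ 2)) :
    GaussBdd r f := ⟨1, δ, hδ, by simpa using hf⟩

lemma integrable {f : ℝ → ℂ} (hf : GaussBdd id f) (hm : AEStronglyMeasurable f) :
    Integrable f := by
  obtain ⟨C, δ, hδ, hf⟩ := hf
  exact ((integrable_exp_neg_mul_sq hδ).const_mul C).mono' hm (ae_of_all _ hf)

lemma memLp_two {f : ℝ → ℂ} (hf : GaussBdd id f) (hm : AEStronglyMeasurable f) :
    MemLp f 2 := by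
  rw [memLp_two_iff_integrable_sq_norm hm]
  obtain ⟨C, δ, hδ, hf⟩ := hf
  refine ((integrable_exp_neg_mul_sq (by positivity : 0 < 2 * δ)).const_mul (C ^ 2)).mono'
    (hm.norm.pow 2) (ae_of_all _ fun a => ?_)
  rw [Real.norm_eq_abs, abs_of_nonneg (by positivity)]
  calc ‖f a‖ ^ 2 ≤ (C * Real.exp (-δ * a ^ 2)) ^ 2 := pow_le_pow_left₀ (norm_nonneg _) (hf a) 2
    _ = _ := by rw [mul_pow, ← Real.exp_nat_mul]; push_cast; ring_nf

end GaussBdd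

/-! ### Representatives -/

section rep

variable {N : ℕ} [NeZero N]

lemma Rep.congr {F G : Fn N} {f : Hilb N} (hF : Rep F f)
    (h : ∀ m, ∀ᵐ x : ℝ, F x m = G x m) : Rep G f := fun m => by
  filter_upwards [hF m, h m] with x h1 h2 using h1.trans h2

lemma Rep.unique {F : Fn N} {f g : Hilb N} (hf : Rep F f) (hg : Rep F g) : f = g := by
  ext1 m
  exact Lp.ext ((hf m).trans (hg m).symm)

lemma Rep.ae_eq {F G : Fn N} {f : Hilb N} (hF : Rep F f) (hG : Rep G f) (m : ZMod N) :
    ∀ᵐ x : ℝ, F x m = G x m := by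
  filter_upwards [hF m, hG m] with x h1 h2 using h1.symm.trans h2

/-- No analyticity is asked of a representative, so an extension depending only on Re μ will do;
operators that use only real values can be tested on it. -/
lemma exists_fn_rep (f : Hilb N) : ∃ F : Fn N, Rep F f :=
  ⟨fun μ m => f m μ.re, fun m => by simp⟩

/-- Square integrable up to null sets with a Gaussian bound. -/
lemma exists_rep_of_gaussBdd {F : Fn N} (hm : ∀ m, AEStronglyMeasurable fun x : ℝ => F x m)
    (hb : ∀ m, GaussBdd id fun x : ℝ => F x m) : ∃ f : Hilb N, Rep F f :=
  ⟨WithLp.toLp 2 fun m => ((hb m).memLp_two (hm m)).toLp _, fun m => ((hb m).memLp_two (hm m)).coeFn_toLp⟩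

lemma Rep.aestronglyMeasurable {F : Fn N} {f : Hilb N} (hF : Rep F f) (m : ZMod N) :
    AEStronglyMeasurable fun x : ℝ => F x m :=
  (Lp.aestronglyMeasurable (f m)).congr (hF m)

lemma inner_eq_of_rep {F : Fn N} {f : Hilb N} (hF : Rep F f) (p : Hilb N) :
    inner ℂ p f = ∑ m, ∫ x : ℝ, conj (p m x) * F x m := by
  rw [PiLp.inner_apply]
  refine Finset.sum_congr rfl fun m _ => ?_
  rw [L2.inner_def]
  refine integral_congr_ae ?_
  filter_upwards [hF m] with x hx
  rw [RCLike.inner_apply', ← hx]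

lemma inner_eq_of_rep_rep {F G : Fn N} {f g : Hilb N} (hF : Rep F f) (hG : Rep G g) :
    inner ℂ f g = ∑ m, ∫ x : ℝ, conj (F x m) * G x m := by
  rw [inner_eq_of_rep hG]
  refine Finset.sum_congr rfl fun m _ => integral_congr_ae ?_
  filter_upwards [hF m] with x hx
  rw [hx]

/-! ### Duality -/

/-- Hahn–Banach in the quotient by `K` gives a functional that kills `K` but not the given point.
The product carries the sup norm, so Riesz is applied on each factor separately, whence the two
vectors `p` and `r`. -/
lemma mem_of_forall_inner {K : Submodule ℂ (Hilb N × Hilb N)}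
    (hK : IsClosed (K : Set (Hilb N × Hilb N))) {f h : Hilb N}
    (H : ∀ p r : Hilb N, (∀ a b, (a, b) ∈ K → inner ℂ p a + inner ℂ r b = 0) →
      inner ℂ p f + inner ℂ r h = 0) : (f, h) ∈ K := by
  by_contra hx
  have : IsClosed (K : Set (Hilb N × Hilb N)) := hK
  have hne : K.mkQ (f, h) ≠ 0 := by
    rwa [Ne, Submodule.mkQ_apply, Submodule.Quotient.mk_eq_zero]
  obtain ⟨φ, hφ1, hφ2⟩ := exists_dual_vector ℂ (K.mkQ (f, h)) (norm_ne_zero_iff.2 hne)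
  let ψ : (Hilb N × Hilb N) →L[ℂ] ℂ := φ.comp K.mkQL
  let p := (InnerProductSpace.toDual ℂ (Hilb N)).symm (ψ.comp (ContinuousLinearMap.inl ℂ _ _))
  let r := (InnerProductSpace.toDual ℂ (Hilb N)).symm (ψ.comp (ContinuousLinearMap.inr ℂ _ _))
  have key : ∀ a b : Hilb N, inner ℂ p a + inner ℂ r b = ψ (a, b) := by
    intro a b
    simp only [p, r, InnerProductSpace.toDual_symm_apply, ContinuousLinearMap.comp_apply,
      ContinuousLinearMap.inl_apply, ContinuousLinearMap.inr_apply]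
    rw [← map_add]
    simp
  have h0 := H p r fun a b hab => by
    rw [key]
    change φ (K.mkQ (a, b)) = 0
    rw [Submodule.mkQ_apply, (Submodule.Quotient.mk_eq_zero K).2 hab, map_zero]
  rw [key] at h0
  change φ (K.mkQ (f, h)) = 0 at h0
  rw [h0] at hφ2
  exact hne (by simpa using hφ2.symm)

/-- The functions `F`, `H` represent an element of `K`. -/
def RepIn (K : Submodule ℂ (Hilb N × Hilb N)) (F H : Fn N) : Prop :=
  ∃ f h, Rep F f ∧ Rep H h ∧ (f, h) ∈ K

lemma RepIn.congr {K : Submodule ℂ (Hilb N × Hilb N)} {F H F' H' : Fn N} (h : RepIn K F H)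
    (hF : ∀ m, ∀ᵐ x : ℝ, F x m = F' x m) (hH : ∀ m, ∀ᵐ x : ℝ, H x m = H' x m) :
    RepIn K F' H' := by
  obtain ⟨f, g, h1, h2, h3⟩ := h
  exact ⟨f, g, h1.congr hF, h2.congr hH, h3⟩

lemma RepIn.mem {K : Submodule ℂ (Hilb N × Hilb N)} {F H : Fn N} (h : RepIn K F H)
    {f g : Hilb N} (hf : Rep F f) (hg : Rep H g) : (f, g) ∈ K := by
  obtain ⟨f', g', h1, h2, h3⟩ := h
  rwa [hf.unique h1, hg.unique h2]

lemma integrable_conj_mul (p : Lp ℂ 2 (volume : Measure ℝ)) {f : ℝ → ℂ} (hf : MemLp f 2) :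
    Integrable fun x => conj (p x) * f x := by
  have : MemLp (fun x => conj (p x)) 2 := (Lp.memLp p).star
  exact this.integrable_mul hf

/-- Weak convergence is all that the test by functionals in `mem_of_forall_inner` requires. -/
lemma tendsto_inner_of_dominated {F : Fn N} {Fs : ℕ → Fn N} {f : Hilb N} {fs : ℕ → Hilb N}
    (hF : Rep F f) (hFs : ∀ n, Rep (Fs n) (fs n))
    (hb : ∀ m, ∃ B : ℝ → ℂ, MemLp B 2 ∧ ∀ n, ∀ᵐ x : ℝ, ‖Fs n x m‖ ≤ ‖B x‖)
    (hl : ∀ m, ∀ᵐ x : ℝ, Tendsto (fun n => Fs n x m) atTop (𝓝 (F x m))) (p : Hilb N) :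
    Tendsto (fun n => (inner ℂ p (fs n) : ℂ)) atTop (𝓝 (inner ℂ p f)) := by
  rw [inner_eq_of_rep hF]
  simp_rw [fun n => inner_eq_of_rep (hFs n) p]
  refine tendsto_finsetSum _ fun m _ => ?_
  obtain ⟨B, hB, hb⟩ := hb m
  refine tendsto_integral_of_dominated_convergence (fun x => ‖conj (p m x) * B x‖) (fun n => ?_)
    (integrable_conj_mul (p m) hB).norm (fun n => ?_) ?_
  · exact (((Lp.aestronglyMeasurable (p m)).star).mul ((hFs n).aestronglyMeasurable m))
  · filter_upwards [hb n] with x hx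
    rw [norm_mul, norm_mul]
    gcongr
  · filter_upwards [hl m] with x hx using hx.const_mul _

/-- A closed subspace contains dominated pointwise limits of its elements. -/
lemma RepIn.of_dominated {K : Submodule ℂ (Hilb N × Hilb N)}
    (hK : IsClosed (K : Set (Hilb N × Hilb N))) {F H : Fn N} {Fs Hs : ℕ → Fn N}
    (h : ∀ n, RepIn K (Fs n) (Hs n))
    (hFb : ∀ m, ∃ B : ℝ → ℂ, MemLp B 2 ∧ ∀ n, ∀ᵐ x : ℝ, ‖Fs n x m‖ ≤ ‖B x‖)
    (hFl : ∀ m, ∀ᵐ x : ℝ, Tendsto (fun n => Fs n x m) atTop (𝓝 (F x m)))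
    (hHb : ∀ m, ∃ B : ℝ → ℂ, MemLp B 2 ∧ ∀ n, ∀ᵐ x : ℝ, ‖Hs n x m‖ ≤ ‖B x‖)
    (hHl : ∀ m, ∀ᵐ x : ℝ, Tendsto (fun n => Hs n x m) atTop (𝓝 (H x m))) :
    RepIn K F H := by
  choose fs hs h1 h2 h3 using h
  have aux : ∀ (G : Fn N) (Gs : ℕ → Fn N) (gs : ℕ → Hilb N), (∀ n, Rep (Gs n) (gs n)) →
      (∀ m, ∃ B : ℝ → ℂ, MemLp B 2 ∧ ∀ n, ∀ᵐ x : ℝ, ‖Gs n x m‖ ≤ ‖B x‖) →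
      (∀ m, ∀ᵐ x : ℝ, Tendsto (fun n => Gs n x m) atTop (𝓝 (G x m))) →
      ∃ g : Hilb N, Rep G g := by
    intro G Gs gs hr hb hl
    have : ∀ m, MemLp (fun x : ℝ => G x m) 2 := fun m => by
      obtain ⟨B, hB, hb⟩ := hb m
      refine hB.mono (aestronglyMeasurable_of_tendsto_ae atTop
        (fun n => (hr n).aestronglyMeasurable m) (hl m)) ?_
      filter_upwards [hl m, ae_all_iff.2 hb] with x hx hbx
      exact le_of_tendsto hx.norm (Eventually.of_forall hbx)
    exact ⟨WithLp.toLp 2 fun m => (this m).toLp _, fun m => (this m).coeFn_toLp⟩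
  obtain ⟨f, hf⟩ := aux F Fs fs h1 hFb hFl
  obtain ⟨g, hg⟩ := aux H Hs hs h2 hHb hHl
  refine ⟨f, g, hf, hg, mem_of_forall_inner hK fun p r hpr => ?_⟩
  have t := (tendsto_inner_of_dominated hf h1 hFb hFl p).add
    (tendsto_inner_of_dominated hg h2 hHb hHl r)
  simp_rw [fun n => hpr _ _ (h3 n)] at t
  exact (tendsto_nhds_unique tendsto_const_nhds t).symm

/-- Fubini. A Gaussian bound in |x| + |t| is dominated by a product of a Gaussian in x and one in t,
and the former is paired with `p` in L². -/
lemma integral_inner_of_gaussBdd {w : ℝ → Fn N} {v : ℝ → Hilb N} {V : Hilb N}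
    (hv : ∀ t, Rep (w t) (v t)) (hc : ∀ m, Continuous fun z : ℝ × ℝ => w z.2 z.1 m)
    (hb : ∀ m, GaussBdd (fun z : ℝ × ℝ => |z.1| + |z.2|) fun z => w z.2 z.1 m)
    (hV : Rep (fun μ m => ∫ t, w t μ m) V) (p : Hilb N) :
    inner ℂ p V = ∫ t, (inner ℂ p (v t) : ℂ) := by
  rw [inner_eq_of_rep hV]
  simp_rw [fun t => inner_eq_of_rep (hv t) p]
  have hint : ∀ m, Integrable (fun z : ℝ × ℝ => conj (p m z.1) * w z.2 z.1 m)
      (volume.prod volume) := fun m => by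
    obtain ⟨C, δ, hC, hδ, hb⟩ := (hb m).exists_nonneg
    have hG : MemLp (fun x : ℝ => ((Real.exp (-δ * x ^ 2) : ℝ) : ℂ)) 2 := by
      refine GaussBdd.memLp_two (GaussBdd.of_exp_neg hδ fun a => ?_)
        (Continuous.aestronglyMeasurable (by fun_prop))
      rw [Complex.norm_real, Real.norm_eq_abs, Real.abs_exp]
      rfl
    have h1 := (integrable_conj_mul (p m) hG).mul_prod
      ((integrable_exp_neg_mul_sq hδ).ofReal (𝕜 := ℂ))
    refine (h1.norm.const_mul C).mono' ?_ (ae_of_all _ fun z => ?_)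
    · exact ((Lp.aestronglyMeasurable (p m)).star.comp_fst).mul (hc m).aestronglyMeasurable
    · rw [norm_mul, norm_mul, norm_mul]
      calc ‖conj (p m z.1)‖ * ‖w z.2 z.1 m‖
          ≤ ‖conj (p m z.1)‖ * (C * Real.exp (-δ * (|z.1| + |z.2|) ^ 2)) := by
            gcongr
            exact hb z
        _ ≤ ‖conj (p m z.1)‖ * (C * (Real.exp (-δ * z.1 ^ 2) * Real.exp (-δ * z.2 ^ 2))) := by
            gcongr
            rw [← Real.exp_add]
            gcongr
            have h2 := sq_abs z.1
            have h3 := sq_abs z.2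
            have h4 : 0 ≤ |z.1| * |z.2| := by positivity
            nlinarith
        _ = _ := by
            simp only [Complex.norm_real, Real.norm_eq_abs, Real.abs_exp, RCLike.norm_ofReal]
            ring
  rw [integral_finsetSum _ fun m _ => (hint m).integral_prod_right]
  refine Finset.sum_congr rfl fun m _ => ?_
  simp_rw [← integral_const_mul]
  exact integral_integral_swap (hint m)

/-- A closed subspace contains the integrals of its elements. -/
lemma RepIn.integral {K : Submodule ℂ (Hilb N × Hilb N)}
    (hK : IsClosed (K : Set (Hilb N × Hilb N))) {w u : ℝ → Fn N}
    (h : ∀ t, RepIn K (w t) (u t)) (hwc : ∀ m, Continuous fun z : ℝ × ℝ => w z.2 z.1 m)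
    (hwb : ∀ m, GaussBdd (fun z : ℝ × ℝ => |z.1| + |z.2|) fun z => w z.2 z.1 m)
    (huc : ∀ m, Continuous fun z : ℝ × ℝ => u z.2 z.1 m)
    (hub : ∀ m, GaussBdd (fun z : ℝ × ℝ => |z.1| + |z.2|) fun z => u z.2 z.1 m) :
    RepIn K (fun μ m => ∫ t, w t μ m) (fun μ m => ∫ t, u t μ m) := by
  choose v v' h1 h2 h3 using h
  have aux : ∀ w : ℝ → Fn N, (∀ m, Continuous fun z : ℝ × ℝ => w z.2 z.1 m) →
      (∀ m, GaussBdd (fun z : ℝ × ℝ => |z.1| + |z.2|) fun z => w z.2 z.1 m) →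
      ∃ V : Hilb N, Rep (fun μ m => ∫ t, w t μ m) V := by
    intro w hc hb
    refine exists_rep_of_gaussBdd (fun m => ?_) fun m => ?_
    · exact AEStronglyMeasurable.integral_prod_right' (f := fun z : ℝ × ℝ => w z.2 z.1 m)
        (hc m).aestronglyMeasurable
    · obtain ⟨C, δ, hC, hδ, hb⟩ := (hb m).exists_nonneg
      refine ⟨C * ∫ t, Real.exp (-δ * t ^ 2), δ, hδ, fun x => ?_⟩
      refine (norm_integral_le_of_norm_le (g := fun t : ℝ =>
        C * Real.exp (-δ * x ^ 2) * Real.exp (-δ * t ^ 2))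
        ((integrable_exp_neg_mul_sq hδ).const_mul _) (ae_of_all _ fun t => ?_)).trans ?_
      · refine (hb (x, t)).trans ?_
        rw [mul_assoc, ← Real.exp_add]
        gcongr
        have h2 := sq_abs x
        have h3 := sq_abs t
        have h4 : 0 ≤ |x| * |t| := by positivity
        simp only
        nlinarith
      · rw [integral_const_mul]
        simp only [id]
        exact le_of_eq (by ring)
  obtain ⟨V, hV⟩ := aux w hwc hwb
  obtain ⟨U, hU⟩ := aux u huc hub
  refine ⟨V, U, hV, hU, mem_of_forall_inner hK fun p r hpr => ?_⟩
  rw [integral_inner_of_gaussBdd h1 hwc hwb hV, integral_inner_of_gaussBdd h2 huc hub hU]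
  have h4 : ∀ t, (inner ℂ p (v t) : ℂ) = - inner ℂ r (v' t) :=
    fun t => eq_neg_of_add_eq_zero_left (hpr _ _ (h3 t))
  simp_rw [h4]
  rw [integral_neg]
  ring

end rep

end LevelN

namespace LevelN

open Filter Topology

set_option linter.unusedSectionVars false

/-! ### Shifts of contours -/

/-- The closed strip between the real line and `Im z = h`. -/
def strip (h : ℝ) : Set ℂ := {z | z.im ∈ Set.uIcc 0 h}

/-- Cauchy's theorem on the rectangles with vertical sides at ±T; the Gaussian bound makes those
sides vanish as T → ∞. The real part of `s` is a mere translation, and `uIcc` allows either sign of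
Im s. -/
lemma integral_add_eq_integral {f : ℂ → ℂ} {s : ℂ}
    (hd : ∀ z ∈ strip s.im, DifferentiableAt ℂ f z)
    (hb : GaussBdd (fun z : strip s.im => z.1.re) fun z => f z) :
    ∫ x : ℝ, f (x + s) = ∫ x : ℝ, f x := by
  set h := s.im with hh
  have hline : ∀ y ∈ Set.uIcc 0 h, Continuous fun x : ℝ => f (x + y * I) := by
    intro y hy
    rw [continuous_iff_continuousAt]
    intro x
    have h1 : ContinuousAt f (x + y * I) := (hd _ (by simpa [strip] using hy)).continuousAt
    exact ContinuousAt.comp (f := fun x : ℝ => (x + y * I : ℂ)) h1 (by fun_prop)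
  have hint : ∀ y ∈ Set.uIcc 0 h, Integrable fun x : ℝ => f (x + y * I) := by
    intro y hy
    refine GaussBdd.integrable ?_ (hline y hy).aestronglyMeasurable
    obtain ⟨C, δ, hδ, hb⟩ := hb
    refine ⟨C, δ, hδ, fun x => ?_⟩
    simpa using hb ⟨x + y * I, by simpa [strip] using hy⟩
  have h0 : (0 : ℝ) ∈ Set.uIcc 0 h := Set.left_mem_uIcc
  have h1 : h ∈ Set.uIcc 0 h := Set.right_mem_uIcc
  have e1 : ∫ x : ℝ, f (x + s) = ∫ x : ℝ, f (x + h * I) := by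
    rw [← integral_add_right_eq_self (fun x : ℝ => f (x + h * I)) s.re]
    congr 1
    ext x
    congr 1
    conv_lhs => rw [← re_add_im s]
    push_cast
    ring
  have rect : ∀ T : ℝ, (∫ x in (-T)..T, f x) - (∫ x in (-T)..T, f (x + h * I))
      + I * (∫ y in (0 : ℝ)..h, f (T + y * I)) - I * (∫ y in (0 : ℝ)..h, f (-T + y * I)) = 0 := by
    intro T
    have := integral_boundary_rect_eq_zero_of_differentiableOn f (-T : ℂ) (T + h * I) (by
      intro z hz
      refine (hd z ?_).differentiableWithinAt
      have := hz.2
      simpa [strip] using this)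
    simpa only [neg_im, ofReal_im, neg_zero, ofReal_zero, zero_mul, add_zero, neg_re,
      ofReal_re, add_re, mul_re, I_re, mul_zero, I_im, tsub_zero, add_im, mul_im,
      mul_one, zero_add, smul_eq_mul, ofReal_neg] using this
  obtain ⟨C, δ, hC, hδ, hb⟩ := hb.exists_nonneg
  have vert : ∀ (ε : ℝ), |ε| = 1 → Tendsto (fun T : ℝ =>
      I * ∫ y in (0 : ℝ)..h, f ((ε * T : ℝ) + y * I)) atTop (𝓝 0) := by
    intro ε hε
    have hsq : ε ^ 2 = 1 := by rw [← sq_abs, hε]; norm_num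
    refine squeeze_zero_norm (a := fun T : ℝ => C * Real.exp (-δ * T ^ 2) * |h - 0|)
      (fun T => ?_) ?_
    · rw [norm_mul, norm_I, one_mul]
      refine intervalIntegral.norm_integral_le_of_norm_le_const fun y hy => ?_
      have := hb ⟨(ε * T : ℝ) + y * I, by
        simpa [strip] using Set.uIoc_subset_uIcc hy⟩
      have e2 : ((ε * T : ℝ) + y * I : ℂ).re = ε * T := by simp
      simp only [e2] at this
      rwa [mul_pow, hsq, one_mul] at this
    · have : Tendsto (fun T : ℝ => Real.exp (-δ * T ^ 2)) atTop (𝓝 0) := by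
        refine Real.tendsto_exp_atBot.comp ?_
        have := (tendsto_pow_atTop (α := ℝ) two_ne_zero).const_mul_atTop_of_neg (neg_lt_zero.2 hδ)
        simpa using this
      simpa using (this.const_mul C).mul_const |h - 0|
  have l1 := intervalIntegral_tendsto_integral (hint 0 h0) tendsto_neg_atTop_atBot tendsto_id
  have l2 := intervalIntegral_tendsto_integral (hint h h1) tendsto_neg_atTop_atBot tendsto_id
  have v1 := vert 1 (by simp)
  have v2 := vert (-1) (by simp)
  have L := ((l1.sub l2).add v1).sub v2
  simp only [ofReal_zero, zero_mul, add_zero, id] at L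
  have : (fun T : ℝ => (∫ x in (-T)..T, f x) - (∫ x in (-T)..T, f (x + h * I))
      + I * (∫ y in (0 : ℝ)..h, f ((1 * T : ℝ) + y * I))
      - I * (∫ y in (0 : ℝ)..h, f ((-1 * T : ℝ) + y * I))) = fun _ => 0 := by
    ext T
    rw [← rect T]
    simp
  rw [this] at L
  have := tendsto_nhds_unique L tendsto_const_nhds
  rw [e1]
  linear_combination -this

/-! ### The Gaussian kernel -/

/-- The heat kernel `n exp(-π n² z²)`. -/
noncomputable def heat (n : ℕ) (z : ℂ) : ℂ := (n + 1) * exp (-Real.pi * ((n + 1) * z) ^ 2)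

/-- Rescaling moves the dependence on n from the kernel to the argument of `H`, so that one fixed
Gaussian serves both for uniform bounds and for the limit. -/
lemma heat_sub_eq (n : ℕ) (H : ℝ → ℂ) (x : ℝ) :
    ∫ t : ℝ, H t * heat n (x - t) = ∫ τ : ℝ, H (x - τ / (n + 1)) * exp (-Real.pi * τ ^ 2) := by
  have hn : (0 : ℝ) < n + 1 := by positivity
  rw [← integral_sub_left_eq_self (fun t : ℝ => H t * heat n (x - t)) volume x]
  have := Measure.integral_comp_div (fun τ : ℝ => H (x - τ) * heat n (x - (x - τ : ℝ))) (n + 1 : ℝ)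
  rw [abs_of_pos hn] at this
  have e : ∫ t : ℝ, H (x - t) * heat n (x - (x - t : ℝ))
      = ((n : ℝ) + 1)⁻¹ • ∫ τ : ℝ, H (x - τ / (n + 1)) * heat n (x - (x - τ / (n + 1) : ℝ)) := by
    rw [this, inv_smul_smul₀ hn.ne']
  rw [e, ← integral_smul]
  congr 1
  ext τ
  have hn' : (n + 1 : ℂ) ≠ 0 := by exact_mod_cast hn.ne'
  simp only [heat, real_smul]
  push_cast
  have e3 : (n + 1 : ℂ) * (x - (x - τ / (n + 1))) = τ := by field_simp; ring
  rw [e3]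
  field_simp

lemma heat_conv_bound {H : ℝ → ℂ} (hb : GaussBdd id H) :
    GaussBdd (fun z : ℕ × ℝ => z.2) fun z => ∫ t : ℝ, H t * heat z.1 (z.2 - t) := by
  obtain ⟨C, δ₀, hC, hδ₀, hb⟩ := hb.exists_nonneg
  -- The inequality z²/2 - u² ≤ (z - u)² loses δu² ≤ τ² once δ ≤ 1, and exp(-πτ²) absorbs this loss
  -- with exp(-τ²) still left to integrate.
  set δ := min δ₀ 1 with hδdef
  have hδ : 0 < δ := lt_min hδ₀ one_pos
  have hδ1 : δ ≤ 1 := min_le_right _ _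
  have hb' : ∀ a, ‖H a‖ ≤ C * Real.exp (-δ * a ^ 2) := fun a => (hb a).trans (by
    simp only [id]
    gcongr
    exact min_le_left _ _)
  refine ⟨C * ∫ τ : ℝ, Real.exp (-1 * τ ^ 2), δ / 2, by positivity, fun z => ?_⟩
  beta_reduce
  rw [heat_sub_eq]
  refine (norm_integral_le_of_norm_le (g := fun τ : ℝ =>
    C * Real.exp (-(δ / 2) * z.2 ^ 2) * Real.exp (-1 * τ ^ 2))
    ((integrable_exp_neg_mul_sq one_pos).const_mul _) (ae_of_all _ fun τ => ?_)).trans ?_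
  · rw [norm_mul, mul_assoc, ← Real.exp_add]
    have hn : (1 : ℝ) ≤ z.1 + 1 := by
      have : (0 : ℝ) ≤ z.1 := by positivity
      linarith
    set u := τ / ((z.1 : ℝ) + 1) with hu
    have h1 : u ^ 2 ≤ τ ^ 2 := by
      rw [hu, div_pow]
      exact div_le_self (sq_nonneg _) (one_le_pow₀ hn)
    have h2 : ‖exp (-Real.pi * (τ : ℂ) ^ 2)‖ = Real.exp (-Real.pi * τ ^ 2) := by
      rw [← Complex.ofReal_pow, ← Complex.ofReal_neg, ← Complex.ofReal_mul, Complex.norm_exp_ofReal]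
    rw [h2]
    calc ‖H (z.2 - u)‖ * Real.exp (-Real.pi * τ ^ 2)
        ≤ C * Real.exp (-δ * (z.2 - u) ^ 2) * Real.exp (-Real.pi * τ ^ 2) := by
          gcongr
          exact hb' _
      _ = C * Real.exp (-δ * (z.2 - u) ^ 2 + -Real.pi * τ ^ 2) := by rw [Real.exp_add]; ring
      _ ≤ _ := by
          refine mul_le_mul_of_nonneg_left (Real.exp_le_exp.2 ?_) hC
          have h3 := Real.pi_gt_three
          have h4 : z.2 ^ 2 / 2 - u ^ 2 ≤ (z.2 - u) ^ 2 := by nlinarith [sq_nonneg (z.2 - 2 * u)]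
          have h5 : δ * (z.2 ^ 2 / 2 - u ^ 2) ≤ δ * (z.2 - u) ^ 2 := by gcongr
          have h6 : δ * u ^ 2 ≤ 1 * τ ^ 2 := by gcongr
          nlinarith [sq_nonneg τ]
  · rw [integral_const_mul]
    exact le_of_eq (by ring)

lemma heat_conv_tendsto {H : ℝ → ℂ} (hc : Continuous H) (hb : GaussBdd id H) (x : ℝ) :
    Tendsto (fun n : ℕ => ∫ t : ℝ, H t * heat n (x - t)) atTop (𝓝 (H x)) := by
  simp_rw [fun n => heat_sub_eq n H x]
  have e : H x = ∫ τ : ℝ, H x * exp (-Real.pi * τ ^ 2) := by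
    rw [integral_const_mul, integral_gaussian_complex (b := Real.pi) (by simpa using Real.pi_pos),
      div_self (by simp)]
    simp
  rw [e]
  obtain ⟨C, δ, hC, hδ, hb⟩ := hb.exists_nonneg
  have hg : Integrable fun τ : ℝ => exp (-Real.pi * (τ : ℂ) ^ 2) :=
    integrable_cexp_neg_mul_sq (b := Real.pi) (by simpa using Real.pi_pos)
  refine tendsto_integral_of_dominated_convergence
    (fun τ => C * ‖exp (-Real.pi * (τ : ℂ) ^ 2)‖) (fun n => ?_) (hg.norm.const_mul C)
    (fun n => ae_of_all _ fun τ => ?_) (ae_of_all _ fun τ => ?_)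
  · exact Continuous.aestronglyMeasurable (by fun_prop)
  · rw [norm_mul]
    gcongr
    refine (hb _).trans ?_
    refine mul_le_of_le_one_right hC (Real.exp_le_one_iff.2 ?_)
    have := sq_nonneg (x - τ / ((n : ℝ) + 1))
    simp only [id]
    nlinarith
  · refine Tendsto.mul_const _ ((hc.tendsto x).comp ?_)
    have : Tendsto (fun n : ℕ => τ * (1 / ((n : ℝ) + 1))) atTop (𝓝 (τ * 0)) :=
      tendsto_one_div_add_atTop_nhds_zero_nat.const_mul τ
    have := this.const_sub x
    simpa [div_eq_mul_inv] using this

end LevelN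

namespace LevelN

open Filter Topology

set_option linter.unusedSectionVars false

/-! ### Gaussian functions -/

/-- The span of the functions `exp(-α μ² + β μ) P(μ)` with `Re α > A`. -/
def gaussFnGt (N : ℕ) (A : ℝ) : Submodule ℂ (Fn N) :=
  Submodule.span ℂ {F | ∃ (α β : ℂ) (P : Polynomial ℂ) (k : ZMod N), A < α.re ∧
    F = fun μ m => if m = k then exp (-α * μ ^ 2 + β * μ) * P.eval μ else 0}

variable {N : ℕ}

lemma gaussFnGt_mono {A B : ℝ} (h : A ≤ B) : gaussFnGt N B ≤ gaussFnGt N A :=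
  Submodule.span_mono fun _ ⟨α, β, P, k, h1, h2⟩ => ⟨α, β, P, k, h.trans_lt h1, h2⟩

lemma gaussFnGt_le {A : ℝ} (h : 0 ≤ A) : gaussFnGt N A ≤ gaussFn N := gaussFnGt_mono h

lemma differentiable_of_mem_gaussFn {F : Fn N} (hF : F ∈ gaussFn N) (m : ZMod N) :
    Differentiable ℂ fun z => F z m := by
  induction hF using Submodule.span_induction with
  | mem F hF =>
    obtain ⟨α, β, P, k, hα, rfl⟩ := hF
    by_cases h : m = k
    · simp only [h, if_true]
      fun_prop
    · simp only [h, if_false]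
      fun_prop
  | zero => exact differentiable_const _
  | add F G _ _ h1 h2 => exact h1.add h2
  | smul c F _ h => exact h.const_mul c

lemma polynomial_growth (P : Polynomial ℂ) : ∃ C, 0 ≤ C ∧ ∀ z, ‖P.eval z‖ ≤ C * Real.exp ‖z‖ := by
  refine ⟨∑ i ∈ Finset.range (P.natDegree + 1), ‖P.coeff i‖ * i.factorial, by positivity,
    fun z => ?_⟩
  rw [Polynomial.eval_eq_sum_range, Finset.sum_mul]
  refine (norm_sum_le _ _).trans (Finset.sum_le_sum fun i _ => ?_)
  rw [norm_mul, norm_pow, mul_assoc]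
  gcongr
  have := Real.pow_div_factorial_le_exp ‖z‖ (norm_nonneg z) i
  rwa [div_le_iff₀' (by positivity)] at this

lemma norm_le_abs_re_add (z : ℂ) : ‖z‖ ≤ |z.re| + |z.im| := Complex.norm_le_abs_re_add_abs_im z

/-- The growth allowed in horizontal strips: multiplication by `exp(-α z²)` yields a Gaussian
bound. -/
lemma gaussBdd_strip {α β : ℂ} {A C : ℝ} (H : ℝ) (hα : A < α.re) {g : ℂ → ℂ} (c : ℝ)
    (hg : ∀ z, ‖g z‖ ≤ C * Real.exp (A * ‖z‖ ^ 2 + c * ‖z‖)) :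
    GaussBdd (fun z : {z : ℂ // |z.im| ≤ H} => z.1.re)
      fun z => exp (-α * z.1 ^ 2 + β * z.1) * g z.1 := by
  -- The quadratic terms in Re z combine to the rate Re α - A. All the rest is at most linear in |Re
  -- z|, because |Im z| ≤ H, and is left to `mul_growth`.
  have h1 : GaussBdd (fun z : {z : ℂ // |z.im| ≤ H} => z.1.re)
      fun z => ((Real.exp (-(α.re - A) * z.1.re ^ 2) : ℝ) : ℂ) :=
    ⟨1, α.re - A, by linarith, fun z => by
      rw [Complex.norm_real, Real.norm_eq_abs, Real.abs_exp, one_mul]⟩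
  have h2 := h1.mul_growth (C := |C| * Real.exp ((|A| + |α.re|) * H ^ 2 + (|c| + ‖β‖) * H))
    (c := 2 * |α.im| * H + |c| + ‖β‖)
    (g := fun z => ((|C| * Real.exp (A * z.1.im ^ 2 + α.re * z.1.im ^ 2
      + 2 * |α.im| * H * |z.1.re| + (|c| + ‖β‖) * (|z.1.re| + |z.1.im|)) : ℝ) : ℂ))
    (fun z => by
      rw [Complex.norm_real, Real.norm_eq_abs, abs_mul, abs_abs, Real.abs_exp, mul_assoc |C|,
        ← Real.exp_add]
      refine mul_le_mul_of_nonneg_left (Real.exp_le_exp.2 ?_) (abs_nonneg _)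
      have hz := z.2
      have hH : 0 ≤ H := (abs_nonneg _).trans hz
      have hsq : z.1.im ^ 2 ≤ H ^ 2 := by
        rw [← sq_abs]
        gcongr
      have e1 : A * z.1.im ^ 2 ≤ |A| * H ^ 2 :=
        mul_le_mul (le_abs_self _) hsq (sq_nonneg _) (abs_nonneg _)
      have e2 : α.re * z.1.im ^ 2 ≤ |α.re| * H ^ 2 :=
        mul_le_mul (le_abs_self _) hsq (sq_nonneg _) (abs_nonneg _)
      have e3 : (|c| + ‖β‖) * |z.1.im| ≤ (|c| + ‖β‖) * H := by gcongr
      nlinarith)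
  refine h2.mono fun z => ?_
  rw [norm_mul, norm_mul, Complex.norm_real, Complex.norm_real, Real.norm_eq_abs,
    Real.norm_eq_abs, abs_mul, abs_abs, Real.abs_exp, Real.abs_exp, mul_assoc, ← Real.exp_add,
    Complex.norm_exp]
  obtain ⟨z, hz⟩ := z
  have hH : 0 ≤ H := (abs_nonneg _).trans hz
  have hn : ‖z‖ ^ 2 = z.re ^ 2 + z.im ^ 2 := by
    rw [← normSq_eq_norm_sq, normSq_apply]; ring
  have hn1 := norm_le_abs_re_add z
  have hβ : (β * z).re ≤ ‖β‖ * (|z.re| + |z.im|) :=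
    (re_le_norm _).trans ((norm_mul _ _).le.trans (by gcongr))
  have hc : c * ‖z‖ ≤ |c| * (|z.re| + |z.im|) :=
    mul_le_mul (le_abs_self _) hn1 (norm_nonneg _) (abs_nonneg _)
  have hα' : (-α * z ^ 2).re ≤ -α.re * z.re ^ 2 + α.re * z.im ^ 2 + 2 * |α.im| * H * |z.re| := by
    have e : (-α * z ^ 2).re = -α.re * z.re ^ 2 + α.re * z.im ^ 2 + 2 * (α.im * z.im * z.re) := by
      simp [sq]
      ring
    have e2 : α.im * z.im * z.re ≤ |α.im| * H * |z.re| := by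
      refine (le_abs_self _).trans ?_
      rw [abs_mul, abs_mul]
      gcongr
    rw [e]
    linarith
  calc Real.exp ((-α * z ^ 2 + β * z).re) * ‖g z‖
      ≤ Real.exp ((-α * z ^ 2 + β * z).re) * (|C| * Real.exp (A * ‖z‖ ^ 2 + c * ‖z‖)) := by
        gcongr
        exact (hg z).trans (by gcongr; exact le_abs_self C)
    _ = |C| * Real.exp ((-α * z ^ 2 + β * z).re + (A * ‖z‖ ^ 2 + c * ‖z‖)) := by
        rw [Real.exp_add ((-α * z ^ 2 + β * z).re)]; ring
    _ ≤ _ := by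
        refine mul_le_mul_of_nonneg_left (Real.exp_le_exp.2 ?_) (abs_nonneg _)
        rw [hn, add_re]
        nlinarith

lemma gaussBdd_of_mem_gaussFn {F : Fn N} (hF : F ∈ gaussFn N) (H : ℝ) (m : ZMod N) :
    GaussBdd (fun z : {z : ℂ // |z.im| ≤ H} => z.1.re) fun z => F z.1 m := by
  induction hF using Submodule.span_induction with
  | mem F hF =>
    obtain ⟨α, β, P, k, hα, rfl⟩ := hF
    by_cases h : m = k
    · simp only [h, if_true]
      obtain ⟨C, hC, hP⟩ := polynomial_growth P
      exact gaussBdd_strip H hα 1 (g := fun z => P.eval z) (C := C) (by simpa using hP)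
    · simp only [h, if_false]
      exact .zero
  | zero => exact .zero
  | add F G _ _ h1 h2 => exact h1.add h2
  | smul c F _ h => exact h.const_mul c

/-- A Gaussian bound in the strip of half-width `|Im w|` is one on `ℝ + w`. -/
lemma GaussBdd.line {f : ℂ → ℂ} {w : ℂ} {S : Set ℂ} (h : GaussBdd (fun z : S => z.1.re)
    fun z => f z) (hS : ∀ x : ℝ, (x + w : ℂ) ∈ S) : GaussBdd id fun x : ℝ => f (x + w) := by
  have h1 := h.comp fun x : ℝ => (⟨x + w, hS x⟩ : S)
  refine GaussBdd.change (r := (fun z : S => z.1.re) ∘ fun x : ℝ => (⟨x + w, hS x⟩ : S))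
    h1 1 |w.re| fun a => ?_
  have : a = (a + w.re) - w.re := by ring
  calc |id a| = |(a + w.re) - w.re| := by simp
    _ ≤ |a + w.re| + |w.re| := abs_sub _ _
    _ = _ := by simp

lemma gaussBdd_line_of_mem_gaussFn {F : Fn N} (hF : F ∈ gaussFn N) (w : ℂ) (m : ZMod N) :
    GaussBdd id fun x : ℝ => F (x + w) m :=
  (gaussBdd_of_mem_gaussFn hF |w.im| m).line (S := {z | |z.im| ≤ |w.im|}) (f := fun z => F z m)
    (fun x => by simp)

lemma continuous_line_of_mem_gaussFn {F : Fn N} (hF : F ∈ gaussFn N) (w : ℂ) (m : ZMod N) :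
    Continuous fun x : ℝ => F (x + w) m :=
  (differentiable_of_mem_gaussFn hF m).continuous.comp (by fun_prop)

/-! ### Operators composed of shifts and multiplications by exponentials -/

/-- The operator `F ↦ a(m) e^(γ μ) F(μ + z, m + k)`. -/
noncomputable def termOp (z : ℂ) (k : ZMod N) (γ : ℂ) (a : ZMod N → ℂ) : FnOp N :=
  mulOp (fun μ m => a m * exp (γ * μ)) * shiftOp z k

lemma termOp_apply (z : ℂ) (k : ZMod N) (γ : ℂ) (a : ZMod N → ℂ) (F : Fn N) (μ : ℂ) (m : ZMod N) :
    termOp z k γ a F μ m = a m * exp (γ * μ) * F (μ + z) (m + k) := rfl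

/-- The span of the operators `F ↦ a(m) e^(γ μ) F(μ + z, m + k)` with `z ∈ S`. -/
def termSpan (N : ℕ) (S : Set ℂ) : Submodule ℂ (FnOp N) :=
  Submodule.span ℂ {X | ∃ z ∈ S, ∃ k γ a, X = termOp z k γ a}

lemma termOp_mem {S : Set ℂ} {z : ℂ} (hz : z ∈ S) (k : ZMod N) (γ : ℂ) (a : ZMod N → ℂ) :
    termOp z k γ a ∈ termSpan N S := Submodule.subset_span ⟨z, hz, k, γ, a, rfl⟩

lemma exp_growth (γ : ℂ) (c : ℂ) (x : ℝ) : ‖c * exp (γ * x)‖ ≤ ‖c‖ * Real.exp (‖γ‖ * |x|) := by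
  rw [norm_mul, Complex.norm_exp]
  gcongr
  refine (re_le_norm _).trans ?_
  rw [norm_mul, Complex.norm_real, Real.norm_eq_abs]

lemma GaussBdd.mul_exp {α : Type*} {r : α → ℝ} {f : α → ℂ} (hf : GaussBdd r f) (c γ : ℂ)
    (x : α → ℝ) (hx : ∀ p, |x p| ≤ |r p|) :
    GaussBdd r fun p => c * exp (γ * x p) * f p := by
  refine hf.mul_growth (C := ‖c‖) (c := ‖γ‖) fun p => (exp_growth γ c (x p)).trans ?_
  exact mul_le_mul_of_nonneg_left (Real.exp_le_exp.2
    (mul_le_mul_of_nonneg_left (hx p) (norm_nonneg γ))) (norm_nonneg c)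

/-- `X F` only depends on `F` up to null sets on the horizontal lines. -/
lemma ae_congr_of_mem_termSpan {S : Set ℂ} {X : FnOp N} (hX : X ∈ termSpan N S) {F G : Fn N}
    (h : ∀ z ∈ S, ∀ m, ∀ᵐ x : ℝ, F (x + z) m = G (x + z) m) (m : ZMod N) :
    ∀ᵐ x : ℝ, X F x m = X G x m := by
  induction hX using Submodule.span_induction with
  | mem X hX =>
    obtain ⟨z, hz, k, γ, a, rfl⟩ := hX
    filter_upwards [h z hz (m + k)] with x hx
    rw [termOp_apply, termOp_apply, hx]
  | zero => simp
  | add X Y _ _ h1 h2 =>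
    filter_upwards [h1, h2] with x e1 e2
    simp [e1, e2]
  | smul c X _ h1 =>
    filter_upwards [h1] with x e1
    simp [e1]

/-- The functions `Fs n` converge to `F` on the lines `ℝ + z`, `z ∈ S`, with Gaussian bounds. -/
structure GaussTendsto (S : Set ℂ) (Fs : ℕ → Fn N) (F : Fn N) : Prop where
  bdd : ∀ z ∈ S, ∀ m, GaussBdd (fun p : ℕ × ℝ => p.2) fun p => Fs p.1 (p.2 + z) m
  lim : ∀ z ∈ S, ∀ m, ∀ x : ℝ, Tendsto (fun n => Fs n (x + z) m) atTop (𝓝 (F (x + z) m))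

/-- Operators in `termSpan N S` see a function only on the lines ℝ + z with z ∈ S, and their
exponential coefficients do not destroy Gaussian bounds. -/
lemma GaussTendsto.map {S : Set ℂ} {Fs : ℕ → Fn N} {F : Fn N} (h : GaussTendsto S Fs F)
    {X : FnOp N} (hX : X ∈ termSpan N S) (m : ZMod N) :
    (GaussBdd (fun p : ℕ × ℝ => p.2) fun p => X (Fs p.1) p.2 m) ∧
    ∀ x : ℝ, Tendsto (fun n => X (Fs n) x m) atTop (𝓝 (X F x m)) := by
  induction hX using Submodule.span_induction with
  | mem X hX =>
    obtain ⟨z, hz, k, γ, a, rfl⟩ := hX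
    simp only [termOp_apply]
    have h1 := (h.bdd z hz (m + k)).mul_exp (a m) γ (fun p => p.2) fun p => le_rfl
    exact ⟨h1, fun x => (h.lim z hz (m + k) x).const_mul _⟩
  | zero =>
    simp only [LinearMap.zero_apply, Pi.zero_apply]
    exact ⟨.zero, fun x => tendsto_const_nhds⟩
  | add X Y _ _ h1 h2 =>
    simp only [LinearMap.add_apply, Pi.add_apply]
    exact ⟨h1.1.add h2.1, fun x => (h1.2 x).add (h2.2 x)⟩
  | smul c X _ h1 =>
    simp only [LinearMap.smul_apply, Pi.smul_apply, smul_eq_mul]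
    exact ⟨h1.1.const_mul c, fun x => (h1.2 x).const_mul c⟩

lemma gaussTendsto_const {S : Set ℂ} {F : Fn N} (hF : F ∈ gaussFn N) :
    GaussTendsto S (fun _ => F) F where
  bdd z _ m := (gaussBdd_line_of_mem_gaussFn hF z m).comp Prod.snd
  lim _ _ _ _ := tendsto_const_nhds

lemma exists_dominating {Fs : ℕ → Fn N} {m : ZMod N}
    (h : GaussBdd (fun p : ℕ × ℝ => p.2) fun p => Fs p.1 p.2 m) :
    ∃ B : ℝ → ℂ, MemLp B 2 ∧ ∀ n, ∀ᵐ x : ℝ, ‖Fs n x m‖ ≤ ‖B x‖ := by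
  obtain ⟨C, δ, hC, hδ, h⟩ := h.exists_nonneg
  refine ⟨fun x => ((C * Real.exp (-δ * x ^ 2) : ℝ) : ℂ), ?_, fun n => ae_of_all _ fun x => ?_⟩
  · refine GaussBdd.memLp_two ⟨C, δ, hδ, fun x => ?_⟩
      (Continuous.aestronglyMeasurable (by fun_prop))
    rw [Complex.norm_real, Real.norm_eq_abs, abs_of_nonneg (by positivity)]
    rfl
  · rw [Complex.norm_real, Real.norm_eq_abs, abs_of_nonneg (by positivity)]
    exact h (n, x)

variable [NeZero N]

/-- A closed subspace containing the graph of `X` at `Fs n` contains it at the limit `F`. -/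
lemma RepIn.of_gaussTendsto {K : Submodule ℂ (Hilb N × Hilb N)}
    (hK : IsClosed (K : Set (Hilb N × Hilb N))) {S : Set ℂ} (h0 : (0 : ℂ) ∈ S) {X : FnOp N}
    (hX : X ∈ termSpan N S) {Fs : ℕ → Fn N} {F : Fn N} (h : GaussTendsto S Fs F)
    (hm : ∀ n, RepIn K (Fs n) (X (Fs n))) : RepIn K F (X F) := by
  refine RepIn.of_dominated hK hm (fun m => exists_dominating ?_) (fun m => ae_of_all _ ?_)
    (fun m => exists_dominating (h.map hX m).1) fun m => ae_of_all _ (h.map hX m).2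
  · simpa using h.bdd 0 h0 m
  · simpa using h.lim 0 h0 m

/-- The values of `X` on Gaussian functions are represented by vectors. -/
lemma exists_rep_of_mem_gaussFn {S : Set ℂ} {X : FnOp N} (hX : X ∈ termSpan N S) {F : Fn N}
    (hF : F ∈ gaussFn N) : ∃ f, Rep (X F) f := by
  refine exists_rep_of_gaussBdd (fun m => ?_) fun m => ?_
  · have : Continuous fun x : ℝ => X F x m := by
      induction hX using Submodule.span_induction with
      | mem X hX =>
        obtain ⟨z, hz, k, γ, a, rfl⟩ := hX
        have := continuous_line_of_mem_gaussFn hF z (m + k)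
        simp only [termOp_apply]
        exact (by fun_prop : Continuous fun x : ℝ => a m * exp (γ * x)).mul this
      | zero => exact continuous_const
      | add X Y _ _ h1 h2 => exact h1.add h2
      | smul c X _ h1 => exact h1.const_smul c
    exact this.aestronglyMeasurable
  · exact ((gaussTendsto_const hF).map hX m).1.comp fun x : ℝ => ((0 : ℕ), x)

lemma repIn_coreGraph {S : Set ℂ} {X : FnOp N} (hX : X ∈ termSpan N S) {F : Fn N}
    (hF : F ∈ gaussFn N) : RepIn (coreGraph X) F (X F) := by
  obtain ⟨g, hg⟩ := exists_rep_of_mem_gaussFn hX hF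
  -- The identity, written as a term with zero shift and zero exponent.
  obtain ⟨f, hf⟩ := exists_rep_of_mem_gaussFn
    (termOp_mem (S := {0}) (Set.mem_singleton _) 0 0 fun _ => 1) hF
  have hf' : Rep F f := hf.congr fun m => ae_of_all _ fun x => by simp [termOp_apply]
  exact ⟨f, g, hf', hg, F, hF, hf', hg⟩

lemma repIn_closedGraph {S : Set ℂ} {X : FnOp N} (hX : X ∈ termSpan N S) {F : Fn N}
    (hF : F ∈ gaussFn N) : RepIn (closedGraph X) F (X F) := by
  obtain ⟨f, g, h1, h2, h3⟩ := repIn_coreGraph hX hF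
  exact ⟨f, g, h1, h2, Submodule.le_topologicalClosure _ h3⟩

lemma isClosed_closedGraph (X : FnOp N) :
    IsClosed (closedGraph X : Set (Hilb N × Hilb N)) :=
  Submodule.isClosed_topologicalClosure _

/-! ### Analytic functions in a strip belong to the domain of the closure -/

/-- `F` is analytic in the closed strip between `ℝ` and `ℝ + i h`, with a Gaussian bound. -/
structure StripGauss (h : ℝ) (F : Fn N) : Prop where
  diff : ∀ m, ∀ z ∈ strip h, DifferentiableAt ℂ (fun z => F z m) z
  bdd : ∀ m, GaussBdd (fun z : strip h => z.1.re) fun z => F z.1 m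

namespace StripGauss

variable {s : ℂ} {F : Fn N}

lemma line_mem {z : ℂ} (hz : z ∈ ({0, s} : Set ℂ)) (x : ℝ) : (x + z : ℂ) ∈ strip s.im := by
  rcases hz with rfl | rfl <;> simp [strip]

lemma continuous_line (hF : StripGauss s.im F) {z : ℂ} (hz : z ∈ ({0, s} : Set ℂ)) (m : ZMod N) :
    Continuous fun x : ℝ => F (x + z) m := by
  rw [continuous_iff_continuousAt]
  intro x
  exact ContinuousAt.comp (f := fun x : ℝ => (x + z : ℂ))
    (hF.diff m _ (line_mem hz x)).continuousAt (by fun_prop)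

lemma bdd_line (hF : StripGauss s.im F) {z : ℂ} (hz : z ∈ ({0, s} : Set ℂ)) (m : ZMod N) :
    GaussBdd id fun x : ℝ => F (x + z) m :=
  (hF.bdd m).line (f := fun z => F z m) (line_mem hz)

lemma norm_heat_le (n : ℕ) (z : ℂ) :
    ‖heat n z‖ = (n + 1) * Real.exp (-(Real.pi * (n + 1) ^ 2) * (z.re ^ 2 - z.im ^ 2)) := by
  have h1 : ‖((n : ℂ) + 1)‖ = n + 1 := by
    rw [← Nat.cast_succ, Complex.norm_natCast, Nat.cast_succ]
  have h2 : (-Real.pi * (((n : ℂ) + 1) * z) ^ 2).re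
      = -(Real.pi * (n + 1) ^ 2) * (z.re ^ 2 - z.im ^ 2) := by
    have : (-Real.pi * (((n : ℂ) + 1) * z) ^ 2)
        = ((-(Real.pi * (n + 1) ^ 2) : ℝ) : ℂ) * (z ^ 2) := by push_cast; ring
    rw [this, Complex.re_ofReal_mul]
    simp [sq]
  rw [heat, norm_mul, h1, Complex.norm_exp, h2]

/-- The convolution with the heat kernel commutes with the shift by `s`. -/
lemma heat_conv_shift (hF : StripGauss s.im F) {z : ℂ} (hz : z ∈ ({0, s} : Set ℂ)) (m : ZMod N)
    (n : ℕ) (x : ℝ) :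
    ∫ t : ℝ, F t m * heat n (x + z - t) = ∫ t : ℝ, F (t + z) m * heat n (x - t) := by
  rcases hz with rfl | rfl
  · simp
  -- Moving the contour from ℝ to ℝ + z makes the argument of the kernel real again. In the strip
  -- the kernel is merely bounded; the decay comes from `F`.
  have := integral_add_eq_integral (s := z) (f := fun w => F w m * heat n (x + z - w))
    (fun w hw => (hF.diff m w hw).mul (by unfold heat; fun_prop)) ?_
  · rw [← this]
    congr 1
    ext t
    simp
  · have hbound : ∀ w : strip z.im,
        ‖heat n (x + z - w.1)‖ ≤ (n + 1) * Real.exp (Real.pi * (n + 1) ^ 2 * z.im ^ 2) := by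
      intro w
      rw [norm_heat_le]
      refine mul_le_mul_of_nonneg_left (Real.exp_le_exp.2 ?_) (by positivity)
      have h2 : (z.im - w.1.im) ^ 2 ≤ z.im ^ 2 := by
        have := w.2
        simp only [strip, Set.mem_ofPred_eq, Set.mem_uIcc] at this
        rcases this with h | h <;> nlinarith
      have h1 : -((x + z - w.1).re ^ 2 - (x + z - w.1).im ^ 2) ≤ z.im ^ 2 := by
        have e : (x + z - w.1).im = z.im - w.1.im := by simp
        rw [e]
        nlinarith [sq_nonneg ((x + z - w.1).re)]
      calc -(Real.pi * ((n : ℝ) + 1) ^ 2) * ((x + z - w.1).re ^ 2 - (x + z - w.1).im ^ 2)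
          = (Real.pi * ((n : ℝ) + 1) ^ 2) * -((x + z - w.1).re ^ 2 - (x + z - w.1).im ^ 2) := by
            ring
        _ ≤ _ := by gcongr
    have := (hF.bdd m).mul_bdd hbound
    exact this.mono fun a => by rw [mul_comm]

/-- The Gaussian functions whose integral over `t` is the convolution with the heat kernel. -/
noncomputable def heatFn (F : Fn N) (n : ℕ) (t : ℝ) : Fn N := fun μ m => F t m * heat n (μ - t)

lemma heatFn_mem (F : Fn N) (n : ℕ) (t : ℝ) : heatFn F n t ∈ gaussFn N := by
  have : heatFn F n t = ∑ k : ZMod N, (fun μ m => if m = k then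
      exp (-(Real.pi * (n + 1) ^ 2) * μ ^ 2 + (2 * Real.pi * (n + 1) ^ 2 * t) * μ) *
      (Polynomial.C (F t k * ((n + 1) * exp (-(Real.pi * (n + 1) ^ 2) * t ^ 2)))).eval μ
      else 0 : Fn N) := by
    ext μ m
    rw [Finset.sum_apply, Finset.sum_apply]
    simp only [Finset.sum_ite_eq, Finset.mem_univ, if_true, Polynomial.eval_C, heatFn, heat]
    have : exp (-Real.pi * (((n : ℂ) + 1) * (μ - t)) ^ 2)
        = exp (-(Real.pi * (n + 1) ^ 2) * μ ^ 2 + (2 * Real.pi * (n + 1) ^ 2 * t) * μ)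
          * exp (-(Real.pi * (n + 1) ^ 2) * t ^ 2) := by
      rw [← Complex.exp_add]
      congr 1
      ring
    rw [this]
    ring
  rw [this]
  refine Submodule.sum_mem _ fun k _ => Submodule.subset_span ⟨_, _, _, k, ?_, rfl⟩
  have : (Real.pi * ((n : ℂ) + 1) ^ 2) = ((Real.pi * (n + 1) ^ 2 : ℝ) : ℂ) := by push_cast; ring
  rw [this, Complex.ofReal_re]
  positivity

/-- Interchange of `X` with the integral over t. The joint decay in (x, t) needed for it comes from
`F` in the variable t and from the heat kernel in x - t. -/
lemma heatFn_map (hF : StripGauss s.im F) (n : ℕ) {S : Set ℂ} {X : FnOp N}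
    (hX : X ∈ termSpan N S) (m : ZMod N) :
    (Continuous fun p : ℝ × ℝ => X (heatFn F n p.2) p.1 m) ∧
    (GaussBdd (fun p : ℝ × ℝ => |p.1| + |p.2|) fun p => X (heatFn F n p.2) p.1 m) ∧
    ∀ x : ℝ, Integrable (fun t => X (heatFn F n t) x m) ∧
      X (fun μ m => ∫ t : ℝ, heatFn F n t μ m) x m = ∫ t : ℝ, X (heatFn F n t) x m := by
  have hline : ∀ {f : ℝ × ℝ → ℂ}, Continuous f →
      GaussBdd (fun p : ℝ × ℝ => |p.1| + |p.2|) f → ∀ x, Integrable fun t => f (x, t) := by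
    intro f hc hb x
    refine GaussBdd.integrable ?_ (Continuous.aestronglyMeasurable (by fun_prop))
    have := hb.comp fun t : ℝ => (x, t)
    refine this.change 1 0 fun t => ?_
    simp only [id, Function.comp, one_mul, add_zero]
    rw [abs_of_nonneg (by positivity : 0 ≤ |x| + |t|)]
    linarith [abs_nonneg x]
  suffices H : (Continuous fun p : ℝ × ℝ => X (heatFn F n p.2) p.1 m) ∧
    (GaussBdd (fun p : ℝ × ℝ => |p.1| + |p.2|) fun p => X (heatFn F n p.2) p.1 m) ∧
    ∀ x : ℝ, X (fun μ m => ∫ t : ℝ, heatFn F n t μ m) x m = ∫ t : ℝ, X (heatFn F n t) x m from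
    ⟨H.1, H.2.1, fun x => ⟨hline H.1 H.2.1 x, H.2.2 x⟩⟩
  induction hX using Submodule.span_induction with
  | mem X hX =>
    obtain ⟨z, hz, k, γ, a, rfl⟩ := hX
    have hc := hF.continuous_line (z := 0) (by simp) (m + k)
    have hb := hF.bdd_line (z := 0) (by simp) (m + k)
    simp only [add_zero] at hc hb
    refine ⟨?_, ?_, fun x => ?_⟩
    · simp only [termOp_apply, heatFn, heat]
      have h1 : Continuous fun p : ℝ × ℝ => F p.2 (m + k) := hc.comp continuous_snd
      exact (by fun_prop : Continuous fun p : ℝ × ℝ => a m * exp (γ * p.1)).mul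
        (h1.mul (by fun_prop))
    · simp only [termOp_apply, heatFn]
      obtain ⟨C, δ, hC, hδ, hb⟩ := hb.exists_nonneg
      set ε := min δ Real.pi with hε
      have hε0 : 0 < ε := lt_min hδ Real.pi_pos
      set K : ℝ := (n + 1) * Real.exp (Real.pi * (n + 1) ^ 2 * z.im ^ 2) with hK
      have base : GaussBdd (fun p : ℝ × ℝ => |p.1| + |p.2|)
          fun p => F p.2 (m + k) * heat n (p.1 + z - p.2) := by
        -- The product of the two Gaussians is naturally bounded in the Euclidean length of (t, x +
        -- Re z - t), with the smaller of their rates.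
        have h1 : GaussBdd (fun p : ℝ × ℝ => Real.sqrt (p.2 ^ 2 + (p.1 + z.re - p.2) ^ 2))
            fun p => F p.2 (m + k) * heat n (p.1 + z - p.2) := by
          refine ⟨C * K, ε, hε0, fun p => ?_⟩
          rw [norm_mul, norm_heat_le, Real.sq_sqrt (by positivity)]
          have e1 : (p.1 + z - p.2 : ℂ).re = p.1 + z.re - p.2 := by simp
          have e2 : (p.1 + z - p.2 : ℂ).im = z.im := by simp
          rw [e1, e2]
          set u := p.1 + z.re - p.2
          calc ‖F p.2 (m + k)‖ * ((n + 1) * Real.exp (-(Real.pi * (n + 1) ^ 2) * (u ^ 2 - z.im ^ 2)))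
              ≤ (C * Real.exp (-δ * p.2 ^ 2)) *
                ((n + 1) * Real.exp (-(Real.pi * (n + 1) ^ 2) * (u ^ 2 - z.im ^ 2))) := by
                gcongr
                exact hb p.2
            _ = C * K * Real.exp (-δ * p.2 ^ 2 + -(Real.pi * (n + 1) ^ 2) * u ^ 2) := by
                rw [hK, mul_sub, sub_eq_add_neg, Real.exp_add, Real.exp_add]
                have : -(-(Real.pi * ((n : ℝ) + 1) ^ 2) * z.im ^ 2)
                  = Real.pi * (n + 1) ^ 2 * z.im ^ 2 := by ring
                rw [this]
                ring
            _ ≤ C * K * Real.exp (-ε * (p.2 ^ 2 + u ^ 2)) := by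
                refine mul_le_mul_of_nonneg_left (Real.exp_le_exp.2 ?_) (by positivity)
                have f1 : ε * p.2 ^ 2 ≤ δ * p.2 ^ 2 := by gcongr; exact min_le_left _ _
                have f2 : ε * u ^ 2 ≤ Real.pi * (n + 1) ^ 2 * u ^ 2 := by
                  gcongr
                  refine (min_le_right _ _).trans (le_mul_of_one_le_right Real.pi_pos.le ?_)
                  refine one_le_pow₀ ?_
                  have : (0 : ℝ) ≤ n := by positivity
                  linarith
                linarith
        -- |x| + |t| ≤ |x + Re z - t| + 2|t| + |Re z|, which accounts for the factor 3.
        refine h1.change 3 |z.re| fun p => ?_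
        rw [abs_of_nonneg (by positivity), abs_of_nonneg (Real.sqrt_nonneg _)]
        have g1 : |p.2| ≤ Real.sqrt (p.2 ^ 2 + (p.1 + z.re - p.2) ^ 2) :=
          Real.abs_le_sqrt (by nlinarith [sq_nonneg (p.1 + z.re - p.2)])
        have g2 : |p.1 + z.re - p.2| ≤ Real.sqrt (p.2 ^ 2 + (p.1 + z.re - p.2) ^ 2) :=
          Real.abs_le_sqrt (by nlinarith [sq_nonneg p.2])
        have g3 : |p.1| ≤ |p.1 + z.re - p.2| + |p.2| + |z.re| := by
          have : p.1 = (p.1 + z.re - p.2) + p.2 - z.re := by ring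
          calc |p.1| = |(p.1 + z.re - p.2) + p.2 - z.re| := by rw [← this]
            _ ≤ |(p.1 + z.re - p.2) + p.2| + |z.re| := abs_sub _ _
            _ ≤ _ := by gcongr; exact abs_add_le _ _
        linarith
      refine base.mul_exp (a m) γ (fun p => p.1) fun p => ?_
      refine le_trans ?_ (le_abs_self _)
      linarith [abs_nonneg p.2]
    · simp only [termOp_apply, heatFn]
      rw [← integral_const_mul]
  | zero =>
    simp only [LinearMap.zero_apply, Pi.zero_apply]
    exact ⟨continuous_const, .zero, fun x => by simp⟩
  | add X Y _ _ h1 h2 =>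
    simp only [LinearMap.add_apply, Pi.add_apply]
    refine ⟨h1.1.add h2.1, h1.2.1.add h2.2.1, fun x => ?_⟩
    have i1 := hline h1.1 h1.2.1 x
    have i2 := hline h2.1 h2.2.1 x
    rw [h1.2.2, h2.2.2, integral_add i1 i2]
  | smul c X _ h1 =>
    simp only [LinearMap.smul_apply, Pi.smul_apply, smul_eq_mul]
    refine ⟨h1.1.const_mul c, h1.2.1.const_mul c, fun x => ?_⟩
    rw [h1.2.2, integral_const_mul]

/-- By `heat_conv_shift` the values on the line ℝ + z are again a heat convolution on ℝ, namely of
F(· + z), so the real-variable estimates apply to both lines. -/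
lemma gaussTendsto (hF : StripGauss s.im F) :
    GaussTendsto {0, s} (fun n => fun μ m => ∫ t : ℝ, heatFn F n t μ m) F where
  bdd z hz m := by
    simp only [heatFn]
    simp_rw [fun p : ℕ × ℝ => hF.heat_conv_shift hz m p.1 p.2]
    exact heat_conv_bound (hF.bdd_line hz m)
  lim z hz m x := by
    simp only [heatFn]
    simp_rw [fun n : ℕ => hF.heat_conv_shift hz m n x]
    exact heat_conv_tendsto (hF.continuous_line hz m) (hF.bdd_line hz m) x

/-- A function that is analytic in a closed strip, with a Gaussian bound, belongs to the domain
of the closure of an operator whose shifts do not leave the strip. -/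
theorem repIn_closedGraph (hF : StripGauss s.im F) {X : FnOp N} (hX : X ∈ termSpan N {0, s}) :
    RepIn (closedGraph X) F (X F) := by
  refine RepIn.of_gaussTendsto (isClosed_closedGraph X) (by simp) hX hF.gaussTendsto fun n => ?_
  have h1 : (1 : FnOp N) ∈ termSpan N {0} := by
    have : (1 : FnOp N) = termOp 0 0 0 fun _ => 1 := by
      ext F μ m
      simp [termOp_apply]
    rw [this]
    exact termOp_mem (by simp) _ _ _
  -- For fixed n the convolution is a superposition over t of elements of `gaussFn N`, so the closed
  -- graph contains it.
  have := RepIn.integral (isClosed_closedGraph X) (w := heatFn F n) (u := fun t => X (heatFn F n t))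
    (fun t => LevelN.repIn_closedGraph hX (heatFn_mem F n t))
    (fun m => (hF.heatFn_map n h1 m).1) (fun m => (hF.heatFn_map n h1 m).2.1)
    (fun m => (hF.heatFn_map n hX m).1) (fun m => (hF.heatFn_map n hX m).2.1)
  refine this.congr (fun m => ae_of_all _ fun x => rfl) fun m => ae_of_all _ fun x => ?_
  exact ((hF.heatFn_map n hX m).2.2 x).2.symm

end StripGauss

end LevelN

namespace LevelN

open Filter Topology

set_option linter.unusedSectionVars false

/-! ### The infinite product `∏ (1 + r^(2j+1) x)` -/

/-- The infinite product `∏_{j ≥ 0} (1 + r^(2j+1) x)`. -/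
noncomputable def qprod (r x : ℂ) : ℂ := ∏' j : ℕ, (1 + r ^ (2 * j + 1) * x)

/-- The partial products of `qprod`. -/
noncomputable def qprodFin (r : ℂ) (n : ℕ) (x : ℂ) : ℂ :=
  ∏ j ∈ Finset.range n, (1 + r ^ (2 * j + 1) * x)

section qprod

variable {r : ℂ}

lemma summable_qprod (hr : ‖r‖ < 1) (x : ℂ) : Summable fun j : ℕ => ‖r ^ (2 * j + 1) * x‖ := by
  have h1 : ‖r‖ ^ 2 < 1 := by
    have := norm_nonneg r
    nlinarith
  have := (summable_geometric_of_lt_one (sq_nonneg ‖r‖) h1).mul_left (‖r‖ * ‖x‖)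
  refine this.congr fun j => ?_
  rw [norm_mul, norm_pow]
  ring

lemma tendsto_qprodFin (hr : ‖r‖ < 1) (x : ℂ) :
    Tendsto (fun n => qprodFin r n x) atTop (𝓝 (qprod r x)) :=
  (multipliable_one_add_of_summable (summable_qprod hr x)).hasProd.tendsto_prod_nat

lemma qprodFin_succ (n : ℕ) (x : ℂ) :
    qprodFin r (n + 1) x = (1 + r * x) * qprodFin r n (r ^ 2 * x) := by
  rw [qprodFin, Finset.prod_range_succ', qprodFin, mul_comm]
  congr 1
  · simp
  · refine Finset.prod_congr rfl fun j _ => ?_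
    ring

lemma qprod_eq (hr : ‖r‖ < 1) (x : ℂ) : qprod r x = (1 + r * x) * qprod r (r ^ 2 * x) := by
  have h1 := (tendsto_qprodFin hr x).comp (tendsto_add_atTop_nat 1)
  have h2 := (tendsto_qprodFin hr (r ^ 2 * x)).const_mul (1 + r * x)
  refine tendsto_nhds_unique h1 (h2.congr fun n => ?_)
  simp [qprodFin_succ]

lemma qprod_eq_fin_mul (hr : ‖r‖ < 1) (n : ℕ) (x : ℂ) :
    qprod r x = qprodFin r n x * qprod r (r ^ (2 * n) * x) := by
  induction n generalizing x with
  | zero => simp [qprodFin]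
  | succ n ih =>
    rw [qprod_eq hr, qprodFin_succ, ih (r ^ 2 * x)]
    ring_nf

lemma differentiable_qprod (hr : ‖r‖ < 1) : Differentiable ℂ (qprod r) := by
  intro x
  have hK : IsOpen (Metric.ball (0 : ℂ) (‖x‖ + 1)) := Metric.isOpen_ball
  have hs := summable_qprod hr ((‖x‖ + 1 : ℝ) : ℂ)
  have h := Summable.hasProdLocallyUniformlyOn_nat_one_add
    (f := fun (j : ℕ) (x : ℂ) => r ^ (2 * j + 1) * x) hK hs
    (Eventually.of_forall fun n y hy => by
      rw [norm_mul, norm_mul]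
      gcongr
      rw [Complex.norm_real, Real.norm_eq_abs, abs_of_nonneg (by positivity)]
      have := mem_ball_zero_iff.1 hy
      exact this.le) (fun i => by fun_prop)
  have h2 := h.tendstoLocallyUniformlyOn_finsetRange
  have := h2.differentiableOn (Eventually.of_forall fun n => by fun_prop) hK
  exact (this.differentiableAt (hK.mem_nhds (by simp)))

lemma qprod_eq_zero_iff (hr : ‖r‖ < 1) (x : ℂ) :
    qprod r x = 0 ↔ ∃ j : ℕ, 1 + r ^ (2 * j + 1) * x = 0 := by
  constructor
  · intro h
    by_contra hne
    push Not at hne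
    exact tprod_one_add_ne_zero_of_summable hne (summable_qprod hr x) h
  · rintro ⟨j, hj⟩
    rw [qprod_eq_fin_mul hr (j + 1), qprodFin,
      Finset.prod_eq_zero (Finset.self_mem_range_succ j) hj, zero_mul]

/-- The zeros of the infinite product are simple. -/
lemma deriv_qprod_ne_zero (hr : ‖r‖ < 1) {x : ℂ} (hx : qprod r x = 0) :
    deriv (qprod r) x ≠ 0 := by
  obtain ⟨j, hj⟩ := (qprod_eq_zero_iff hr x).1 hx
  have hr0 : r ≠ 0 := by
    rintro rfl
    simp at hj
  have hx0 : x ≠ 0 := by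
    rintro rfl
    simp at hj
  -- Since 0 < |r| < 1 the numbers r^(2i+1) have distinct moduli, so exactly one factor vanishes at
  -- `x`.
  have hinj : ∀ i, 1 + r ^ (2 * i + 1) * x = 0 → i = j := by
    intro i hi
    have h1 : r ^ (2 * i + 1) = r ^ (2 * j + 1) := by
      have : r ^ (2 * i + 1) * x = r ^ (2 * j + 1) * x := by linear_combination hi - hj
      exact mul_right_cancel₀ hx0 this
    have h2 : ‖r‖ ^ (2 * i + 1) = ‖r‖ ^ (2 * j + 1) := by rw [← norm_pow, h1, norm_pow]
    have := pow_right_injective₀ (norm_pos_iff.2 hr0) hr.ne h2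
    omega
  set R : ℂ → ℂ := fun x => qprodFin r j x * qprod r (r ^ (2 * (j + 1)) * x) with hR
  have hfac : qprod r = fun x => (1 + r ^ (2 * j + 1) * x) * R x := by
    ext y
    rw [qprod_eq_fin_mul hr (j + 1), hR, qprodFin, Finset.prod_range_succ, ← qprodFin]
    ring
  have hRd : Differentiable ℂ R := by
    have := differentiable_qprod hr
    simp only [hR, qprodFin]
    fun_prop
  have hRx : R x ≠ 0 := by
    refine mul_ne_zero ?_ ?_
    · rw [qprodFin, Finset.prod_ne_zero_iff]
      intro i hi h0
      have := hinj i h0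
      simp only [Finset.mem_range] at hi
      omega
    · intro h0
      obtain ⟨i, hi⟩ := (qprod_eq_zero_iff hr _).1 h0
      have := hinj (i + (j + 1)) (by rw [← hi]; ring)
      omega
  have hd : HasDerivAt (fun x => (1 + r ^ (2 * j + 1) * x) * R x)
      (r ^ (2 * j + 1) * R x + (1 + r ^ (2 * j + 1) * x) * deriv R x) x := by
    have h1 : HasDerivAt (fun x => 1 + r ^ (2 * j + 1) * x) (r ^ (2 * j + 1)) x := by
      simpa using ((hasDerivAt_id x).const_mul (r ^ (2 * j + 1))).const_add 1
    exact h1.mul (hRd x).hasDerivAt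
  rw [hfac, hd.deriv, hj, zero_mul, add_zero]
  exact mul_ne_zero (pow_ne_zero _ hr0) hRx

lemma conj_qprod (hr : ‖r‖ < 1) (x : ℂ) :
    conj (qprod r x) = qprod (conj r) (conj x) := by
  have h1 := (continuous_conj.tendsto _).comp (tendsto_qprodFin hr x)
  have h2 := tendsto_qprodFin (r := conj r) (by rwa [RCLike.norm_conj]) (conj x)
  refine tendsto_nhds_unique h1 (h2.congr fun n => ?_)
  simp [qprodFin, map_prod]

end qprod

/-! ### Removable singularities of quotients -/

/-- The quotient `g / P`, with the removable singularities at simple zeros of `P` removed. -/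
noncomputable def quot (g P : ℂ → ℂ) (z : ℂ) : ℂ :=
  if P z = 0 then deriv g z / deriv P z else g z / P z

lemma quot_of_ne {g P : ℂ → ℂ} {z : ℂ} (h : P z ≠ 0) : quot g P z = g z / P z := if_neg h

/-- At a simple zero of `P` both functions are divided by w - z by means of `dslope`; the new
denominator takes the value P'(z) ≠ 0 there. -/
lemma differentiableAt_quot {g P : ℂ → ℂ} (hg : Differentiable ℂ g) (hP : Differentiable ℂ P)
    {z : ℂ} (h : P z = 0 → g z = 0 ∧ deriv P z ≠ 0) : DifferentiableAt ℂ (quot g P) z := by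
  by_cases hz : P z = 0
  · obtain ⟨hgz, hd⟩ := h hz
    have h1 : DifferentiableAt ℂ (fun w => dslope g z w / dslope P z w) z := by
      have e1 : DifferentiableAt ℂ (dslope g z) z :=
        ((Complex.differentiableOn_dslope (s := Set.univ) univ_mem).2
          hg.differentiableOn).differentiableAt univ_mem
      have e2 : DifferentiableAt ℂ (dslope P z) z :=
        ((Complex.differentiableOn_dslope (s := Set.univ) univ_mem).2
          hP.differentiableOn).differentiableAt univ_mem
      exact e1.div e2 (by rwa [dslope_same])
    refine h1.congr_of_eventuallyEq ?_
    have e3 : ∀ᶠ w in 𝓝 z, dslope P z w ≠ 0 := by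
      have : ContinuousAt (dslope P z) z := continuousAt_dslope_same.2 (hP z)
      exact this.eventually_ne (by rwa [dslope_same])
    filter_upwards [e3] with w hw
    by_cases hwz : w = z
    · rw [hwz, quot, if_pos hz, dslope_same, dslope_same]
    · have e4 : P w = (w - z) * dslope P z w := by
        rw [← smul_eq_mul, sub_smul_dslope, hz, sub_zero]
      have e5 : g w = (w - z) * dslope g z w := by
        rw [← smul_eq_mul, sub_smul_dslope, hgz, sub_zero]
      have hwz' : w - z ≠ 0 := sub_ne_zero.2 hwz
      rw [quot_of_ne (by rw [e4]; exact mul_ne_zero hwz' hw), e4, e5,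
        mul_div_mul_left _ _ hwz']
  · have : (fun w => g w / P w) =ᶠ[𝓝 z] quot g P := by
      filter_upwards [(hP z).continuousAt.eventually_ne hz] with w hw
      rw [quot_of_ne hw]
    exact ((hg z).div (hP z) hz).congr_of_eventuallyEq this.symm

/-! ### Exponential bounds from quasi-periodicity -/

/-- A continuous function on a strip that is multiplied by a bounded factor by a real translation
grows at most exponentially. -/
lemma exp_bound_of_quasiperiodic {ι : Type*} [Finite ι] {h v R K : ℝ} (hv : 0 < v)
    (σ σ' : Equiv.Perm ι) {f : ℂ → ι → ℂ}
    (hc : ∀ m, ∀ z : ℂ, |z.im| ≤ h → ContinuousAt (fun z => f z m) z)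
    (hr : ∀ m, ∀ z : ℂ, |z.im| ≤ h → R ≤ z.re → ‖f (z + v) (σ m)‖ ≤ K * ‖f z m‖)
    (hl : ∀ m, ∀ z : ℂ, |z.im| ≤ h → z.re ≤ -R → ‖f (z - v) (σ' m)‖ ≤ K * ‖f z m‖) :
    ∃ C c, 0 ≤ C ∧ 0 ≤ c ∧ ∀ m, ∀ z : ℂ, |z.im| ≤ h → ‖f z m‖ ≤ C * Real.exp (c * |z.re|) := by
  -- The rectangle extends one period beyond |R|, so that a point outside it may be translated
  -- inwards by `v` and still satisfy the hypothesis `hr` or `hl`.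
  set Q : Set ℂ := Set.Icc (-(|R| + v)) (|R| + v) ×ℂ Set.Icc (-h) h with hQ
  have hQc : IsCompact Q := isCompact_Icc.reProdIm isCompact_Icc
  have hbd : ∀ m, ∃ C, ∀ z ∈ Q, ‖f z m‖ ≤ C := fun m =>
    hQc.exists_bound_of_continuousOn fun z hz =>
      (hc m z (abs_le.2 hz.2)).continuousWithinAt
  choose C₀ hC₀ using hbd
  have := Fintype.ofFinite ι
  set C := ∑ m, |C₀ m| with hC
  have hCm : ∀ m, C₀ m ≤ C := fun m => (le_abs_self _).trans
    (Finset.single_le_sum (f := fun m => |C₀ m|) (fun i _ => abs_nonneg _) (Finset.mem_univ m))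
  set L := max K 1 with hL
  have hL1 : 1 ≤ L := le_max_right _ _
  have hC0 : 0 ≤ C := Finset.sum_nonneg fun i _ => abs_nonneg _
  -- Each period costs at most one factor `L`; the power is converted to an exponential in |Re z| at
  -- the end.
  have key : ∀ n : ℕ, ∀ m, ∀ z : ℂ, |z.im| ≤ h → |z.re| ≤ |R| + (n + 1) * v →
      ‖f z m‖ ≤ C * L ^ n := by
    intro n
    induction n with
    | zero =>
      intro m z hz hre
      rw [pow_zero, mul_one]
      refine (hC₀ m z ⟨abs_le.1 (by simpa using hre), abs_le.1 hz⟩).trans (hCm m)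
    | succ n ih =>
      intro m z hz hre
      push_cast at hre
      by_cases h1 : |z.re| ≤ |R| + v
      · refine (hC₀ m z ⟨abs_le.1 h1, abs_le.1 hz⟩).trans ((hCm m).trans ?_)
        exact le_mul_of_one_le_right hC0 (one_le_pow₀ hL1)
      · rw [not_le] at h1
        have hR := le_abs_self R
        rcases le_total 0 z.re with h0 | h0
        · obtain ⟨m', rfl⟩ := σ.surjective m
          rw [abs_of_nonneg h0] at hre h1
          have e := hr m' (z - v) (by simpa using hz) (by simp; linarith)
          rw [sub_add_cancel] at e
          have e2 := ih m' (z - v) (by simpa using hz) (by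
            simp only [sub_re, ofReal_re]
            rw [abs_of_nonneg (by linarith [abs_nonneg R])]
            linarith)
          calc ‖f z (σ m')‖ ≤ K * ‖f (z - v) m'‖ := e
            _ ≤ L * (C * L ^ n) := by
              gcongr
              exact le_max_left _ _
            _ = _ := by ring
        · obtain ⟨m', rfl⟩ := σ'.surjective m
          rw [abs_of_nonpos h0] at hre h1
          have e := hl m' (z + v) (by simpa using hz) (by simp; linarith)
          rw [add_sub_cancel_right] at e
          have e2 := ih m' (z + v) (by simpa using hz) (by
            simp only [add_re, ofReal_re]
            rw [abs_of_nonpos (by linarith [abs_nonneg R])]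
            linarith)
          calc ‖f z (σ' m')‖ ≤ K * ‖f (z + v) m'‖ := e
            _ ≤ L * (C * L ^ n) := by
              gcongr
              exact le_max_left _ _
            _ = _ := by ring
  refine ⟨C, Real.log L / v, hC0, div_nonneg (Real.log_nonneg hL1) hv.le, fun m z hz => ?_⟩
  set n := ⌊|z.re| / v⌋₊ with hn
  have h1 : |z.re| ≤ |R| + (n + 1) * v := by
    have := (Nat.lt_floor_add_one (|z.re| / v)).le
    rw [div_le_iff₀ hv] at this
    linarith [abs_nonneg R]
  refine (key n m z hz h1).trans ?_
  refine mul_le_mul_of_nonneg_left ?_ hC0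
  have h2 : (n : ℝ) ≤ |z.re| / v := Nat.floor_le (by positivity)
  calc L ^ n = Real.exp (Real.log L * n) := by
        rw [mul_comm, Real.exp_nat_mul, Real.exp_log (by linarith)]
    _ ≤ Real.exp (Real.log L / v * |z.re|) := by
        refine Real.exp_le_exp.2 ?_
        calc Real.log L * n ≤ Real.log L * (|z.re| / v) := by
              gcongr
              exact Real.log_nonneg hL1
          _ = _ := by ring

end LevelN

namespace LevelN

open Filter Topology

set_option linter.unusedSectionVars false

/-! ### The coordinate functions and the quantum torus, uniformly for both members of a pair -/

/-- `exp[(2π i / N)(-i β μ - ε m)]`; this is `y` for `(b, 1)` and `ỹ` for `(b⁻¹, -1)`. -/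
noncomputable def gy (N : ℕ) (β : ℂ) (ε : ℤ) : Fn N := fun μ m =>
  exp (2 * Real.pi * I / N * (-I * β * μ - ε * (m.val : ℂ)))

/-- `exp[(π i / N)(1 + β²)]`. -/
noncomputable def gq (N : ℕ) (β : ℂ) : ℂ := exp (Real.pi * I / N * (1 + β ^ 2))

/-- `weyl` for `(b, 1)` and `weylt` for `(b⁻¹, -1)`. -/
noncomputable def gweyl (N : ℕ) (β : ℂ) (ε : ℤ) (α γ : ℤ) : FnOp N :=
  (gq N β ^ (-(α * γ))) •
    (shiftOp ((α : ℂ) * (I * β)) (-(ε * α : ZMod N)) * mulOp fun μ m => gy N β ε μ m ^ γ)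

variable {N : ℕ}

lemma gy_one (b : ℂ) : gy N b 1 = y N b := by
  ext μ m
  simp [gy, y]

lemma gy_neg_one (b : ℂ) : gy N b⁻¹ (-1) = yt N b := by
  ext μ m
  simp [gy, yt]

lemma gweyl_one (b : ℂ) : gweyl N b 1 = weyl N b := by
  ext α γ F μ m
  simp [gweyl, weyl, gy_one, gq, q]

lemma gweyl_neg_one (b : ℂ) : gweyl N b⁻¹ (-1) = weylt N b := by
  ext α γ F μ m
  simp [gweyl, weylt, gy_neg_one, gq, qt]

variable {β : ℂ} {ε : ℤ}

lemma gy_ne_zero (μ : ℂ) (m : ZMod N) : gy N β ε μ m ≠ 0 := Complex.exp_ne_zero _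

lemma gq_ne_zero : gq N β ≠ 0 := Complex.exp_ne_zero _

variable [NeZero N]

lemma natCast_ne_zero' : (N : ℂ) ≠ 0 := Nat.cast_ne_zero.2 (NeZero.ne N)

lemma exp_eq_exp_of_sub {x y : ℂ} (n : ℤ) (h : x = y + n * (2 * Real.pi * I)) : exp x = exp y :=
  Complex.exp_eq_exp_iff_exists_int.2 ⟨n, h⟩

lemma val_intCast_eq (n : ℤ) : ∃ k : ℤ, (((n : ZMod N).val : ℤ)) = n + N * k := by
  refine ⟨-(n / N), ?_⟩
  rw [ZMod.val_intCast]
  have := Int.emod_add_mul_ediv n N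
  linarith

lemma exists_intCast (m : ZMod N) : ∃ n : ℤ, (n : ZMod N) = m :=
  ⟨m.val, by simp⟩

/-- Changing the representative by a multiple of N changes the exponent by a multiple of 2πi.
Integers in place of `ZMod.val` make the exponents linear in m. -/
lemma gy_intCast (μ : ℂ) (n : ℤ) :
    gy N β ε μ (n : ZMod N) = exp (2 * Real.pi * I / N * (-I * β * μ - ε * n)) := by
  obtain ⟨k, hk⟩ := val_intCast_eq (N := N) n
  have hk' : (((n : ZMod N).val : ℂ)) = n + N * k := by exact_mod_cast hk
  refine exp_eq_exp_of_sub (-(ε * k)) ?_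
  rw [hk']
  have := natCast_ne_zero' (N := N)
  field_simp
  push_cast
  ring

lemma gy_add (μ μ' : ℂ) (m m' : ZMod N) :
    gy N β ε (μ + μ') (m + m') = gy N β ε μ m * gy N β ε μ' m' := by
  obtain ⟨n, rfl⟩ := exists_intCast m
  obtain ⟨n', rfl⟩ := exists_intCast m'
  rw [← Int.cast_add, gy_intCast, gy_intCast, gy_intCast, ← Complex.exp_add]
  congr 1
  push_cast
  ring

lemma gy_zero : gy N β ε 0 0 = 1 := by simp [gy]

lemma gy_neg (μ : ℂ) (m : ZMod N) : gy N β ε (-μ) (-m) = (gy N β ε μ m)⁻¹ := by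
  refine eq_inv_of_mul_eq_one_left ?_
  rw [← gy_add, neg_add_cancel, neg_add_cancel, gy_zero]

/-- The commutation relation of the quantum torus. -/
lemma gy_shift (hε : ε * ε = 1) (α : ℤ) (μ : ℂ) (m : ZMod N) :
    gy N β ε (μ + α * (I * β)) (m + -(ε * α : ZMod N)) = gq N β ^ (2 * α) * gy N β ε μ m := by
  have e : gy N β ε (α * (I * β)) (-(ε * α : ZMod N)) = gq N β ^ (2 * α) := by
    have : (-(ε * α : ZMod N)) = ((-(ε * α) : ℤ) : ZMod N) := by push_cast; ring
    rw [this, gy_intCast, gq, ← Complex.exp_int_mul]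
    congr 1
    have hε' : (ε : ℂ) * ε = 1 := by exact_mod_cast hε
    push_cast
    linear_combination (2 * Real.pi * I / N * (α : ℂ)) * hε'
      - (2 * Real.pi * I / N * α * β ^ 2) * I_sq
  rw [gy_add, e, mul_comm]

/-- Normal ordering: carrying y^γ to the left of the shift produces q^(2αγ), which turns the
prefactor q^(-αγ) into q^(αγ). -/
lemma gweyl_apply (hε : ε * ε = 1) (α γ : ℤ) (F : Fn N) (μ : ℂ) (m : ZMod N) :
    gweyl N β ε α γ F μ m = gq N β ^ (α * γ) * gy N β ε μ m ^ γ *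
      F (μ + α * (I * β)) (m + -(ε * α : ZMod N)) := by
  have : gweyl N β ε α γ F μ m = gq N β ^ (-(α * γ)) *
      (gy N β ε (μ + α * (I * β)) (m + -(ε * α : ZMod N)) ^ γ *
      F (μ + α * (I * β)) (m + -(ε * α : ZMod N))) := rfl
  rw [this, gy_shift hε, mul_zpow, ← zpow_mul]
  have h1 : gq N β ^ (α * γ) = gq N β ^ (-(α * γ)) * gq N β ^ (2 * α * γ) := by
    rw [← zpow_add₀ gq_ne_zero]
    congr 1
    ring
  rw [h1]
  ring

lemma gweyl_mem_termSpan (hε : ε * ε = 1) (α γ : ℤ) {S : Set ℂ} (h : (α * (I * β) : ℂ) ∈ S) :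
    gweyl N β ε α γ ∈ termSpan N S := by
  have : gweyl N β ε α γ = termOp (α * (I * β)) (-(ε * α : ZMod N))
      (2 * Real.pi * I / N * (-I * β) * γ)
      (fun m => gq N β ^ (α * γ) * exp (γ * (2 * Real.pi * I / N * (- ε * (m.val : ℂ))))) := by
    ext F μ m
    rw [gweyl_apply hε, termOp_apply, gy, ← Complex.exp_int_mul, mul_assoc (gq N β ^ (α * γ)),
      mul_assoc (gq N β ^ (α * γ)), ← Complex.exp_add, ← mul_assoc]
    congr 3
    ring
  rw [this]
  exact termOp_mem h _ _ _

/-! ### Conjugation of the quantum torus by the elementary operators -/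

lemma phase_intCast (x : ℝ) (μ : ℂ) (k n : ℤ) :
    exp (2 * Real.pi * I / N * (x * μ - (((k : ZMod N).val : ℂ)) * (((n : ZMod N).val : ℂ))))
      = exp (2 * Real.pi * I / N * (x * μ - k * n)) := by
  obtain ⟨a, ha⟩ := val_intCast_eq (N := N) k
  obtain ⟨c, hc⟩ := val_intCast_eq (N := N) n
  have ha' : (((k : ZMod N).val : ℂ)) = k + N * a := by exact_mod_cast ha
  have hc' : (((n : ZMod N).val : ℂ)) = n + N * c := by exact_mod_cast hc
  refine exp_eq_exp_of_sub (-(k * c + a * n + N * a * c)) ?_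
  rw [ha', hc']
  have := natCast_ne_zero' (N := N)
  field_simp
  push_cast
  ring

/-- The function by which `phaseOp` multiplies. -/
noncomputable def phaseFn (N : ℕ) (x : ℝ) (k : ZMod N) : Fn N := fun μ m =>
  exp (2 * Real.pi * I / N * (x * μ - (k.val : ℂ) * (m.val : ℂ)))

/-- The function by which `weilOp` multiplies. -/
noncomputable def weilFn (N : ℕ) : Fn N := fun μ m =>
  (-1) ^ (m.val ^ 2) * exp (Real.pi * I / N * (μ ^ 2 - (m.val : ℂ) ^ 2))

lemma phaseFn_ne_zero (x : ℝ) (k : ZMod N) (μ : ℂ) (m : ZMod N) : phaseFn N x k μ m ≠ 0 :=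
  Complex.exp_ne_zero _

lemma weilFn_ne_zero (μ : ℂ) (m : ZMod N) : weilFn N μ m ≠ 0 :=
  mul_ne_zero (pow_ne_zero _ (by norm_num)) (Complex.exp_ne_zero _)

/-- The sign (-1)^(m²) is what makes the quadratic phase well defined modulo N: n ↦ n + Nk
contributes πi k²N(N - 1) modulo 2πi, and N(N - 1) is even. -/
lemma weilFn_intCast (μ : ℂ) (n : ℤ) : weilFn N μ (n : ZMod N) =
    exp (Real.pi * I * n ^ 2 + Real.pi * I / N * (μ ^ 2 - (n : ℂ) ^ 2)) := by
  obtain ⟨k, hk⟩ := val_intCast_eq (N := N) n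
  have hk' : (((n : ZMod N).val : ℂ)) = n + N * k := by exact_mod_cast hk
  have h1 : ((-1 : ℂ)) ^ ((n : ZMod N).val ^ 2)
      = exp (Real.pi * I * (((n : ZMod N).val : ℂ)) ^ 2) := by
    rw [← Complex.exp_pi_mul_I, ← Complex.exp_nat_mul]
    congr 1
    push_cast
    ring
  rw [weilFn, h1, ← Complex.exp_add, hk']
  obtain ⟨t, ht⟩ : Even ((N : ℤ) * (N - 1)) := Int.even_mul_pred_self _
  have ht' : (N : ℂ) * (N - 1) = t + t := by exact_mod_cast ht
  refine exp_eq_exp_of_sub (n * N * k - n * k + k ^ 2 * t) ?_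
  have := natCast_ne_zero' (N := N)
  have e : Real.pi * I / N * (μ ^ 2 - (n + N * k : ℂ) ^ 2)
      = Real.pi * I / N * (μ ^ 2 - (n : ℂ) ^ 2) - Real.pi * I * (2 * n * k + N * k ^ 2) := by
    field_simp
    ring
  rw [e]
  push_cast
  linear_combination Real.pi * I * k ^ 2 * ht'

lemma phaseFn_shift (x : ℝ) (k : ZMod N) (α : ℤ) (μ : ℂ) (m : ZMod N) :
    phaseFn N x k (μ + α * (I * β)) (m + -(ε * α : ZMod N))
      = (gy N β ε x k)⁻¹ ^ α * phaseFn N x k μ m := by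
  obtain ⟨n, rfl⟩ := exists_intCast m
  obtain ⟨k, rfl⟩ := exists_intCast k
  have : ((n : ZMod N) + -(ε * α : ZMod N)) = ((n - ε * α : ℤ) : ZMod N) := by push_cast; ring
  rw [this, phaseFn, phaseFn, phase_intCast, phase_intCast, gy_intCast, ← Complex.exp_neg,
    ← Complex.exp_int_mul, ← Complex.exp_add]
  congr 1
  push_cast
  ring

/-- A quadratic phase turns a shift into a linear exponential, here y^α. The discrete part leaves
exp(-πi α²), which equals (-1)^α because α(α + 1) is even. -/
lemma weilFn_shift (hε : ε * ε = 1) (α : ℤ) (μ : ℂ) (m : ZMod N) :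
    weilFn N μ m = (-1) ^ α * gq N β ^ (α * α) * gy N β ε μ m ^ α *
      weilFn N (μ + α * (I * β)) (m + -(ε * α : ZMod N)) := by
  obtain ⟨n, rfl⟩ := exists_intCast m
  have : ((n : ZMod N) + -(ε * α : ZMod N)) = ((n - ε * α : ℤ) : ZMod N) := by push_cast; ring
  rw [this, weilFn_intCast, weilFn_intCast, gy_intCast, gq, ← Complex.exp_pi_mul_I,
    ← Complex.exp_int_mul, ← Complex.exp_int_mul, ← Complex.exp_int_mul, ← Complex.exp_add,
    ← Complex.exp_add, ← Complex.exp_add]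
  obtain ⟨t, ht⟩ : Even (α * (α + 1)) := Int.even_mul_succ_self α
  have ht' : (α : ℂ) * (α + 1) = t + t := by exact_mod_cast ht
  have hε' : (ε : ℂ) * ε = 1 := by exact_mod_cast hε
  refine exp_eq_exp_of_sub (n * ε * α - t) ?_
  push_cast
  linear_combination (-Real.pi * I) * ht' - (Real.pi * I * α ^ 2) * hε'
    + (Real.pi * I / N * α ^ 2) * hε' - (Real.pi * I / N * α ^ 2 * β ^ 2) * I_sq

/-- `T e^(αU + γY) = (-1)^α e^(αU + (γ+α)Y) T`. -/
lemma weilOp_mul_gweyl (hε : ε * ε = 1) (α γ : ℤ) :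
    weilOp N * gweyl N β ε α γ = ((-1) ^ α : ℂ) • (gweyl N β ε α (γ + α) * weilOp N) := by
  ext F μ m
  have h1 : (weilOp N * gweyl N β ε α γ) F μ m = weilFn N μ m * gweyl N β ε α γ F μ m := rfl
  have h2 : (((-1) ^ α : ℂ) • (gweyl N β ε α (γ + α) * weilOp N)) F μ m
      = (-1) ^ α * gweyl N β ε α (γ + α) (weilOp N F) μ m := rfl
  have h3 : ∀ μ m, weilOp N F μ m = weilFn N μ m * F μ m := fun _ _ => rfl
  rw [h1, h2, gweyl_apply hε, gweyl_apply hε, h3, weilFn_shift hε α μ m, mul_add α,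
    zpow_add₀ gq_ne_zero, zpow_add₀ (gy_ne_zero _ _)]
  ring

lemma phaseOp_mul_gweyl (hε : ε * ε = 1) (x : ℝ) (k : ZMod N) (α γ : ℤ) :
    phaseOp N x k * gweyl N β ε α γ
      = (gy N β ε x k ^ α) • (gweyl N β ε α γ * phaseOp N x k) := by
  ext F μ m
  have h1 : (phaseOp N x k * gweyl N β ε α γ) F μ m
      = phaseFn N x k μ m * gweyl N β ε α γ F μ m := rfl
  have h2 : ((gy N β ε x k ^ α) • (gweyl N β ε α γ * phaseOp N x k)) F μ m
      = gy N β ε x k ^ α * gweyl N β ε α γ (phaseOp N x k F) μ m := rfl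
  have h3 : ∀ μ m, phaseOp N x k F μ m = phaseFn N x k μ m * F μ m := fun _ _ => rfl
  rw [h1, h2, gweyl_apply hε, gweyl_apply hε, h3, phaseFn_shift, inv_zpow]
  have := zpow_ne_zero α (gy_ne_zero (β := β) (ε := ε) (x : ℂ) k)
  field_simp

lemma shiftOp_mul_gweyl (hε : ε * ε = 1) (x : ℝ) (k : ZMod N) (α γ : ℤ) :
    shiftOp (x : ℂ) k * gweyl N β ε α γ
      = (gy N β ε x k ^ γ) • (gweyl N β ε α γ * shiftOp (x : ℂ) k) := by
  ext F μ m
  have h1 : (shiftOp (x : ℂ) k * gweyl N β ε α γ) F μ m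
      = gweyl N β ε α γ F (μ + x) (m + k) := rfl
  have h2 : ((gy N β ε x k ^ γ) • (gweyl N β ε α γ * shiftOp (x : ℂ) k)) F μ m
      = gy N β ε x k ^ γ * gweyl N β ε α γ (shiftOp (x : ℂ) k F) μ m := rfl
  have h3 : ∀ μ m, shiftOp (x : ℂ) k F μ m = F (μ + x) (m + k) := fun _ _ => rfl
  rw [h1, h2, gweyl_apply hε, gweyl_apply hε, h3, gy_add, mul_zpow, add_right_comm μ,
    add_right_comm m]
  ring

lemma parityOp_mul_gweyl (hε : ε * ε = 1) (α γ : ℤ) :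
    parityOp N * gweyl N β ε α γ = gweyl N β ε (-α) (-γ) * parityOp N := by
  ext F μ m
  have h1 : (parityOp N * gweyl N β ε α γ) F μ m = gweyl N β ε α γ F (-μ) (-m) := rfl
  have h2 : (gweyl N β ε (-α) (-γ) * parityOp N) F μ m
      = gweyl N β ε (-α) (-γ) (parityOp N F) μ m := rfl
  have h3 : ∀ μ m, parityOp N F μ m = F (-μ) (-m) := fun _ _ => rfl
  rw [h1, h2, gweyl_apply hε, gweyl_apply hε, h3, gy_neg, neg_mul_neg, inv_zpow, ← zpow_neg]
  congr 2
  · push_cast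
    ring
  · push_cast
    ring

end LevelN

namespace LevelN

open Filter Topology

set_option linter.unusedSectionVars false

/-! ### The quantum dilogarithm as a function of `μ` -/

/-- The denominator `∏ (1 + q^(2j+1) c y)` of `φ(c y, c̄ ỹ)`. -/
noncomputable def dilogDen (N : ℕ) (b c : ℂ) : Fn N := fun μ m => qprod (q N b) (c * y N b μ m)

/-- The numerator `∏ (1 + q̃^(-2j-1) c̄ ỹ)` of `φ(c y, c̄ ỹ)`. -/
noncomputable def dilogNum (N : ℕ) (b c : ℂ) : Fn N := fun μ m =>
  qprod (qt N b)⁻¹ (conj c * yt N b μ m)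

/-- The function `φ(c y, c̄ ỹ)`. -/
noncomputable def dilogFn (N : ℕ) (b c : ℂ) : Fn N := fun μ m =>
  (dilogDen N b c μ m / dilogNum N b c μ m)⁻¹

variable {N : ℕ} {b : ℂ}

lemma dilogOp_eq (c : ℂ) : dilogOp N b c = mulOp (dilogFn N b c) := rfl

lemma dilogInvOp_eq (c : ℂ) :
    dilogInvOp N b c = mulOp fun μ m => (dilogFn N b c μ m)⁻¹ := rfl

lemma conj_eq_inv (hb : ‖b‖ = 1) : conj b = b⁻¹ := (Complex.inv_eq_conj hb).symm

lemma inv_re (hb : ‖b‖ = 1) : (b⁻¹).re = b.re := by rw [← conj_eq_inv hb, conj_re]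

lemma norm_gq (β : ℂ) : ‖gq N β‖ = Real.exp (-(Real.pi / N * (2 * β.re * β.im))) := by
  rw [gq, Complex.norm_exp]
  congr 1
  have : (Real.pi * I / N * (1 + β ^ 2) : ℂ) = ((Real.pi / N : ℝ) : ℂ) * (I * (1 + β ^ 2)) := by
    push_cast
    ring
  rw [this, Complex.re_ofReal_mul]
  simp [sq]
  ring

/-- For |b| = 1 complex conjugation is b ↦ b⁻¹, hence exchanges the two members of each pair;
unitarity and Hermitian conjugation both come from this. -/
lemma conj_q (hb : ‖b‖ = 1) : conj (q N b) = (qt N b)⁻¹ := by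
  rw [q, qt, ← Complex.exp_conj, ← Complex.exp_neg]
  congr 1
  simp [conj_eq_inv hb]
  ring

section zeros

variable [NeZero N]

lemma norm_q_lt (hre : 0 < b.re) (him : 0 < b.im) : ‖q N b‖ < 1 := by
  have : q N b = gq N b := rfl
  rw [this, norm_gq, Real.exp_lt_one_iff, neg_lt_zero]
  have := Nat.pos_of_ne_zero (NeZero.ne N)
  have := Real.pi_pos
  positivity

lemma norm_qt_inv_lt (hb : ‖b‖ = 1) (hre : 0 < b.re) (him : 0 < b.im) :
    ‖(qt N b)⁻¹‖ < 1 := by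
  rw [← conj_q hb, RCLike.norm_conj]
  exact norm_q_lt hre him

lemma conj_y (hb : ‖b‖ = 1) (z : ℂ) (m : ZMod N) : conj (y N b z m) = yt N b (conj z) m := by
  rw [y, yt, ← Complex.exp_conj]
  congr 1
  simp only [map_mul, map_div₀, map_sub, map_neg, conj_I, conj_ofReal, map_natCast, map_ofNat,
    conj_eq_inv hb]
  ring

/-- Numerator and denominator of φ are reflections of each other in the real axis. Hence |φ| = 1 on
ℝ, and the conjugate of φ at z̄ is φ(z)⁻¹. -/
lemma conj_dilogDen (hb : ‖b‖ = 1) (hre : 0 < b.re) (him : 0 < b.im) (c z : ℂ) (m : ZMod N) :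
    conj (dilogDen N b c z m) = dilogNum N b c (conj z) m := by
  rw [dilogDen, conj_qprod (norm_q_lt hre him), conj_q hb, map_mul, conj_y hb, dilogNum]

lemma conj_dilogNum (hb : ‖b‖ = 1) (hre : 0 < b.re) (him : 0 < b.im) (c z : ℂ) (m : ZMod N) :
    conj (dilogNum N b c z m) = dilogDen N b c (conj z) m := by
  rw [← conj_conj z, ← conj_dilogDen hb hre him, conj_conj, conj_conj]

lemma conj_dilogFn (hb : ‖b‖ = 1) (hre : 0 < b.re) (him : 0 < b.im) (c z : ℂ) (m : ZMod N) :
    conj (dilogFn N b c (conj z) m) = (dilogFn N b c z m)⁻¹ := by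
  rw [dilogFn, dilogFn, map_inv₀, map_div₀, conj_dilogDen hb hre him, conj_dilogNum hb hre him,
    conj_conj, inv_div, inv_inv]

lemma differentiable_y (m : ZMod N) : Differentiable ℂ fun z => y N b z m := by
  unfold y
  fun_prop

lemma differentiable_yt (m : ZMod N) : Differentiable ℂ fun z => yt N b z m := by
  unfold yt
  fun_prop

lemma differentiable_dilogDen (hre : 0 < b.re) (him : 0 < b.im) (c : ℂ) (m : ZMod N) :
    Differentiable ℂ fun z => dilogDen N b c z m :=
  (differentiable_qprod (norm_q_lt hre him)).comp ((differentiable_y m).const_mul c)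

lemma differentiable_dilogNum (hb : ‖b‖ = 1) (hre : 0 < b.re) (him : 0 < b.im) (c : ℂ)
    (m : ZMod N) : Differentiable ℂ fun z => dilogNum N b c z m :=
  (differentiable_qprod (norm_qt_inv_lt hb hre him)).comp ((differentiable_yt m).const_mul _)

/-- Two real solutions would give equal moduli exp(Re γ · x), so there is at most one. -/
lemma ae_exp_ne {γ : ℂ} (hγ : γ.re ≠ 0) (a : ℂ) : ∀ᵐ x : ℝ, 1 + a * exp (γ * x) ≠ 0 := by
  have : {x : ℝ | ¬ (1 + a * exp (γ * x) ≠ 0)}.Subsingleton := by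
    intro x hx x' hx'
    simp only [Set.mem_ofPred_eq, not_not] at hx hx'
    have h1 : a * exp (γ * x) = a * exp (γ * x') := by linear_combination hx - hx'
    have ha : a ≠ 0 := by
      rintro rfl
      simp at hx
    have h2 := congrArg norm (mul_left_cancel₀ ha h1)
    rw [Complex.norm_exp, Complex.norm_exp, Real.exp_eq_exp] at h2
    simp only [mul_re, ofReal_re, ofReal_im, mul_zero, sub_zero] at h2
    exact mul_left_cancel₀ hγ h2
  exact this.measure_zero _

lemma ae_qprod_ne {r γ : ℂ} (hr : ‖r‖ < 1) (hγ : γ.re ≠ 0) (a w : ℂ) :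
    ∀ᵐ x : ℝ, qprod r (a * exp (γ * (x + w))) ≠ 0 := by
  have : ∀ᵐ x : ℝ, ∀ j : ℕ, 1 + r ^ (2 * j + 1) * a * exp (γ * w) * exp (γ * x) ≠ 0 :=
    ae_all_iff.2 fun j => ae_exp_ne hγ _
  filter_upwards [this] with x hx h0
  obtain ⟨j, hj⟩ := (qprod_eq_zero_iff hr _).1 h0
  refine hx j ?_
  rw [← hj, mul_add, Complex.exp_add]
  ring

lemma y_eq (z : ℂ) (m : ZMod N) : y N b z m =
    exp (-(2 * Real.pi * I / N * (m.val : ℂ))) * exp ((2 * Real.pi / N : ℝ) * b * z) := by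
  rw [y, ← Complex.exp_add]
  congr 1
  push_cast
  linear_combination (-(2 * Real.pi / N * b * z)) * I_sq

lemma yt_eq (z : ℂ) (m : ZMod N) : yt N b z m =
    exp (2 * Real.pi * I / N * (m.val : ℂ)) * exp ((2 * Real.pi / N : ℝ) * b⁻¹ * z) := by
  rw [yt, ← Complex.exp_add]
  congr 1
  push_cast
  linear_combination (-(2 * Real.pi / N * b⁻¹ * z)) * I_sq

lemma two_pi_div_pos : (0 : ℝ) < 2 * Real.pi / N := by
  have := Nat.pos_of_ne_zero (NeZero.ne N)
  have := Real.pi_pos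
  positivity

lemma ae_dilogDen_ne (hre : 0 < b.re) (him : 0 < b.im) (c w : ℂ) (m : ZMod N) :
    ∀ᵐ x : ℝ, dilogDen N b c (x + w) m ≠ 0 := by
  have h := ae_qprod_ne (r := q N b) (γ := (2 * Real.pi / N : ℝ) * b) (norm_q_lt hre him)
    (by rw [Complex.re_ofReal_mul]; exact (mul_pos two_pi_div_pos hre).ne')
    (c * exp (-(2 * Real.pi * I / N * (m.val : ℂ)))) w
  simpa only [dilogDen, y_eq, mul_assoc] using h

lemma ae_dilogNum_ne (hb : ‖b‖ = 1) (hre : 0 < b.re) (him : 0 < b.im) (c w : ℂ) (m : ZMod N) :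
    ∀ᵐ x : ℝ, dilogNum N b c (x + w) m ≠ 0 := by
  have h := ae_qprod_ne (r := (qt N b)⁻¹) (γ := (2 * Real.pi / N : ℝ) * b⁻¹)
    (norm_qt_inv_lt hb hre him)
    (by rw [Complex.re_ofReal_mul, inv_re hb]; exact (mul_pos two_pi_div_pos hre).ne')
    (conj c * exp (2 * Real.pi * I / N * (m.val : ℂ))) w
  simpa only [dilogNum, yt_eq, mul_assoc] using h

lemma ae_dilogFn_ne (hb : ‖b‖ = 1) (hre : 0 < b.re) (him : 0 < b.im) (c w : ℂ) (m : ZMod N) :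
    ∀ᵐ x : ℝ, dilogFn N b c (x + w) m ≠ 0 := by
  filter_upwards [ae_dilogDen_ne hre him c w m, ae_dilogNum_ne hb hre him c w m] with x h1 h2
  exact inv_ne_zero (div_ne_zero h1 h2)

lemma norm_dilogFn (hb : ‖b‖ = 1) (hre : 0 < b.re) (him : 0 < b.im) (c : ℂ) (m : ZMod N) :
    ∀ᵐ x : ℝ, ‖dilogFn N b c x m‖ = 1 := by
  filter_upwards [ae_dilogDen_ne hre him c 0 m] with x h1
  rw [add_zero] at h1
  have := conj_dilogDen hb hre him c x m
  rw [conj_ofReal] at this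
  rw [dilogFn, ← this, norm_inv, norm_div, RCLike.norm_conj, div_self (norm_ne_zero_iff.2 h1),
    inv_one]

/-- The functional equation in the variable `y`. -/
lemma dilogFn_shift (hre : 0 < b.re) (him : 0 < b.im) (c z : ℂ) (m : ZMod N)
    (h : 1 + q N b * (c * y N b z m) ≠ 0) :
    dilogFn N b c (z + I * b) (m + -1) = (1 + q N b * (c * y N b z m)) * dilogFn N b c z m := by
  have h1 := gy_shift (N := N) (β := b) (ε := 1) (by norm_num) 1 z m
  have h2 : y N b (z + I * b) (m + -1) = q N b ^ 2 * y N b z m := by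
    have e1 : z + I * b = z + (1 : ℤ) * (I * b) := by push_cast; ring
    have e2 : m + -1 = m + -(((1 : ℤ) : ZMod N) * ((1 : ℤ) : ZMod N)) := by push_cast; ring
    have e3 : gq N b ^ (2 * 1 : ℤ) = q N b ^ 2 := by rw [mul_one]; exact zpow_ofNat _ 2
    rw [← gy_one, e1, e2, h1, e3]
  -- The shift u commutes with ỹ, so the numerator is unchanged while the denominator loses its
  -- first factor.
  have h3 : yt N b (z + I * b) (m + -1) = yt N b z m := by
    rw [← gy_neg_one, gy_add]
    have : (-1 : ZMod N) = ((-1 : ℤ) : ZMod N) := by push_cast; ring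
    rw [this, gy_intCast]
    have hb0 : b ≠ 0 := by
      rintro rfl
      simp at hre
    have : exp (2 * Real.pi * I / N * (-I * b⁻¹ * (I * b) - (-1 : ℤ) * (-1 : ℤ))) = 1 := by
      rw [← Complex.exp_zero]
      congr 1
      push_cast
      field_simp
      linear_combination (-2 * Real.pi * I / N) * I_sq
    rw [this, mul_one]
  rw [dilogFn, dilogFn, dilogDen, dilogNum, dilogDen, dilogNum, h2, h3,
    qprod_eq (norm_q_lt hre him) (c * y N b z m)]
  have e : c * (q N b ^ 2 * y N b z m) = q N b ^ 2 * (c * y N b z m) := by ring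
  rw [e, inv_div, inv_div, mul_div_assoc', mul_div_mul_left _ _ h]

/-- The functional equation in the variable `ỹ`. -/
lemma dilogFn_shift' (hb : ‖b‖ = 1) (hre : 0 < b.re) (him : 0 < b.im) (c z : ℂ) (m : ZMod N) :
    dilogFn N b c (z + I * b⁻¹) (m + 1)
      = (1 + qt N b * (conj c * yt N b z m)) * dilogFn N b c z m := by
  have h1 := gy_shift (N := N) (β := b⁻¹) (ε := -1) (by norm_num) 1 z m
  have h2 : yt N b (z + I * b⁻¹) (m + 1) = qt N b ^ 2 * yt N b z m := by
    have e1 : z + I * b⁻¹ = z + (1 : ℤ) * (I * b⁻¹) := by push_cast; ring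
    have e2 : m + 1 = m + -(((-1 : ℤ) : ZMod N) * ((1 : ℤ) : ZMod N)) := by push_cast; ring
    have e3 : gq N b⁻¹ ^ (2 * 1 : ℤ) = qt N b ^ 2 := by rw [mul_one]; exact zpow_ofNat _ 2
    rw [← gy_neg_one, e1, e2, h1, e3]
  -- Now the denominator is fixed and the numerator gains a factor; nothing is cancelled, so no
  -- nonvanishing condition is needed.
  have h3 : y N b (z + I * b⁻¹) (m + 1) = y N b z m := by
    rw [← gy_one, gy_add]
    have : (1 : ZMod N) = ((1 : ℤ) : ZMod N) := by push_cast; ring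
    rw [this, gy_intCast]
    have hb0 : b ≠ 0 := by
      rintro rfl
      simp at hre
    have : exp (2 * Real.pi * I / N * (-I * b * (I * b⁻¹) - (1 : ℤ) * (1 : ℤ))) = 1 := by
      rw [← Complex.exp_zero]
      congr 1
      push_cast
      field_simp
      linear_combination (-2 * Real.pi * I / N) * I_sq
    rw [this, mul_one]
  have hq0 : qt N b ≠ 0 := Complex.exp_ne_zero _
  rw [dilogFn, dilogFn, dilogDen, dilogNum, dilogDen, dilogNum, h2, h3,
    qprod_eq (norm_qt_inv_lt hb hre him) (conj c * (qt N b ^ 2 * yt N b z m))]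
  have e : (qt N b)⁻¹ ^ 2 * (conj c * (qt N b ^ 2 * yt N b z m)) = conj c * yt N b z m := by
    field_simp
  have e2 : (qt N b)⁻¹ * (conj c * (qt N b ^ 2 * yt N b z m))
      = qt N b * (conj c * yt N b z m) := by
    field_simp
  rw [e, e2, inv_div, inv_div, mul_div_assoc]

/-! ### Cancellation of poles for even `N` -/

/-- The zeros of the denominator above the line `Im z = -Re b` are cancelled by the numerator. -/
lemma dilogNum_eq_zero (hN : Even N) (hb : ‖b‖ = 1) (hre : 0 < b.re) (him : 0 < b.im)
    (x : ℝ) (k : ZMod N) {z : ℂ} {m : ZMod N} (hz : -b.re ≤ z.im)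
    (h0 : dilogDen N b (y N b x k) z m = 0) :
    z = -x - I * b.re ∨ dilogNum N b (y N b x k) z m = 0 := by
  obtain ⟨n', rfl⟩ := exists_intCast m
  obtain ⟨k', rfl⟩ := exists_intCast k
  obtain ⟨j, hj⟩ := (qprod_eq_zero_iff (norm_q_lt hre him) _).1 h0
  obtain ⟨h, hh⟩ := hN
  have hNc : (N : ℂ) = 2 * h := by rw [hh]; push_cast; ring
  have hN0 := natCast_ne_zero' (N := N)
  have hh0 : (h : ℂ) ≠ 0 := by
    intro h'
    rw [hNc, h'] at hN0
    simp at hN0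
  have hpi : (Real.pi : ℂ) ≠ 0 := by exact_mod_cast Real.pi_ne_zero
  have hb0 : b ≠ 0 := by
    rintro rfl
    simp at hre
  set w : ℂ := x + z with hw
  set n : ℤ := k' + n' with hn
  rw [← gy_one, ← gy_add, ← Int.cast_add, gy_intCast, q, ← Complex.exp_nat_mul,
    ← Complex.exp_add] at hj
  have hexp : exp ((2 * j + 1 : ℕ) * (Real.pi * I / N * (1 + b ^ 2)) +
      2 * Real.pi * I / N * (-I * b * w - (1 : ℤ) * n)) = exp (Real.pi * I) := by
    rw [Complex.exp_pi_mul_I]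
    linear_combination hj
  obtain ⟨t, ht⟩ := Complex.exp_eq_exp_iff_exists_int.1 hexp
  -- The exponent at a zero is an odd multiple of πi. Divided by 2πi/N this becomes (N/2)(2t + 1),
  -- an integer exactly because N = 2h is even.
  have hlin : (j + 1 / 2) * (1 + b ^ 2) - I * b * w - n = h * (2 * t + 1) := by
    have h2 : (2 * Real.pi * I / N) * ((j + 1 / 2) * (1 + b ^ 2) - I * b * w - n)
        = (2 * Real.pi * I / N) * (h * (2 * t + 1)) := by
      have e1 : (2 * Real.pi * I / N) * (h * (2 * t + 1)) = Real.pi * I + t * (2 * Real.pi * I) := by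
        rw [hNc]
        field_simp
        ring
      rw [e1, ← ht]
      push_cast
      field_simp
      ring
    exact mul_left_cancel₀
      (div_ne_zero (mul_ne_zero (mul_ne_zero two_ne_zero hpi) I_ne_zero) hN0) h2
  -- With this integer the zeros take the symmetric form iw = (j + 1/2)b - (l + 1/2)b⁻¹. For l ≥ 0
  -- this is also a zero of the factor with index l in the numerator.
  set l : ℤ := h * (2 * t + 1) + n - j - 1 with hl
  have hlc : (l : ℂ) = h * (2 * t + 1) + n - j - 1 := by rw [hl]; push_cast; ring
  have hIw : I * w = (j + 1 / 2) * b - (l + 1 / 2) * b⁻¹ := by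
    have : b * (I * w) = b * ((j + 1 / 2) * b - (l + 1 / 2) * b⁻¹) := by
      have e : b * ((j + 1 / 2) * b - (l + 1 / 2) * b⁻¹) = (j + 1 / 2) * b ^ 2 - (l + 1 / 2) := by
        field_simp
      rw [e, hlc]
      linear_combination -hlin
    exact mul_left_cancel₀ hb0 this
  have him' : z.im = b.re * (l - j) := by
    have e := congrArg re hIw
    have e2 : (I * w).re = -z.im := by simp [hw]
    have e3 : (((j : ℂ) + 1 / 2) * b - ((l : ℂ) + 1 / 2) * b⁻¹).re
        = (j + 1 / 2) * b.re - (l + 1 / 2) * b.re := by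
      have f1 : ((j : ℂ) + 1 / 2) = ((j + 1 / 2 : ℝ) : ℂ) := by push_cast; ring
      have f2 : ((l : ℂ) + 1 / 2) = ((l + 1 / 2 : ℝ) : ℂ) := by push_cast; ring
      rw [f1, f2, sub_re, Complex.re_ofReal_mul, Complex.re_ofReal_mul, inv_re hb]
    rw [e2, e3] at e
    linarith
  -- As b and b⁻¹ have the same real part, Im z = (l - j) Re b, and the bound on Im z reads l ≥ j -
  -- 1.
  have hlj : (j : ℤ) - 1 ≤ l := by
    have : (-1 : ℝ) ≤ l - j := by
      by_contra hcon
      rw [not_le] at hcon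
      nlinarith
    have : (((j : ℤ) - 1 : ℤ) : ℝ) ≤ (l : ℝ) := by push_cast; linarith
    exact_mod_cast this
  -- Only j = 0, l = -1 escapes cancellation; it is the single point on the boundary line.
  by_cases hl0 : 0 ≤ l
  · right
    obtain ⟨l', hl'⟩ := Int.eq_ofNat_of_zero_le hl0
    refine (qprod_eq_zero_iff (norm_qt_inv_lt hb hre him) _).2 ⟨l', ?_⟩
    rw [conj_y hb, conj_ofReal, ← gy_neg_one, ← gy_add, ← Int.cast_add, gy_intCast, qt,
      ← Complex.exp_neg, ← Complex.exp_nat_mul, ← Complex.exp_add]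
    have hl'' : (l : ℂ) = l' := by rw [hl']; simp
    have e : (2 * l' + 1 : ℕ) * (-(Real.pi * I / N * (1 + b⁻¹ ^ 2))) +
        2 * Real.pi * I / N * (-I * b⁻¹ * w - (-1 : ℤ) * n)
        = Real.pi * I + (-t - 1 : ℤ) * (2 * Real.pi * I) := by
      have e1 : -I * b⁻¹ * w = -(j + 1 / 2) + (l + 1 / 2) * b⁻¹ ^ 2 := by
        have : -I * b⁻¹ * w = -b⁻¹ * (I * w) := by ring
        rw [this, hIw]
        field_simp
        ring
      have e2 : (2 * l' + 1 : ℕ) * (-(Real.pi * I / N * (1 + b⁻¹ ^ 2))) +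
        2 * Real.pi * I / N * (-I * b⁻¹ * w - (-1 : ℤ) * n)
        = 2 * Real.pi * I / N * (-(h * (2 * t + 1))) := by
        rw [e1]
        have : (n : ℂ) = l - h * (2 * t + 1) + j + 1 := by rw [hlc]; ring
        rw [this, hl'']
        push_cast
        ring
      rw [e2, hNc]
      field_simp
      push_cast
      ring
    rw [e, Complex.exp_add, Complex.exp_int_mul_two_pi_mul_I, Complex.exp_pi_mul_I]
    ring
  · left
    have hj0 : j = 0 := by omega
    have hl1 : l = -1 := by omega
    have e : I * w = b.re := by
      rw [hIw, hj0, hl1]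
      have : (b + b⁻¹) = (2 * b.re : ℝ) := by
        rw [← conj_eq_inv hb, Complex.add_conj]
      push_cast at this
      push_cast
      linear_combination this / 2
    have : w = -I * b.re := by
      linear_combination (-I) * e + w * I_sq
    rw [hw] at this
    linear_combination this

end zeros

end LevelN

namespace LevelN

open Filter Topology

set_option linter.unusedSectionVars false

/-! ### Multipliers with at most a simple pole on the boundary of a strip -/

variable {N : ℕ}

/-- `M = A / (z - p̄)` and `M⁻¹ = B / (z - p)` with `Im p = Im s` and with `A`, `B` analytic and of
at most exponential growth in the strip `|Im z| ≤ |Im s|`; moreover `M` is unimodular on `ℝ`. -/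
structure StripMult (s : ℂ) (M : Fn N) (p : ℂ) (A B : Fn N) : Prop where
  im_eq : p.im = s.im
  diffA : ∀ m, ∀ z : ℂ, |z.im| ≤ |s.im| → DifferentiableAt ℂ (fun z => A z m) z
  diffB : ∀ m, ∀ z : ℂ, |z.im| ≤ |s.im| → DifferentiableAt ℂ (fun z => B z m) z
  growthA : ∃ C c, 0 ≤ C ∧ 0 ≤ c ∧ ∀ m, ∀ z : ℂ, |z.im| ≤ |s.im| →
    ‖A z m‖ ≤ C * Real.exp (c * |z.re|)
  growthB : ∃ C c, 0 ≤ C ∧ 0 ≤ c ∧ ∀ m, ∀ z : ℂ, |z.im| ≤ |s.im| →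
    ‖B z m‖ ≤ C * Real.exp (c * |z.re|)
  eqA : ∀ w : ℂ, ∀ m, ∀ᵐ x : ℝ, M (x + w) m = A (x + w) m / (x + w - conj p)
  eqB : ∀ w : ℂ, ∀ m, ∀ᵐ x : ℝ, (M (x + w) m)⁻¹ = B (x + w) m / (x + w - p)
  norm_eq : ∀ m, ∀ᵐ x : ℝ, ‖M x m‖ = 1

lemma StripMult.inv {s : ℂ} {M : Fn N} {p : ℂ} {A B : Fn N} (h : StripMult s M p A B)
    {s' : ℂ} (hs : s'.im = -s.im) : StripMult s' (fun μ m => (M μ m)⁻¹) (conj p) B A where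
  im_eq := by rw [conj_im, h.im_eq, hs]
  diffA := by simpa only [hs, abs_neg] using h.diffB
  diffB := by simpa only [hs, abs_neg] using h.diffA
  growthA := by simpa only [hs, abs_neg] using h.growthB
  growthB := by simpa only [hs, abs_neg] using h.growthA
  eqA := by simpa only [conj_conj] using h.eqB
  eqB := by simpa only [inv_inv] using h.eqA
  norm_eq m := by
    filter_upwards [h.norm_eq m] with x hx
    rw [norm_inv, hx, inv_one]

/-! ### The quantum dilogarithm as a strip multiplier -/

section dilog

variable [NeZero N] {b : ℂ}

/-- Quasi-periodicity under the real translation by `2 Im b`. -/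
lemma dilog_add (hre : 0 < b.re) (him : 0 < b.im) (hb : ‖b‖ = 1) (c z : ℂ) (m : ZMod N) :
    dilogDen N b c (z + (2 * b.im : ℝ)) (m + 2)
      = (1 + (q N b)⁻¹ * (c * y N b z m)) * dilogDen N b c z m ∧
    dilogNum N b c (z + (2 * b.im : ℝ)) (m + 2)
      = (1 + qt N b * (conj c * yt N b z m)) * dilogNum N b c z m := by
  have hb0 : b ≠ 0 := by
    rintro rfl
    simp at hre
  -- The real translation by 2 Im b is the shift by ib⁻¹ followed by the inverse of the shift by ib;
  -- the steps in m add up to 2.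
  have hv : ((2 * b.im : ℝ) : ℂ) = I * b⁻¹ - I * b := by
    have : b - b⁻¹ = 2 * b.im * I := by
      rw [← conj_eq_inv hb, Complex.sub_conj]
      push_cast
      ring
    have h2 : (2 * b.im : ℂ) = -I * (b - b⁻¹) := by
      rw [this]
      linear_combination (2 * (b.im : ℂ)) * I_sq
    push_cast
    rw [h2]
    ring
  have hN0 := natCast_ne_zero' (N := N)
  have e2 : m + 2 = m + ((2 : ℤ) : ZMod N) := by push_cast; ring
  have hq0 : q N b ≠ 0 := Complex.exp_ne_zero _
  have hqt0 : qt N b ≠ 0 := Complex.exp_ne_zero _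
  have hy : y N b (z + (2 * b.im : ℝ)) (m + 2) = (q N b)⁻¹ ^ 2 * y N b z m := by
    rw [← gy_one, e2, gy_add, gy_intCast, mul_comm, hv]
    congr 1
    rw [q, ← Complex.exp_neg, ← Complex.exp_nat_mul]
    congr 1
    push_cast
    field_simp
    linear_combination (-(1 - b ^ 2)) * I_sq
  have hyt : yt N b (z + (2 * b.im : ℝ)) (m + 2) = qt N b ^ 2 * yt N b z m := by
    rw [← gy_neg_one, e2, gy_add, gy_intCast, mul_comm, hv]
    congr 1
    rw [qt, ← Complex.exp_nat_mul]
    congr 1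
    push_cast
    field_simp
    linear_combination (-(1 - b ^ 2)) * I_sq
  constructor
  · rw [dilogDen, dilogDen, hy, qprod_eq (norm_q_lt hre him)]
    congr 2
    · field_simp
    · field_simp
  · rw [dilogNum, dilogNum, hyt, qprod_eq (norm_qt_inv_lt hb hre him)
      (conj c * (qt N b ^ 2 * yt N b z m))]
    have f1 : (qt N b)⁻¹ * (conj c * (qt N b ^ 2 * yt N b z m))
        = qt N b * (conj c * yt N b z m) := by field_simp
    have f2 : (qt N b)⁻¹ ^ 2 * (conj c * (qt N b ^ 2 * yt N b z m)) = conj c * yt N b z m := by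
      field_simp
    rw [f1, f2]

lemma norm_y (z : ℂ) (m : ZMod N) :
    ‖y N b z m‖ = Real.exp (2 * Real.pi / N * (b.re * z.re - b.im * z.im)) := by
  have h1 : (-(2 * Real.pi * I / N * (m.val : ℂ))) = ((-(2 * Real.pi / N * m.val) : ℝ) : ℂ) * I := by
    push_cast
    ring
  rw [y_eq, norm_mul, h1, Complex.norm_exp_ofReal_mul_I, one_mul, Complex.norm_exp, mul_assoc,
    Complex.re_ofReal_mul, mul_re]

lemma norm_yt (hb : ‖b‖ = 1) (z : ℂ) (m : ZMod N) :
    ‖yt N b z m‖ = Real.exp (2 * Real.pi / N * (b.re * z.re + b.im * z.im)) := by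
  have := conj_y (N := N) hb (conj z) m
  rw [conj_conj] at this
  rw [← this, RCLike.norm_conj, norm_y]
  simp

/-- Extends an estimate that is available only off the zeros of the denominators to every point of
the strip. -/
lemma le_of_ae_of_continuousAt {f g : ℝ → ℝ} (hf : ContinuousAt f 0) (hg : ContinuousAt g 0)
    (h : ∀ᵐ t : ℝ, |t| < 1 → f t ≤ g t) : f 0 ≤ g 0 := by
  by_contra hcon
  rw [not_le] at hcon
  have h1 : ∀ᶠ t in 𝓝 (0 : ℝ), g t < f t := hg.eventually_lt hf hcon
  have h2 : ∀ᶠ t in 𝓝 (0 : ℝ), |t| < 1 := by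
    have : Metric.ball (0 : ℝ) 1 ∈ 𝓝 0 := Metric.ball_mem_nhds _ one_pos
    filter_upwards [this] with t ht
    simpa using ht
  obtain ⟨U, hU, hUo, hU0⟩ := mem_nhds_iff.1 (h1.and h2)
  obtain ⟨t, ht1, ht2⟩ := (Measure.dense_of_ae h).inter_open_nonempty U hUo ⟨0, hU0⟩
  obtain ⟨ht3, ht4⟩ := hU ht1
  exact absurd (ht2 ht4) (not_le.2 ht3)

/-- The function `(z - p̄) φ(c y, c̄ ỹ)` with its removable singularities removed. -/
noncomputable def dilogReg (N : ℕ) (b c p : ℂ) : Fn N := fun z m =>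
  quot (fun w => (w - conj p) * dilogNum N b c w m) (fun w => dilogDen N b c w m) z

lemma dilogReg_of_ne {c p z : ℂ} {m : ZMod N} (h : dilogDen N b c z m ≠ 0) :
    dilogReg N b c p z m = (z - conj p) * dilogNum N b c z m / dilogDen N b c z m :=
  quot_of_ne h

/-- The zeros of `qprod` are simple, and y has no critical points. -/
lemma deriv_dilogDen_ne (hre : 0 < b.re) (him : 0 < b.im) {c z : ℂ} (hc : c ≠ 0) {m : ZMod N}
    (h : dilogDen N b c z m = 0) : deriv (fun w => dilogDen N b c w m) z ≠ 0 := by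
  have h1 := deriv_qprod_ne_zero (norm_q_lt hre him) h
  have h2 : HasDerivAt (fun w => c * y N b w m)
      (c * (y N b z m * (2 * Real.pi * I / N * (-I * b)))) z := by
    have h3 : HasDerivAt (fun w => 2 * Real.pi * I / N * (-I * b * w - (m.val : ℂ)))
        (2 * Real.pi * I / N * (-I * b)) z := by
      simpa using (((hasDerivAt_id z).const_mul (-I * b)).sub_const _).const_mul
        (2 * Real.pi * I / N)
    exact h3.cexp.const_mul c
  have h3 := ((differentiable_qprod (norm_q_lt (N := N) hre him)) (c * y N b z m)).hasDerivAt.comp z h2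
  have h4 : deriv (fun w => dilogDen N b c w m) z = _ := h3.deriv
  rw [h4]
  have hpi : (Real.pi : ℂ) ≠ 0 := by exact_mod_cast Real.pi_ne_zero
  have hb0 : b ≠ 0 := by
    rintro rfl
    simp at hre
  refine mul_ne_zero h1 (mul_ne_zero hc (mul_ne_zero (Complex.exp_ne_zero _) ?_))
  exact mul_ne_zero (div_ne_zero (mul_ne_zero (mul_ne_zero two_ne_zero hpi) I_ne_zero)
    (natCast_ne_zero' (N := N))) (mul_ne_zero (neg_ne_zero.2 I_ne_zero) hb0)

lemma y_ne_zero (z : ℂ) (m : ZMod N) : y N b z m ≠ 0 := Complex.exp_ne_zero _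

lemma differentiableAt_dilogReg (hN : Even N) (hb : ‖b‖ = 1) (hre : 0 < b.re) (him : 0 < b.im)
    (x : ℝ) (k : ZMod N) {z : ℂ} (hz : -b.re ≤ z.im) (m : ZMod N) :
    DifferentiableAt ℂ (fun z => dilogReg N b (y N b x k) (-x + I * b.re) z m) z := by
  refine differentiableAt_quot
    ((differentiable_id.sub_const _).mul (differentiable_dilogNum hb hre him _ m))
    (differentiable_dilogDen hre him _ m) fun h0 => ⟨?_, deriv_dilogDen_ne hre him (y_ne_zero _ _) h0⟩
  change (z - conj (-x + I * b.re)) * dilogNum N b (y N b x k) z m = 0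
  rcases dilogNum_eq_zero hN hb hre him x k hz h0 with h | h
  · simp only [h, map_add, map_neg, map_mul, conj_ofReal, conj_I]
    ring
  · rw [h, mul_zero]

lemma dilogReg_add (hre : 0 < b.re) (him : 0 < b.im) (hb : ‖b‖ = 1) (c p z : ℂ) (m : ZMod N)
    (h : dilogDen N b c z m ≠ 0) (h' : dilogDen N b c (z + (2 * b.im : ℝ)) (m + 2) ≠ 0) :
    dilogReg N b c p (z + (2 * b.im : ℝ)) (m + 2) *
      ((1 + (q N b)⁻¹ * (c * y N b z m)) * (z - conj p))
      = (z + (2 * b.im : ℝ) - conj p) * (1 + qt N b * (conj c * yt N b z m)) *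
        dilogReg N b c p z m := by
  obtain ⟨h1, h2⟩ := dilog_add hre him hb c z m
  rw [dilogReg_of_ne h, dilogReg_of_ne h', h1, h2]
  rw [h1] at h'
  have h3 := left_ne_zero_of_mul h'
  generalize 1 + (q N b)⁻¹ * (c * y N b z m) = a at *
  generalize 1 + qt N b * (conj c * yt N b z m) = a' at *
  field_simp

/-- Translation by 2 Im b multiplies the regularised function by (1 + q̃ c̄ỹ)/(1 + q⁻¹ c y) and by a
quotient of linear factors. Far to the right y and ỹ have comparable moduli, far to the left both
are small, so the factor is bounded outwards in both directions and `exp_bound_of_quasiperiodic`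
applies. -/
lemma dilogReg_growth (hN : Even N) (hb : ‖b‖ = 1) (hre : 0 < b.re) (him : 0 < b.im)
    (x : ℝ) (k : ZMod N) :
    ∃ C c, 0 ≤ C ∧ 0 ≤ c ∧ ∀ m, ∀ z : ℂ, |z.im| ≤ b.re →
      ‖dilogReg N b (y N b x k) (-x + I * b.re) z m‖ ≤ C * Real.exp (c * |z.re|) := by
  set p : ℂ := -x + I * b.re with hp
  set c := y N b x k with hc
  set A := dilogReg N b c p with hA
  set v : ℝ := 2 * b.im with hv
  have hv0 : 0 < v := by positivity
  set g : ℝ := 2 * Real.pi / N with hg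
  have hg0 : 0 < g := two_pi_div_pos
  set d : ℝ := b.im * b.re with hd
  set κ : ℝ := ‖qt N b‖ with hκ
  have hqt0 : qt N b ≠ 0 := Complex.exp_ne_zero _
  have hκ1 : 1 ≤ κ := by
    have := norm_qt_inv_lt (N := N) hb hre him
    rw [norm_inv] at this
    exact ((inv_lt_one₀ (norm_pos_iff.2 hqt0)).1 this).le
  have hqκ : ‖(q N b)⁻¹‖ = κ := by
    rw [norm_inv, ← RCLike.norm_conj, conj_q hb, norm_inv, inv_inv]
  set K1 := Real.exp (2 * g * d) with hK1
  set R₀ : ℝ := |x| + 1 + (d + Real.log (2 * κ) / g) / b.re with hR₀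
  have hcont : ∀ m, ∀ z : ℂ, |z.im| ≤ b.re → ContinuousAt (fun z => A z m) z := fun m z hz =>
    (differentiableAt_dilogReg hN hb hre him x k (abs_le.1 hz).1 m).continuousAt
  have hlog : 0 ≤ Real.log (2 * κ) := Real.log_nonneg (by linarith)
  -- the sizes of the coordinates
  have hY : ∀ m (z : ℂ), c * y N b z m = y N b (x + z) (k + m) := fun m z => by
    rw [hc, ← gy_one, gy_add]
  have hYt : ∀ m (z : ℂ), conj c * yt N b z m = yt N b (x + z) (k + m) := fun m z => by
    rw [hc, conj_y hb, conj_ofReal, ← gy_neg_one, gy_add]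
  have hdz : ∀ z : ℂ, |z.im| ≤ b.re → |b.im * z.im| ≤ d := fun z hz => by
    rw [abs_mul, abs_of_pos him]
    exact mul_le_mul_of_nonneg_left hz him.le
  have hbig : ∀ m (z : ℂ), |z.im| ≤ b.re → R₀ ≤ z.re → 2 * κ ≤ ‖c * y N b z m‖ ∧
      ‖conj c * yt N b z m‖ ≤ K1 * ‖c * y N b z m‖ := by
    intro m z hz hR
    obtain ⟨h1, h2⟩ := abs_le.1 (hdz z hz)
    rw [hY, hYt, norm_y, norm_yt hb, hK1, ← Real.exp_add]
    simp only [add_re, ofReal_re, add_im, ofReal_im, zero_add]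
    constructor
    · rw [← Real.log_le_iff_le_exp (by linarith)]
      have h3 : (d + Real.log (2 * κ) / g) ≤ b.re * (x + z.re) := by
        have : (d + Real.log (2 * κ) / g) / b.re ≤ x + z.re := by
          have := neg_abs_le x
          linarith
        rwa [div_le_iff₀' hre] at this
      have h4 : Real.log (2 * κ) / g ≤ b.re * (x + z.re) - b.im * z.im := by linarith
      rwa [div_le_iff₀' hg0] at h4
    · refine Real.exp_le_exp.2 ?_
      have : g * (b.im * z.im) ≤ g * d := by gcongr
      linarith
  have hsmall : ∀ m (z : ℂ), |z.im| ≤ b.re → z.re ≤ -R₀ → κ * ‖c * y N b z m‖ ≤ 1 / 2 ∧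
      κ * ‖conj c * yt N b z m‖ ≤ 1 / 2 := by
    intro m z hz hR
    obtain ⟨h1, h2⟩ := abs_le.1 (hdz z hz)
    have h3 : (d + Real.log (2 * κ) / g) ≤ -(b.re * (x + z.re)) := by
      have : (d + Real.log (2 * κ) / g) / b.re ≤ -(x + z.re) := by
        have := le_abs_self x
        linarith
      rw [div_le_iff₀' hre] at this
      linarith
    have aux : ∀ e : ℝ, Real.log (2 * κ) / g ≤ -e → κ * Real.exp (g * e) ≤ 1 / 2 := by
      intro e he
      rw [div_le_iff₀' hg0] at he
      have h5 : Real.exp (g * e) ≤ Real.exp (-Real.log (2 * κ)) :=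
        Real.exp_le_exp.2 (by linarith)
      rw [Real.exp_neg, Real.exp_log (by linarith)] at h5
      calc κ * Real.exp (g * e) ≤ κ * (2 * κ)⁻¹ := by gcongr
        _ = 1 / 2 := by
          have : κ ≠ 0 := by linarith
          field_simp
    rw [hY, hYt, norm_y, norm_yt hb]
    simp only [add_re, ofReal_re, add_im, ofReal_im, zero_add]
    exact ⟨aux _ (by linarith), aux _ (by linarith)⟩
  have hpre : ∀ z : ℂ, R₀ ≤ |z.re| → 1 ≤ ‖z - conj p‖ := by
    intro z hz
    have h1 : (z - conj p).re = z.re + x := by simp [hp]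
    have h2 := Complex.abs_re_le_norm (z - conj p)
    rw [h1] at h2
    have h3 : |z.re| ≤ |z.re + x| + |x| := by
      have := abs_sub (z.re + x) x
      rwa [add_sub_cancel_right] at this
    have h4 : 0 ≤ (d + Real.log (2 * κ) / g) / b.re := by positivity
    linarith
  -- The factor 1 + v bounds the quotient of linear factors; the other quotient is at most 2(1 + K1)
  -- on the right and 2/(1/2) = 4 on the left.
  set K : ℝ := 4 * (1 + v) * (1 + K1) with hK
  have hK10 : 0 < K1 := Real.exp_pos _
  have good_r : ∀ m (z : ℂ), |z.im| ≤ b.re → R₀ ≤ z.re → dilogDen N b c z m ≠ 0 →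
      dilogDen N b c (z + v) (m + 2) ≠ 0 → ‖A (z + v) (m + 2)‖ ≤ K * ‖A z m‖ := by
    intro m z hz hR h1 h2
    have e := congrArg norm (dilogReg_add hre him hb c p z m h1 h2)
    rw [← hA, ← hv] at e
    simp only [norm_mul] at e
    obtain ⟨b1, b2⟩ := hbig m z hz hR
    have hP := hpre z (hR.trans (le_abs_self _))
    set Y := ‖c * y N b z m‖ with hYdef
    have f1 : ‖1 + qt N b * (conj c * yt N b z m)‖ ≤ 1 + κ * (K1 * Y) := by
      refine (norm_add_le _ _).trans ?_
      rw [norm_one, norm_mul]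
      gcongr
    have f2 : κ * Y / 2 ≤ ‖1 + (q N b)⁻¹ * (c * y N b z m)‖ := by
      have := norm_sub_le_norm_add ((q N b)⁻¹ * (c * y N b z m)) 1
      rw [norm_one, norm_mul, hqκ, add_comm _ (1 : ℂ)] at this
      have : 1 ≤ κ * Y / 2 := by nlinarith
      linarith
    have f3 : ‖1 + qt N b * (conj c * yt N b z m)‖
        ≤ 2 * (1 + K1) * ‖1 + (q N b)⁻¹ * (c * y N b z m)‖ := by
      have h5 : 1 + κ * (K1 * Y) ≤ (1 + K1) * (κ * Y) := by nlinarith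
      have h6 : 2 * (1 + K1) * (κ * Y / 2) ≤ 2 * (1 + K1) * ‖1 + (q N b)⁻¹ * (c * y N b z m)‖ := by
        gcongr
      linarith
    have f4 : ‖z + v - conj p‖ ≤ (1 + v) * ‖z - conj p‖ := by
      have : z + v - conj p = (z - conj p) + v := by ring
      rw [this]
      refine (norm_add_le _ _).trans ?_
      rw [Complex.norm_real, Real.norm_eq_abs, abs_of_pos hv0]
      nlinarith
    have hden : 0 < ‖1 + (q N b)⁻¹ * (c * y N b z m)‖ * ‖z - conj p‖ := by
      have : 0 < κ * Y / 2 := by nlinarith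
      exact mul_pos (this.trans_le f2) (by linarith)
    have hv' : ‖(v : ℂ)‖ = v := by rw [Complex.norm_real, Real.norm_eq_abs, abs_of_pos hv0]
    refine le_of_mul_le_mul_right ?_ hden
    rw [e]
    calc ‖z + v - conj p‖ * ‖1 + qt N b * (conj c * yt N b z m)‖ * ‖A z m‖
        ≤ ((1 + v) * ‖z - conj p‖) * (2 * (1 + K1) * ‖1 + (q N b)⁻¹ * (c * y N b z m)‖)
          * ‖A z m‖ := by gcongr
      _ ≤ _ := by
        rw [hK]
        have : 0 ≤ (1 + v) * (1 + K1) * ‖A z m‖ *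
          (‖1 + (q N b)⁻¹ * (c * y N b z m)‖ * ‖z - conj p‖) := by positivity
        linarith
  have good_l : ∀ m (z : ℂ), |z.im| ≤ b.re → z.re ≤ -R₀ → dilogDen N b c (z - v) (m - 2) ≠ 0 →
      dilogDen N b c z m ≠ 0 → ‖A (z - v) (m - 2)‖ ≤ K * ‖A z m‖ := by
    intro m z hz hR h1 h2
    have e := congrArg norm (dilogReg_add hre him hb c p (z - v) (m - 2) h1
      (by rwa [sub_add_cancel, sub_add_cancel]))
    rw [← hA, ← hv, sub_add_cancel, sub_add_cancel] at e
    simp only [norm_mul] at e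
    obtain ⟨b1, b2⟩ := hsmall (m - 2) (z - v) (by simpa using hz) (by simp; linarith)
    have hP := hpre z (by rw [le_abs]; right; linarith)
    have f1 : 1 / 2 ≤ ‖1 + qt N b * (conj c * yt N b (z - v) (m - 2))‖ := by
      have := norm_sub_le_norm_add 1 (qt N b * (conj c * yt N b (z - v) (m - 2)))
      rw [norm_one, norm_mul] at this
      linarith
    have f2 : ‖1 + (q N b)⁻¹ * (c * y N b (z - v) (m - 2))‖ ≤ 2 := by
      refine (norm_add_le _ _).trans ?_
      rw [norm_one, norm_mul, hqκ]
      linarith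
    have f4 : ‖z - v - conj p‖ ≤ (1 + v) * ‖z - conj p‖ := by
      have : z - v - conj p = (z - conj p) - v := by ring
      rw [this]
      refine (norm_sub_le _ _).trans ?_
      rw [Complex.norm_real, Real.norm_eq_abs, abs_of_pos hv0]
      nlinarith
    have hden : 0 < ‖z - conj p‖ * (1 / 2) := by linarith
    refine le_of_mul_le_mul_right ?_ hden
    calc ‖A (z - v) (m - 2)‖ * (‖z - conj p‖ * (1 / 2))
        ≤ ‖A (z - v) (m - 2)‖ * (‖z - conj p‖ *
          ‖1 + qt N b * (conj c * yt N b (z - v) (m - 2))‖) := by gcongr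
      _ = ‖z - conj p‖ * ‖1 + qt N b * (conj c * yt N b (z - v) (m - 2))‖ *
          ‖A (z - v) (m - 2)‖ := by ring
      _ = ‖A z m‖ * (‖1 + (q N b)⁻¹ * (c * y N b (z - v) (m - 2))‖ * ‖z - v - conj p‖) := e.symm
      _ ≤ ‖A z m‖ * (2 * ((1 + v) * ‖z - conj p‖)) := by gcongr
      _ ≤ _ := by
        rw [hK]
        have : 0 ≤ (1 + v) * K1 * (‖A z m‖ * ‖z - conj p‖) := by positivity
        linarith
  have hline : ∀ (w : ℂ), |w.im| ≤ b.re → ∀ m, ContinuousAt (fun t : ℝ => ‖A (w + t) m‖) 0 := by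
    intro w hw m
    have h1 : ContinuousAt (fun z => A z m) (w + (0 : ℝ)) := hcont m _ (by simpa using hw)
    exact (ContinuousAt.comp (f := fun t : ℝ => (w + t : ℂ)) h1 (by fun_prop)).norm
  -- `R₀ + 1` leaves room for the perturbation |t| < 1 by which the zeros of the denominators are
  -- avoided.
  refine exp_bound_of_quasiperiodic (h := b.re) (v := v) (R := R₀ + 1) (K := K) hv0
    (Equiv.addRight 2) (Equiv.subRight 2) hcont ?_ ?_
  · intro m z hz hR
    have := le_of_ae_of_continuousAt (hline (z + v) (by simpa using hz) (m + 2))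
      ((hline z hz m).const_mul K) ?_
    · simpa using this
    · filter_upwards [ae_dilogDen_ne hre him c z m, ae_dilogDen_ne hre him c (z + v) (m + 2)]
        with t h1 h2 ht
      have h3 : z + v + t = (z + t) + v := by ring
      rw [h3]
      refine good_r m (z + t) (by simpa using hz) ?_ (by rwa [add_comm]) ?_
      · have := (abs_lt.1 ht).1
        simp
        linarith
      · rw [← h3, add_comm]
        exact h2
  · intro m z hz hR
    have := le_of_ae_of_continuousAt (hline (z - v) (by simpa using hz) (m - 2))
      ((hline z hz m).const_mul K) ?_
    · simpa using this
    · filter_upwards [ae_dilogDen_ne hre him c z m, ae_dilogDen_ne hre him c (z - v) (m - 2)]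
        with t h1 h2 ht
      have h3 : z - v + t = (z + t) - v := by ring
      rw [h3]
      refine good_l m (z + t) (by simpa using hz) ?_ ?_ (by rwa [add_comm])
      · have := (abs_lt.1 ht).2
        simp
        linarith
      · rw [← h3, add_comm]
        exact h2

lemma ae_ne (w p : ℂ) : ∀ᵐ x : ℝ, (x + w - p : ℂ) ≠ 0 := by
  have : {x : ℝ | ¬ ((x + w - p : ℂ) ≠ 0)}.Subsingleton := by
    intro x hx x' hx'
    simp only [Set.mem_ofPred_eq, not_not] at hx hx'
    have : (x : ℂ) = x' := by linear_combination hx - hx'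
    exact_mod_cast this
  exact this.measure_zero _

/-- The quantum dilogarithm with a quantised parameter has simple poles on the boundary of the
strip at worst, if `N` is even. -/
theorem stripMult_dilogFn (hN : Even N) (hb : ‖b‖ = 1) (hre : 0 < b.re) (him : 0 < b.im)
    (x : ℝ) (k : ZMod N) {s : ℂ} (hs : s.im = b.re) :
    StripMult s (dilogFn N b (y N b x k)) (-x + I * b.re)
      (dilogReg N b (y N b x k) (-x + I * b.re))
      (fun z m => conj (dilogReg N b (y N b x k) (-x + I * b.re) (conj z) m)) := by
  have habs : |s.im| = b.re := by rw [hs, abs_of_pos hre]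
  have eqA : ∀ w : ℂ, ∀ m, ∀ᵐ t : ℝ, dilogFn N b (y N b x k) (t + w) m =
      dilogReg N b (y N b x k) (-x + I * b.re) (t + w) m / (t + w - conj (-x + I * b.re)) := by
    intro w m
    filter_upwards [ae_dilogDen_ne hre him (y N b x k) w m, ae_ne w (conj (-x + I * b.re))]
      with t h1 h2
    rw [dilogReg_of_ne h1, dilogFn, inv_div]
    field_simp
  refine ⟨by simp [hs], fun m z hz => ?_, fun m z hz => ?_, ?_, ?_, eqA, fun w m => ?_,
    norm_dilogFn hb hre him _⟩
  · rw [habs] at hz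
    exact differentiableAt_dilogReg hN hb hre him x k (abs_le.1 hz).1 m
  · rw [habs] at hz
    have := differentiableAt_dilogReg hN hb hre him x k (z := conj z)
      (by rw [conj_im]; linarith [(abs_le.1 hz).2]) m
    simpa [Function.comp_def] using this.conj_conj
  · rw [habs]
    exact dilogReg_growth hN hb hre him x k
  · rw [habs]
    obtain ⟨C, c, hC, hc, h⟩ := dilogReg_growth hN hb hre him x k
    refine ⟨C, c, hC, hc, fun m z hz => ?_⟩
    rw [RCLike.norm_conj]
    simpa using h m (conj z) (by simpa using hz)
  -- The reflection φ(z)⁻¹ = conj φ(z̄) turns the description of the pole of φ at p̄ into one of the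
  -- pole of φ⁻¹ at p.
  · filter_upwards [eqA (conj w) m] with t ht
    have e : (t + conj w : ℂ) = conj (t + w) := by simp
    rw [e] at ht
    rw [← conj_dilogFn hb hre him, ht, map_div₀, map_sub, conj_conj, conj_conj]

end dilog

end LevelN

namespace LevelN

open Filter Topology

set_option linter.unusedSectionVars false

variable {N : ℕ} [NeZero N]

/-! ### Conjugation of graphs by unitaries -/

lemma Realises.eq {W W' : Hilb N ≃ₗᵢ[ℂ] Hilb N} {A : FnOp N} (h : Realises W A)
    (h' : Realises W' A) : W = W' := by
  ext1 f
  obtain ⟨F, hF⟩ := exists_fn_rep f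
  exact (h F f hF).unique (h' F f hF)

/-- The inverse of a unitary is realised by an inverse of the operator on functions. -/
lemma Realises.inv {W : Hilb N ≃ₗᵢ[ℂ] Hilb N} {A A' : FnOp N} (h : Realises W A)
    (hloc : ∀ F G : Fn N, (∀ m, ∀ᵐ x : ℝ, F x m = G x m) → ∀ m, ∀ᵐ x : ℝ, A' F x m = A' G x m)
    (hinv : ∀ F : Fn N, ∀ m, ∀ᵐ x : ℝ, A' (A F) x m = F x m) : Realises W⁻¹ A' := by
  intro F f hF
  obtain ⟨G, hG⟩ := exists_fn_rep (W⁻¹ f)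
  have h1 := h G _ hG
  have h2 : W (W⁻¹ f) = f := W.apply_symm_apply f
  rw [h2] at h1
  refine hG.congr fun m => ?_
  filter_upwards [hloc _ _ (fun m => h1.ae_eq hF m) m, hinv G m] with x e1 e2
  rw [← e2, e1]

lemma Conjugates.trans {W W' : Hilb N ≃ₗᵢ[ℂ] Hilb N} {G G' G'' : Submodule ℂ (Hilb N × Hilb N)}
    (h : Conjugates W G G') (h' : Conjugates W' G' G'') : Conjugates (W' * W) G G'' :=
  fun f g => (h f g).trans (h' _ _)

lemma Conjugates.symm {W : Hilb N ≃ₗᵢ[ℂ] Hilb N} {G G' : Submodule ℂ (Hilb N × Hilb N)}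
    (h : Conjugates W G G') : Conjugates W⁻¹ G' G := fun f g => by
  have e : ∀ f, W (W⁻¹ f) = f := W.apply_symm_apply
  rw [h, e, e]

/-- Transport of graphs, for operators that are intertwined on the given class of functions. -/
lemma conjugates_graphOn {V : Submodule ℂ (Fn N)} {W : Hilb N ≃ₗᵢ[ℂ] Hilb N} {A A' X Z : FnOp N}
    (hW : Realises W A) (hW' : Realises W⁻¹ A') (hA : ∀ F ∈ V, A F ∈ V) (hA' : ∀ F ∈ V, A' F ∈ V)
    (h : ∀ F ∈ V, ∀ m, ∀ᵐ x : ℝ, A (X F) x m = Z (A F) x m)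
    (h' : ∀ F ∈ V, ∀ m, ∀ᵐ x : ℝ, A' (Z F) x m = X (A' F) x m) :
    Conjugates W (graphOn V X) (graphOn V Z) := by
  have e : ∀ f, W⁻¹ (W f) = f := W.symm_apply_apply
  intro f g
  constructor
  · rintro ⟨F, hF, h1, h2⟩
    exact ⟨A F, hA F hF, hW F f h1, (hW _ g h2).congr (h F hF)⟩
  · rintro ⟨F, hF, h1, h2⟩
    refine ⟨A' F, hA' F hF, ?_, ?_⟩
    · have := hW' F _ h1
      rwa [e] at this
    · have := (hW' _ _ h2).congr (h' F hF)
      rwa [e] at this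

/-- The preimage of a closed graph under W × W is closed, so only Gaussian vectors have to be
checked. -/
lemma map_closedGraph_of_repIn {W : Hilb N ≃ₗᵢ[ℂ] Hilb N} {A X Z : FnOp N} (hW : Realises W A)
    (h : ∀ F ∈ gaussFn N, RepIn (closedGraph Z) (A F) (A (X F))) {f g : Hilb N}
    (hfg : (f, g) ∈ closedGraph X) : (W f, W g) ∈ closedGraph Z := by
  let φ : (Hilb N × Hilb N) →L[ℂ] (Hilb N × Hilb N) :=
    (W.toContinuousLinearEquiv : Hilb N →L[ℂ] Hilb N).prodMap
      (W.toContinuousLinearEquiv : Hilb N →L[ℂ] Hilb N)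
  have h1 : coreGraph X ≤ (closedGraph Z).comap (φ : (Hilb N × Hilb N) →ₗ[ℂ] _) := by
    rintro ⟨f, g⟩ ⟨F, hF, h1, h2⟩
    exact (h F hF).mem (hW F f h1) (hW _ g h2)
  have h2 : IsClosed ((closedGraph Z).comap (φ : (Hilb N × Hilb N) →ₗ[ℂ] _) :
      Set (Hilb N × Hilb N)) := (isClosed_closedGraph Z).preimage φ.continuous
  exact (coreGraph X).topologicalClosure_minimal h1 h2 hfg

lemma conjugates_closedGraph {W : Hilb N ≃ₗᵢ[ℂ] Hilb N} {A A' X Z : FnOp N} (hW : Realises W A)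
    (hW' : Realises W⁻¹ A') (h : ∀ F ∈ gaussFn N, RepIn (closedGraph Z) (A F) (A (X F)))
    (h' : ∀ F ∈ gaussFn N, RepIn (closedGraph X) (A' F) (A' (Z F))) :
    Conjugates W (closedGraph X) (closedGraph Z) := fun f g =>
  ⟨map_closedGraph_of_repIn hW h, fun hfg => by
    have e : ∀ f, W⁻¹ (W f) = f := W.symm_apply_apply
    have := map_closedGraph_of_repIn hW' h' hfg
    rwa [e, e] at this⟩

/-- Transport of closed operators by a unitary that preserves the Gaussian functions. -/
lemma conjugates_closedGraph_of_gauss {W : Hilb N ≃ₗᵢ[ℂ] Hilb N} {A A' X Z : FnOp N}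
    {S : Set ℂ} (hX : X ∈ termSpan N S) (hZ : Z ∈ termSpan N S)
    (hW : Realises W A) (hW' : Realises W⁻¹ A') (hA : ∀ F ∈ gaussFn N, A F ∈ gaussFn N)
    (hA' : ∀ F ∈ gaussFn N, A' F ∈ gaussFn N) (h : A * X = Z * A) (h' : A' * Z = X * A') :
    Conjugates W (closedGraph X) (closedGraph Z) :=
  conjugates_closedGraph hW hW'
    (fun F hF => by
      have := LinearMap.congr_fun h F
      have e : A (X F) = Z (A F) := this
      rw [e]
      exact repIn_closedGraph hZ (hA F hF))
    (fun F hF => by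
      have := LinearMap.congr_fun h' F
      have e : A' (Z F) = X (A' F) := this
      rw [e]
      exact repIn_closedGraph hX (hA' F hF))

/-! ### Conjugation by a multiplier -/

/-- `X = R + ρ π (shift by s)` and `Z = R + ρ (shift by s)`, where the shift multiplies the
function `M` by `π`. -/
structure Twist (s : ℂ) (k : ZMod N) (M R ρ π : Fn N) (X Z : FnOp N) : Prop where
  hX : X = mulOp R + mulOp (ρ * π) * shiftOp s k
  hZ : Z = mulOp R + mulOp ρ * shiftOp s k
  memR : mulOp R ∈ termSpan N {0, s}
  memρ : mulOp ρ * shiftOp s k ∈ termSpan N {0, s}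
  memX : mulOp (ρ * π) * shiftOp s k ∈ termSpan N {0, s}
  shift : ∀ m, ∀ᵐ x : ℝ, M (x + s) (m + k) = π x m * M x m
  ne : ∀ w : ℂ, ∀ m, ∀ᵐ x : ℝ, M (x + w) m ≠ 0

namespace Twist

variable {s : ℂ} {k : ZMod N} {M R ρ π : Fn N} {X Z : FnOp N}

lemma X_apply (h : Twist s k M R ρ π X Z) (F : Fn N) (μ : ℂ) (m : ZMod N) :
    X F μ m = R μ m * F μ m + ρ μ m * π μ m * F (μ + s) (m + k) := by
  rw [h.hX]
  rfl

lemma Z_apply (h : Twist s k M R ρ π X Z) (F : Fn N) (μ : ℂ) (m : ZMod N) :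
    Z F μ m = R μ m * F μ m + ρ μ m * F (μ + s) (m + k) := by
  rw [h.hZ]
  rfl

lemma X_mem (h : Twist s k M R ρ π X Z) : X ∈ termSpan N {0, s} := by
  rw [h.hX]
  exact add_mem h.memR h.memX

lemma Z_mem (h : Twist s k M R ρ π X Z) : Z ∈ termSpan N {0, s} := by
  rw [h.hZ]
  exact add_mem h.memR h.memρ

lemma map (h : Twist s k M R ρ π X Z) (F : Fn N) (m : ZMod N) :
    ∀ᵐ x : ℝ, mulOp M (X F) x m = Z (mulOp M F) x m := by
  filter_upwards [h.shift m] with x hx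
  have e : ∀ G : Fn N, ∀ μ m, mulOp M G μ m = M μ m * G μ m := fun _ _ _ => rfl
  rw [e, h.X_apply, h.Z_apply, e, e, hx]
  ring

lemma map_inv (h : Twist s k M R ρ π X Z) (F : Fn N) (m : ZMod N) :
    ∀ᵐ x : ℝ, mulOp (fun μ m => (M μ m)⁻¹) (Z F) x m
      = X (mulOp (fun μ m => (M μ m)⁻¹) F) x m := by
  filter_upwards [h.shift m, h.ne s (m + k), h.ne 0 m] with x hx h1 h2
  rw [add_zero] at h2
  have e : ∀ G : Fn N, ∀ μ m, mulOp (fun μ m => (M μ m)⁻¹) G μ m = (M μ m)⁻¹ * G μ m :=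
    fun _ _ _ => rfl
  rw [e, h.X_apply, h.Z_apply, e, e, hx]
  rw [hx] at h1
  have h3 := left_ne_zero_of_mul h1
  field_simp

end Twist

lemma memLp_of_mem_gaussFn {S : Set ℂ} {X : FnOp N} (hX : X ∈ termSpan N S) {F : Fn N}
    (hF : F ∈ gaussFn N) (m : ZMod N) : MemLp (fun x : ℝ => X F x m) 2 := by
  obtain ⟨f, hf⟩ := exists_rep_of_mem_gaussFn hX hF
  exact (Lp.memLp (f m)).ae_eq (hf m)

lemma abs_im_le_of_mem_strip {h : ℝ} {z : ℂ} (hz : z ∈ strip h) : |z.im| ≤ |h| := by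
  simp only [strip, Set.mem_ofPred_eq, Set.mem_uIcc] at hz
  rcases hz with ⟨h1, h2⟩ | ⟨h1, h2⟩
  · rw [abs_of_nonneg h1, abs_of_nonneg (h1.trans h2)]
    exact h2
  · rw [abs_of_nonpos h2, abs_of_nonpos (h1.trans h2)]
    linarith

lemma stripGauss_of_gaussFn {F : Fn N} (hF : F ∈ gaussFn N) (h : ℝ) : StripGauss h F where
  diff m z _ := differentiable_of_mem_gaussFn hF m z
  bdd m := (gaussBdd_of_mem_gaussFn hF |h| m).comp
    fun z : strip h => ⟨z.1, abs_im_le_of_mem_strip z.2⟩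

lemma StripGauss.mul_div {h : ℝ} {F A : Fn N} (hF : StripGauss h F)
    (hd : ∀ m, ∀ z : ℂ, |z.im| ≤ |h| → DifferentiableAt ℂ (fun z => A z m) z)
    (hg : ∃ C c, 0 ≤ C ∧ 0 ≤ c ∧ ∀ m, ∀ z : ℂ, |z.im| ≤ |h| → ‖A z m‖ ≤ C * Real.exp (c * |z.re|))
    {r : ℂ} {δ : ℝ} (hδ : 0 < δ) (hr : ∀ z ∈ strip h, δ ≤ ‖z - r‖) :
    StripGauss h fun z m => A z m / (z - r) * F z m where
  diff m z hz := by
    have h0 : z - r ≠ 0 := norm_pos_iff.1 (hδ.trans_le (hr z hz))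
    exact ((hd m z (abs_im_le_of_mem_strip hz)).div (by fun_prop) h0).mul (hF.diff m z hz)
  bdd m := by
    obtain ⟨C, c, hC, hc, hg⟩ := hg
    refine (hF.bdd m).mul_growth (C := C / δ) (c := c) fun z => ?_
    rw [norm_div, div_mul_eq_mul_div]
    have := hg m z.1 (abs_im_le_of_mem_strip z.2)
    gcongr
    exact hr z.1 z.2

/-- The point p̄ lies at height -Im s, across the real line from the strip. -/
lemma norm_sub_conj_ge {s p z : ℂ} (hp : p.im = s.im) (hz : z ∈ strip s.im) :
    |s.im| ≤ ‖z - conj p‖ := by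
  refine le_trans ?_ (Complex.abs_im_le_norm _)
  rw [sub_im, conj_im, hp, sub_neg_eq_add]
  simp only [strip, Set.mem_ofPred_eq, Set.mem_uIcc] at hz
  rcases hz with ⟨h1, h2⟩ | ⟨h1, h2⟩
  · rw [abs_of_nonneg (h1.trans h2), abs_of_nonneg (by linarith)]
    linarith
  · rw [abs_of_nonpos (h1.trans h2), abs_of_nonpos (by linarith)]
    linarith

/-- The pole `p` moved away from the strip. -/
noncomputable def movedPole (s p : ℂ) (n : ℕ) : ℂ := p + I * (s.im / (n + 1) : ℝ)

/-- Moving the pole outwards along the normal frees the closed strip of it and increases its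
distance to every point of the strip, so (z - p)/(z - pₙ) is bounded by 1 there, uniformly in n. -/
lemma norm_sub_movedPole {s p z : ℂ} (hp : p.im = s.im) (hz : z ∈ strip s.im) (n : ℕ) :
    |s.im| / (n + 1) ≤ ‖z - movedPole s p n‖ ∧ ‖z - p‖ ≤ ‖z - movedPole s p n‖ := by
  have hn : (0 : ℝ) < n + 1 := by positivity
  have him : (z - movedPole s p n).im = z.im - s.im - s.im / (n + 1) := by
    simp [movedPole, hp, -ofReal_div]
    ring
  have hre : (z - movedPole s p n).re = (z - p).re := by
    simp [movedPole, -ofReal_div]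
  have hsq : (z.im - s.im) * s.im ≤ 0 := by
    simp only [strip, Set.mem_ofPred_eq, Set.mem_uIcc] at hz
    rcases hz with ⟨h1, h2⟩ | ⟨h1, h2⟩ <;> nlinarith
  have key : (z.im - s.im) * (s.im / (n + 1)) ≤ 0 := by
    rw [← mul_div_assoc]
    exact div_nonpos_of_nonpos_of_nonneg hsq hn.le
  constructor
  · refine le_trans ?_ (Complex.abs_im_le_norm _)
    rw [him, ← abs_of_pos hn, ← abs_div, abs_of_pos hn]
    refine sq_le_sq.1 ?_
    nlinarith [sq_nonneg (z.im - s.im)]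
  · rw [← sq_le_sq₀ (norm_nonneg _) (norm_nonneg _), ← normSq_eq_norm_sq, ← normSq_eq_norm_sq,
      normSq_apply, normSq_apply, him, hre, sub_im, hp]
    nlinarith [sq_nonneg (s.im / ((n : ℝ) + 1))]

lemma tendsto_movedPole {s p z : ℂ} (hz : z - p ≠ 0) :
    Tendsto (fun n : ℕ => (z - p) / (z - movedPole s p n)) atTop (𝓝 1) := by
  have h1 : Tendsto (fun n : ℕ => ((s.im / (n + 1) : ℝ) : ℂ)) atTop (𝓝 (0 : ℝ)) := by
    refine (Complex.continuous_ofReal.tendsto 0).comp ?_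
    have := tendsto_one_div_add_atTop_nhds_zero_nat.const_mul s.im
    simpa [div_eq_mul_inv] using this
  have h2 : Tendsto (fun n : ℕ => z - movedPole s p n) atTop (𝓝 (z - p)) := by
    have := (h1.const_mul I).const_add p |>.const_sub z
    simpa [movedPole] using this
  have := (tendsto_const_nhds (x := z - p)).div h2 hz
  rwa [div_self hz] at this

/-! ### Twists by strip multipliers on closed operators -/

section core

variable {s : ℂ} {k : ZMod N} {M₁ M₂ R ρ π : Fn N} {X Z : FnOp N} {p₁ p₂ : ℂ} {A₁ A₂ B₁ B₂ : Fn N}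

/-- The poles of the multipliers can only be at p̄₁, p̄₂, away from the strip. The product with a
Gaussian is therefore analytic in the closed strip with a Gaussian bound, and
`StripGauss.repIn_closedGraph` applies. -/
lemma repIn_mul (hs : s.im ≠ 0) (h : Twist s k (M₁ * M₂) R ρ π X Z) (h₁ : StripMult s M₁ p₁ A₁ B₁)
    (h₂ : StripMult s M₂ p₂ A₂ B₂) {F : Fn N} (hF : F ∈ gaussFn N) :
    RepIn (closedGraph Z) (mulOp (M₁ * M₂) F) (mulOp (M₁ * M₂) (X F)) := by
  have hs' : 0 < |s.im| := abs_pos.2 hs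
  have h1 := ((stripGauss_of_gaussFn hF s.im).mul_div h₁.diffA h₁.growthA (r := conj p₁) hs'
    fun z hz => norm_sub_conj_ge h₁.im_eq hz).mul_div h₂.diffA h₂.growthA (r := conj p₂) hs'
    fun z hz => norm_sub_conj_ge h₂.im_eq hz
  have hae : ∀ w : ℂ, ∀ m, ∀ᵐ x : ℝ, A₂ (x + w) m / (x + w - conj p₂) *
      (A₁ (x + w) m / (x + w - conj p₁) * F (x + w) m) = mulOp (M₁ * M₂) F (x + w) m := by
    intro w m
    filter_upwards [h₁.eqA w m, h₂.eqA w m] with x e1 e2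
    rw [← e1, ← e2]
    change _ = M₁ (x + w) m * M₂ (x + w) m * F (x + w) m
    ring
  refine (h1.repIn_closedGraph h.Z_mem).congr (fun m => by simpa using hae 0 m) fun m => ?_
  filter_upwards [ae_congr_of_mem_termSpan (F := fun z m => A₂ z m / (z - conj p₂) *
      (A₁ z m / (z - conj p₁) * F z m)) (G := mulOp (M₁ * M₂) F) h.Z_mem
    (fun z _ m => hae z m) m, h.map F m] with x e1 e2
  rw [e1, e2]

/-- The inverse multiplier may have poles on the line ℝ + s itself. They are moved off the strip,
which amounts to a factor χₙ with |χₙ| ≤ 1 and χₙ → 1. Although M⁻¹ may be unbounded at the shifted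
points, `X` carries the factor π there, and π M(· + s)⁻¹ = M⁻¹ is unimodular on ℝ. Hence `X (Fs n)`
is dominated by |RF| + |ρ F(· + s)|, and the limit stays in the closed graph. -/
lemma repIn_mul_inv (hs : s.im ≠ 0) (h : Twist s k (M₁ * M₂) R ρ π X Z)
    (h₁ : StripMult s M₁ p₁ A₁ B₁) (h₂ : StripMult s M₂ p₂ A₂ B₂) {F : Fn N}
    (hF : F ∈ gaussFn N) :
    RepIn (closedGraph X) (mulOp (fun μ m => ((M₁ * M₂) μ m)⁻¹) F)
      (mulOp (fun μ m => ((M₁ * M₂) μ m)⁻¹) (Z F)) := by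
  have hs' : 0 < |s.im| := abs_pos.2 hs
  set χ : ℕ → ℂ → ℂ := fun n z =>
    (z - p₂) / (z - movedPole s p₂ n) * ((z - p₁) / (z - movedPole s p₁ n)) with hχ
  set Fs : ℕ → Fn N := fun n z m => B₂ z m / (z - movedPole s p₂ n) *
    (B₁ z m / (z - movedPole s p₁ n) * F z m) with hFs
  have hδ : ∀ n : ℕ, 0 < |s.im| / (n + 1) := fun n => by positivity
  have h1 : ∀ n, RepIn (closedGraph X) (Fs n) (X (Fs n)) := fun n =>
    (((stripGauss_of_gaussFn hF s.im).mul_div h₁.diffB h₁.growthB (hδ n)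
      fun z hz => (norm_sub_movedPole h₁.im_eq hz n).1).mul_div h₂.diffB h₂.growthB (hδ n)
      fun z hz => (norm_sub_movedPole h₂.im_eq hz n).1).repIn_closedGraph h.X_mem
  have hχ1 : ∀ n, ∀ z ∈ strip s.im, ‖χ n z‖ ≤ 1 := by
    intro n z hz
    rw [hχ, norm_mul, norm_div, norm_div]
    have e1 := (norm_sub_movedPole h₁.im_eq hz n).2
    have e2 := (norm_sub_movedPole h₂.im_eq hz n).2
    exact mul_le_one₀ (div_le_one_of_le₀ e2 (norm_nonneg _)) (by positivity)
      (div_le_one_of_le₀ e1 (norm_nonneg _))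
  have hχl : ∀ z, z - p₁ ≠ 0 → z - p₂ ≠ 0 → Tendsto (fun n => χ n z) atTop (𝓝 1) := by
    intro z e1 e2
    simpa using (tendsto_movedPole (s := s) e2).mul (tendsto_movedPole (s := s) e1)
  have hae : ∀ w : ℂ, ∀ m, ∀ᵐ x : ℝ, (∀ n, Fs n (x + w) m =
      χ n (x + w) * (((M₁ * M₂) (x + w) m)⁻¹ * F (x + w) m)) ∧
      Tendsto (fun n => χ n (x + w)) atTop (𝓝 1) := by
    intro w m
    filter_upwards [h₁.eqB w m, h₂.eqB w m, ae_ne w p₁, ae_ne w p₂] with x e1 e2 n1 n2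
    refine ⟨fun n => ?_, hχl _ n1 n2⟩
    have : ((M₁ * M₂) (x + w) m)⁻¹ = (M₁ (x + w) m)⁻¹ * (M₂ (x + w) m)⁻¹ := by
      rw [← mul_inv]
      rfl
    rw [this, e1, e2]
    simp only [hFs, hχ]
    generalize (x + w - movedPole s p₁ n : ℂ) = d1
    generalize (x + w - movedPole s p₂ n : ℂ) = d2
    generalize (x + w - p₁ : ℂ) = u1 at n1 ⊢
    generalize (x + w - p₂ : ℂ) = u2 at n2 ⊢
    have e : u2 / d2 * (u1 / d1) * (B₁ (x + w) m / u1 * (B₂ (x + w) m / u2) * F (x + w) m) =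
        u1 / u1 * (u2 / u2) * (B₂ (x + w) m / d2 * (B₁ (x + w) m / d1 * F (x + w) m)) := by
      simp only [div_eq_mul_inv]
      ac_rfl
    rw [e, div_self n1, div_self n2, one_mul, one_mul]
  have hnorm : ∀ m, ∀ᵐ x : ℝ, ‖((M₁ * M₂) x m)⁻¹‖ = 1 := by
    intro m
    filter_upwards [h₁.norm_eq m, h₂.norm_eq m] with x e1 e2
    rw [norm_inv]
    change ‖M₁ x m * M₂ x m‖⁻¹ = 1
    rw [norm_mul, e1, e2]
    norm_num
  have hstrip : ∀ x : ℝ, (x : ℂ) ∈ strip s.im ∧ (x + s : ℂ) ∈ strip s.im :=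
    fun x => ⟨by simp [strip], by simp [strip]⟩
  -- the values of `X` on the approximants
  have hXae : ∀ m, ∀ᵐ x : ℝ, ∀ n, X (Fs n) x m = ((M₁ * M₂) x m)⁻¹ *
      (χ n x * (R x m * F x m) + χ n (x + s) * (ρ x m * F (x + s) (m + k))) := by
    intro m
    filter_upwards [hae 0 m, hae s (m + k), h.shift m, h.ne s (m + k), h.ne 0 m]
      with x e1 e2 e3 n1 n2 n
    have e1' := e1.1 n
    simp only [add_zero] at e1' n2
    rw [h.X_apply, e1', e2.1 n, e3]
    rw [e3] at n1
    have h3 := left_ne_zero_of_mul n1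
    field_simp
  clear_value χ Fs
  refine RepIn.of_dominated (isClosed_closedGraph X) h1 (fun m => ?_) (fun m => ?_) (fun m => ?_)
    (fun m => ?_)
  · refine ⟨fun x => F x m, ?_, fun n => ?_⟩
    · have := memLp_of_mem_gaussFn (termOp_mem (S := {0}) (Set.mem_singleton _) 0 0 fun _ => 1) hF m
      simpa [termOp_apply] using this
    · filter_upwards [hae 0 m, hnorm m] with x e1 e2
      have e1' := e1.1 n
      simp only [add_zero] at e1'
      rw [e1', norm_mul, norm_mul, e2, one_mul]
      exact mul_le_of_le_one_left (norm_nonneg _) (hχ1 n x (hstrip x).1)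
  · filter_upwards [hae 0 m] with x e1
    have e1' := e1.1
    have e2 := e1.2
    simp only [add_zero] at e1' e2
    simp_rw [e1']
    have := e2.mul_const (((M₁ * M₂) x m)⁻¹ * F x m)
    rw [one_mul] at this
    exact this
  · have g1 := memLp_of_mem_gaussFn h.memR hF m
    have g2 := memLp_of_mem_gaussFn h.memρ hF m
    refine ⟨fun x => ((‖mulOp R F x m‖ + ‖(mulOp ρ * shiftOp s k) F x m‖ : ℝ) : ℂ),
      (g1.norm.add g2.norm).ofReal, fun n => ?_⟩
    filter_upwards [hXae m, hnorm m] with x e1 e2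
    rw [e1 n, norm_mul, e2, one_mul, Complex.norm_real, Real.norm_eq_abs,
      abs_of_nonneg (by positivity)]
    refine (norm_add_le _ _).trans (add_le_add ?_ ?_)
    · rw [norm_mul]
      exact mul_le_of_le_one_left (norm_nonneg _) (hχ1 n x (hstrip x).1)
    · rw [norm_mul]
      exact mul_le_of_le_one_left (norm_nonneg _) (hχ1 n _ (hstrip x).2)
  · filter_upwards [hXae m, hae 0 m, hae s m] with x e1 e2 e3
    have e2' := e2.2
    simp only [add_zero] at e2'
    simp_rw [e1]
    have := ((e2'.mul_const (R x m * F x m)).add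
      (e3.2.mul_const (ρ x m * F (x + s) (m + k)))).const_mul ((M₁ * M₂) x m)⁻¹
    rw [one_mul, one_mul, ← h.Z_apply] at this
    exact this

/-- Unitary equivalence of the closed operators. -/
theorem conjugates_closedGraph_of_stripMult (hs : s.im ≠ 0)
    (h : Twist s k (M₁ * M₂) R ρ π X Z) (h₁ : StripMult s M₁ p₁ A₁ B₁)
    (h₂ : StripMult s M₂ p₂ A₂ B₂) {W : Hilb N ≃ₗᵢ[ℂ] Hilb N} (hW : Realises W (mulOp (M₁ * M₂)))
    (hW' : Realises W⁻¹ (mulOp fun μ m => ((M₁ * M₂) μ m)⁻¹)) :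
    Conjugates W (closedGraph X) (closedGraph Z) :=
  conjugates_closedGraph hW hW' (fun _ hF => repIn_mul hs h h₁ h₂ hF)
    (fun _ hF => repIn_mul_inv hs h h₁ h₂ hF)

end core

end LevelN

namespace LevelN

open Filter Topology

set_option linter.unusedSectionVars false

variable {N : ℕ} [NeZero N]

/-! ### Construction of unitaries -/

/-- Operators on functions that act unitarily: a measure preserving substitution followed by the
multiplication by a function of modulus one. -/
def PointOp (A : FnOp N) : Prop :=
  ∃ (a : ℝ → ZMod N → ℂ) (τ : ℝ → ℝ) (σ : Equiv.Perm (ZMod N)), MeasurePreserving τ ∧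
    (∀ m, AEStronglyMeasurable fun x => a x m) ∧ (∀ m, ∀ᵐ x, ‖a x m‖ = 1) ∧
    ∀ F m, ∀ᵐ x : ℝ, A F x m = a x m * F (τ x) (σ m)

lemma PointOp.mul {A A' : FnOp N} (h : PointOp A) (h' : PointOp A') : PointOp (A * A') := by
  obtain ⟨a, τ, σ, hτ, ha, ha1, hA⟩ := h
  obtain ⟨a', τ', σ', hτ', ha', ha1', hA'⟩ := h'
  refine ⟨fun x m => a x m * a' (τ x) (σ m), τ' ∘ τ, σ.trans σ', hτ'.comp hτ, fun m => ?_,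
    fun m => ?_, fun F m => ?_⟩
  · exact (ha m).mul ((ha' (σ m)).comp_measurePreserving hτ)
  · filter_upwards [ha1 m, hτ.quasiMeasurePreserving.ae (ha1' (σ m))] with x h1 h2
    rw [norm_mul, h1, h2, one_mul]
  · filter_upwards [hA (A' F) m, hτ.quasiMeasurePreserving.ae (hA' F (σ m))] with x h1 h2
    rw [Module.End.mul_apply, h1, h2, mul_assoc]
    rfl

lemma PointOp.ae_congr {A : FnOp N} (h : PointOp A) {F G : Fn N}
    (hFG : ∀ m, ∀ᵐ x : ℝ, F x m = G x m) (m : ZMod N) : ∀ᵐ x : ℝ, A F x m = A G x m := by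
  obtain ⟨a, τ, σ, hτ, -, -, hA⟩ := h
  filter_upwards [hA F m, hA G m, hτ.quasiMeasurePreserving.ae (hFG (σ m))] with x h1 h2 h3
  rw [h1, h2, h3]

lemma PointOp.exists_rep {A : FnOp N} (h : PointOp A) {F : Fn N} {f : Hilb N} (hF : Rep F f) :
    ∃ g, Rep (A F) g ∧ ‖g‖ = ‖f‖ := by
  obtain ⟨a, τ, σ, hτ, ha, ha1, hA⟩ := h
  have h1 : ∀ m, MemLp (fun x : ℝ => F (τ x) (σ m)) 2 := fun m =>
    ((Lp.memLp (f (σ m))).ae_eq (hF (σ m))).comp_measurePreserving hτ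
  have h2 : ∀ m, MemLp (fun x : ℝ => A F x m) 2 := fun m => by
    refine (h1 m).of_le ?_ ?_
    · exact ((ha m).mul (h1 m).1).congr (by filter_upwards [hA F m] with x hx using hx.symm)
    · filter_upwards [hA F m, ha1 m] with x e1 e2
      rw [e1, norm_mul, e2, one_mul]
  refine ⟨WithLp.toLp 2 fun m => (h2 m).toLp _, fun m => (h2 m).coeFn_toLp, ?_⟩
  have h3 : ∀ m, ‖(h2 m).toLp _‖ = ‖f (σ m)‖ := fun m => by
    rw [Lp.norm_toLp, Lp.norm_def, eLpNorm_congr_ae (hF (σ m)),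
      ← eLpNorm_comp_measurePreserving ((Lp.memLp (f (σ m))).ae_eq (hF (σ m))).1 hτ]
    congr 1
    refine eLpNorm_congr_norm_ae ?_
    filter_upwards [hA F m, ha1 m] with x e1 e2
    rw [e1, norm_mul, e2, one_mul]
    rfl
  rw [PiLp.norm_eq_of_L2, PiLp.norm_eq_of_L2]
  congr 1
  rw [← Equiv.sum_comp σ fun m => ‖f m‖ ^ 2]
  exact Finset.sum_congr rfl fun m _ => by rw [← h3 m]

lemma Rep.add {F G : Fn N} {f g : Hilb N} (hF : Rep F f) (hG : Rep G g) : Rep (F + G) (f + g) :=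
  fun m => by
    filter_upwards [Lp.coeFn_add (f m) (g m), hF m, hG m] with x hx e1 e2
    simpa [e1, e2] using hx

lemma Rep.smul {F : Fn N} {f : Hilb N} (c : ℂ) (hF : Rep F f) : Rep (c • F) (c • f) :=
  fun m => by
    filter_upwards [Lp.coeFn_smul c (f m), hF m] with x hx e1
    simpa [e1] using hx

/-- Mutually inverse operators on functions that act unitarily are realised by a unitary. -/
theorem exists_realises {A A' : FnOp N} (hA : PointOp A) (hA' : PointOp A')
    (h : ∀ F m, ∀ᵐ x : ℝ, A' (A F) x m = F x m) (h' : ∀ F m, ∀ᵐ x : ℝ, A (A' F) x m = F x m) :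
    ∃ W : Hilb N ≃ₗᵢ[ℂ] Hilb N, Realises W A := by
  -- The map is defined through one chosen representative; `PointOp.ae_congr` makes it independent
  -- of that choice, from which linearity and inverses follow.
  have key : ∀ {B : FnOp N}, PointOp B → ∃ V : Hilb N → Hilb N,
      (∀ F f, Rep F f → Rep (B F) (V f)) ∧ ∀ f, ‖V f‖ = ‖f‖ := fun {B} hB => by
    choose G hG using fun f : Hilb N => exists_fn_rep f
    choose V hV hn using fun f => hB.exists_rep (hG f)
    refine ⟨V, fun F f hF => (hV f).congr fun m => ?_, hn⟩
    exact hB.ae_congr (fun m => (hG f).ae_eq hF m) m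
  obtain ⟨V, hV, hn⟩ := key hA
  obtain ⟨V', hV', -⟩ := key hA'
  refine ⟨{
    toFun := V
    invFun := V'
    map_add' := fun f g => ?_
    map_smul' := fun c f => ?_
    left_inv := fun f => ?_
    right_inv := fun f => ?_
    norm_map' := hn }, hV⟩
  · obtain ⟨F, hF⟩ := exists_fn_rep f
    obtain ⟨G, hG⟩ := exists_fn_rep g
    have := hV _ _ (hF.add hG)
    rw [map_add] at this
    exact this.unique ((hV _ _ hF).add (hV _ _ hG))
  · obtain ⟨F, hF⟩ := exists_fn_rep f
    have := hV _ _ (hF.smul c)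
    rw [map_smul] at this
    exact this.unique ((hV _ _ hF).smul c)
  · obtain ⟨F, hF⟩ := exists_fn_rep f
    exact (hV' _ _ (hV _ _ hF)).unique (hF.congr fun m => by
      filter_upwards [h F m] with x hx using hx.symm)
  · obtain ⟨F, hF⟩ := exists_fn_rep f
    exact (hV _ _ (hV' _ _ hF)).unique (hF.congr fun m => by
      filter_upwards [h' F m] with x hx using hx.symm)

lemma Realises.mul {W W' : Hilb N ≃ₗᵢ[ℂ] Hilb N} {A A' : FnOp N} (h : Realises W A)
    (h' : Realises W' A') : Realises (W * W') (A * A') :=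
  fun _ _ hF => h _ _ (h' _ _ hF)

/-! ### Elementary operators -/

/-- Mutually inverse unitary operators that preserve all the classes of functions. -/
structure Elem (A A' : FnOp N) : Prop where
  left : A' * A = 1
  right : A * A' = 1
  point : PointOp A
  point' : PointOp A'
  gauss : ∀ r : ℝ, 0 ≤ r → ∀ F ∈ gaussFnGt N r, A F ∈ gaussFnGt N r
  gauss' : ∀ r : ℝ, 0 ≤ r → ∀ F ∈ gaussFnGt N r, A' F ∈ gaussFnGt N r
  mer : ∀ F ∈ merFn N, A F ∈ merFn N
  mer' : ∀ F ∈ merFn N, A' F ∈ merFn N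

namespace Elem

variable {A A' B B' X Z : FnOp N}

lemma symm (h : Elem A A') : Elem A' A :=
  ⟨h.right, h.left, h.point', h.point, h.gauss', h.gauss, h.mer', h.mer⟩

lemma mul (h : Elem A A') (h' : Elem B B') : Elem (A * B) (B' * A') where
  left := by rw [mul_assoc, ← mul_assoc A', h.left, one_mul, h'.left]
  right := by rw [mul_assoc, ← mul_assoc B, h'.right, one_mul, h.right]
  point := h.point.mul h'.point
  point' := h'.point'.mul h.point'
  gauss r hr F hF := h.gauss r hr _ (h'.gauss r hr F hF)
  gauss' r hr F hF := h'.gauss' r hr _ (h.gauss' r hr F hF)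
  mer F hF := h.mer _ (h'.mer F hF)
  mer' F hF := h'.mer' _ (h.mer' F hF)

lemma exists_realises (h : Elem A A') : ∃ W : Hilb N ≃ₗᵢ[ℂ] Hilb N, Realises W A :=
  LevelN.exists_realises h.point h.point'
    (fun F m => ae_of_all _ fun x => by rw [← Module.End.mul_apply, h.left]; rfl)
    (fun F m => ae_of_all _ fun x => by rw [← Module.End.mul_apply, h.right]; rfl)

lemma realises_inv (h : Elem A A') {W : Hilb N ≃ₗᵢ[ℂ] Hilb N} (hW : Realises W A) :
    Realises W⁻¹ A' :=
  hW.inv (fun _ _ hFG => h.point'.ae_congr hFG)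
    (fun F m => ae_of_all _ fun x => by rw [← Module.End.mul_apply, h.left]; rfl)

lemma intertwine_inv (h : Elem A A') (hXZ : A * X = Z * A) : A' * Z = X * A' := by
  calc A' * Z = A' * (Z * A) * A' := by rw [mul_assoc, mul_assoc, h.right, mul_one]
    _ = X * A' := by rw [← hXZ, ← mul_assoc, h.left, one_mul]

lemma conjugates_merGraph (h : Elem A A') {W : Hilb N ≃ₗᵢ[ℂ] Hilb N} (hW : Realises W A)
    (hXZ : A * X = Z * A) : Conjugates W (merGraph X) (merGraph Z) :=
  conjugates_graphOn hW (h.realises_inv hW) h.mer h.mer'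
    (fun F _ m => ae_of_all _ fun x => by rw [← Module.End.mul_apply, hXZ]; rfl)
    (fun F _ m => ae_of_all _ fun x => by
      rw [← Module.End.mul_apply, h.intertwine_inv hXZ]; rfl)

lemma conjugates_closedGraph (h : Elem A A') {W : Hilb N ≃ₗᵢ[ℂ] Hilb N} (hW : Realises W A)
    {S : Set ℂ} (hX : X ∈ termSpan N S) (hZ : Z ∈ termSpan N S) (hXZ : A * X = Z * A) :
    Conjugates W (closedGraph X) (closedGraph Z) :=
  conjugates_closedGraph_of_gauss hX hZ hW (h.realises_inv hW) (h.gauss 0 le_rfl)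
    (h.gauss' 0 le_rfl) hXZ (h.intertwine_inv hXZ)

end Elem

lemma gaussFnGt_induction {r : ℝ} {A : FnOp N}
    (h : ∀ (α β : ℂ) (P : Polynomial ℂ) (k : ZMod N), r < α.re →
      A (fun μ m => if m = k then exp (-α * μ ^ 2 + β * μ) * P.eval μ else 0) ∈ gaussFnGt N r)
    {F : Fn N} (hF : F ∈ gaussFnGt N r) : A F ∈ gaussFnGt N r := by
  have : gaussFnGt N r ≤ (gaussFnGt N r).comap A := by
    refine Submodule.span_le.2 ?_
    rintro _ ⟨α, β, P, k, hα, rfl⟩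
    exact h α β P k hα
  exact this hF

/-- A Gaussian function supported at one point of `ℤ/N`. -/
lemma gaussian_mem {r : ℝ} {α β : ℂ} (hα : r < α.re) (P : Polynomial ℂ) (k : ZMod N) {F : Fn N}
    (hF : ∀ μ m, F μ m = if m = k then exp (-α * μ ^ 2 + β * μ) * P.eval μ else 0) :
    F ∈ gaussFnGt N r :=
  Submodule.subset_span ⟨α, β, P, k, hα, by ext μ m; exact hF μ m⟩

/-- Shifts and linear exponentials change β and P but not the quadratic coefficient α, so the
filtration by Re α is preserved. -/
lemma termOp_gauss (z : ℂ) (k : ZMod N) (γ : ℂ) (a : ZMod N → ℂ) (r : ℝ) {F : Fn N}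
    (hF : F ∈ gaussFnGt N r) : termOp z k γ a F ∈ gaussFnGt N r := by
  refine gaussFnGt_induction (fun α β P j hα => ?_) hF
  refine gaussian_mem (β := γ + β - 2 * α * z) hα
    (Polynomial.C (a (j - k) * exp (-α * z ^ 2 + β * z)) *
      P.comp (Polynomial.X + Polynomial.C z)) (j - k) fun μ m => ?_
  rw [termOp_apply]
  simp only [eq_sub_iff_add_eq]
  split_ifs with h
  · subst h
    simp only [add_sub_cancel_right, Polynomial.eval_mul, Polynomial.eval_C,
      Polynomial.eval_comp, Polynomial.eval_add, Polynomial.eval_X]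
    have e : exp (γ * μ) * exp (-α * (μ + z) ^ 2 + β * (μ + z)) =
        exp (-α * μ ^ 2 + (γ + β - 2 * α * z) * μ) * exp (-α * z ^ 2 + β * z) := by
      rw [← Complex.exp_add, ← Complex.exp_add]
      congr 1
      ring
    linear_combination (a m * P.eval (μ + z)) * e
  · rw [mul_zero]

/-- An imaginary quadratic phase changes only Im α. -/
lemma mulOp_quadratic_gauss {c : ℂ} (hc : c.re = 0) (a : ZMod N → ℂ) (r : ℝ) {F : Fn N}
    (hF : F ∈ gaussFnGt N r) :
    mulOp (fun μ m => a m * exp (c * μ ^ 2)) F ∈ gaussFnGt N r := by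
  refine gaussFnGt_induction (fun α β P j hα => ?_) hF
  refine gaussian_mem (α := α - c) (β := β) (by rwa [sub_re, hc, sub_zero])
    (Polynomial.C (a j) * P) j fun μ m => ?_
  change a m * exp (c * μ ^ 2) * (if m = j then _ else 0) = _
  split_ifs with h
  · subst h
    have e : exp (c * μ ^ 2) * exp (-α * μ ^ 2 + β * μ) = exp (-(α - c) * μ ^ 2 + β * μ) := by
      rw [← Complex.exp_add]
      congr 1
      ring
    simp only [Polynomial.eval_mul, Polynomial.eval_C]
    linear_combination (a m * P.eval μ) * e
  · rw [mul_zero]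

lemma parityOp_gauss (r : ℝ) {F : Fn N} (hF : F ∈ gaussFnGt N r) :
    parityOp N F ∈ gaussFnGt N r := by
  refine gaussFnGt_induction (fun α β P j hα => ?_) hF
  refine gaussian_mem (β := -β) hα (P.comp (-Polynomial.X)) (-j) fun μ m => ?_
  change (if -m = j then _ else 0) = _
  simp only [neg_eq_iff_eq_neg]
  split_ifs with h
  · simp only [Polynomial.eval_comp, Polynomial.eval_neg, Polynomial.eval_X]
    congr 2
    ring
  · rfl

lemma mulOp_mem_merFn {a : Fn N} (ha : ∀ m, Meromorphic fun z => a z m) {F : Fn N}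
    (hF : F ∈ merFn N) : mulOp a F ∈ merFn N := fun m z => (ha m z).mul (hF m z)

lemma shiftOp_mem_merFn (w : ℂ) (k : ZMod N) {F : Fn N} (hF : F ∈ merFn N) :
    shiftOp w k F ∈ merFn N := fun m z =>
  (hF (m + k) (z + w)).comp_analyticAt (f := fun μ => F μ (m + k)) (g := fun μ => μ + w)
    (by fun_prop)

lemma parityOp_mem_merFn {F : Fn N} (hF : F ∈ merFn N) : parityOp N F ∈ merFn N := fun m z =>
  (hF (-m) (-z)).comp_analyticAt (f := fun μ => F μ (-m)) (g := fun μ => -μ) (by fun_prop)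

lemma meromorphic_of_differentiable {f : ℂ → ℂ} (hf : Differentiable ℂ f) : Meromorphic f :=
  fun z => (hf.analyticAt z).meromorphicAt

lemma pointOp_mulOp {a : Fn N} (hm : ∀ m, AEStronglyMeasurable fun x : ℝ => a x m)
    (h : ∀ m, ∀ᵐ x : ℝ, ‖a x m‖ = 1) : PointOp (mulOp a) :=
  ⟨fun x m => a x m, id, Equiv.refl _, MeasurePreserving.id _, hm, h, fun _ _ => ae_of_all _ fun _ => rfl⟩

lemma mulOp_mul (a b : Fn N) : mulOp a * mulOp b = mulOp (a * b) := by
  ext F μ m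
  exact (mul_assoc (a μ m) (b μ m) (F μ m)).symm

lemma mulOp_one : mulOp (1 : Fn N) = 1 := by
  ext F μ m
  exact one_mul _

/-- Multiplication by a nonvanishing entire function of modulus one on `ℝ`. -/
lemma elem_mulOp {a : Fn N} (hd : ∀ m, Differentiable ℂ fun z => a z m) (h0 : ∀ z m, a z m ≠ 0)
    (h1 : ∀ m, ∀ x : ℝ, ‖a x m‖ = 1)
    (hg : ∀ r : ℝ, 0 ≤ r → ∀ F ∈ gaussFnGt N r, mulOp a F ∈ gaussFnGt N r)
    (hg' : ∀ r : ℝ, 0 ≤ r → ∀ F ∈ gaussFnGt N r, mulOp (fun z m => (a z m)⁻¹) F ∈ gaussFnGt N r) :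
    Elem (mulOp a) (mulOp fun z m => (a z m)⁻¹) := by
  have hc : ∀ m, Continuous fun x : ℝ => a x m := fun m =>
    (hd m).continuous.comp Complex.continuous_ofReal
  refine ⟨?_, ?_, ?_, ?_, hg, hg', fun F hF => ?_, fun F hF => ?_⟩
  · rw [mulOp_mul, ← mulOp_one]
    congr 1
    ext z m
    exact inv_mul_cancel₀ (h0 z m)
  · rw [mulOp_mul, ← mulOp_one]
    congr 1
    ext z m
    exact mul_inv_cancel₀ (h0 z m)
  · exact pointOp_mulOp (fun m => (hc m).aestronglyMeasurable) fun m => ae_of_all _ (h1 m)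
  · refine pointOp_mulOp (fun m => ((hc m).inv₀ fun x => h0 _ _).aestronglyMeasurable) fun m =>
      ae_of_all _ fun x => ?_
    rw [norm_inv, h1, inv_one]
  · exact mulOp_mem_merFn (fun m => meromorphic_of_differentiable (hd m)) hF
  · exact mulOp_mem_merFn (fun m => (meromorphic_of_differentiable (hd m)).inv) hF

lemma elem_phaseOp (x : ℝ) (k : ZMod N) :
    Elem (phaseOp N x k) (mulOp fun z m => (phaseFn N x k z m)⁻¹) := by
  refine elem_mulOp (a := phaseFn N x k) (fun m => by unfold phaseFn; fun_prop)
    (phaseFn_ne_zero x k) (fun m t => ?_) (fun r _ F hF => ?_) (fun r _ F hF => ?_)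
  · have : (2 * Real.pi * I / N * (x * t - (k.val : ℂ) * (m.val : ℂ)) : ℂ)
        = ((2 * Real.pi / N * (x * t - k.val * m.val) : ℝ) : ℂ) * I := by push_cast; ring
    rw [phaseFn, this, Complex.norm_exp_ofReal_mul_I]
  · have : mulOp (phaseFn N x k) = termOp 0 0 (2 * Real.pi * I / N * x) fun m =>
        exp (-(2 * Real.pi * I / N * ((k.val : ℂ) * (m.val : ℂ)))) := by
      ext F μ m
      rw [termOp_apply, add_zero, add_zero, ← Complex.exp_add]
      change phaseFn N x k μ m * F μ m = _
      rw [phaseFn]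
      congr 2
      ring
    rw [this]
    exact termOp_gauss _ _ _ _ _ hF
  · have : (mulOp fun z m => (phaseFn N x k z m)⁻¹) = termOp 0 0 (-(2 * Real.pi * I / N * x))
        fun m => exp ((2 * Real.pi * I / N * ((k.val : ℂ) * (m.val : ℂ)))) := by
      ext F μ m
      rw [termOp_apply, add_zero, add_zero, ← Complex.exp_add]
      change (phaseFn N x k μ m)⁻¹ * F μ m = _
      rw [phaseFn, ← Complex.exp_neg]
      congr 2
      ring
    rw [this]
    exact termOp_gauss _ _ _ _ _ hF

lemma elem_weilOp : Elem (weilOp N) (mulOp fun z m => (weilFn N z m)⁻¹) := by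
  refine elem_mulOp (a := weilFn N) (fun m => by unfold weilFn; fun_prop)
    weilFn_ne_zero (fun m t => ?_) (fun r _ F hF => ?_) (fun r _ F hF => ?_)
  · have : (Real.pi * I / N * (t ^ 2 - (m.val : ℂ) ^ 2) : ℂ)
        = ((Real.pi / N * (t ^ 2 - m.val ^ 2) : ℝ) : ℂ) * I := by push_cast; ring
    rw [weilFn, this, norm_mul, Complex.norm_exp_ofReal_mul_I, norm_pow, norm_neg, norm_one,
      one_pow, mul_one]
  · have : weilFn N = fun μ m => ((-1) ^ (m.val ^ 2) *
        exp (-(Real.pi * I / N * (m.val : ℂ) ^ 2))) * exp (Real.pi * I / N * μ ^ 2) := by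
      ext μ m
      rw [mul_assoc, ← Complex.exp_add, weilFn]
      congr 2
      ring
    rw [this]
    refine mulOp_quadratic_gauss ?_ _ r hF
    have : (Real.pi * I / N : ℂ) = ((Real.pi / N : ℝ) : ℂ) * I := by push_cast; ring
    rw [this, Complex.re_ofReal_mul, I_re, mul_zero]
  · have : (fun z m => (weilFn N z m)⁻¹ : Fn N) = fun μ m => (((-1) ^ (m.val ^ 2))⁻¹ *
        exp (Real.pi * I / N * (m.val : ℂ) ^ 2)) * exp (-(Real.pi * I / N) * μ ^ 2) := by
      ext μ m
      rw [mul_assoc, ← Complex.exp_add, weilFn, mul_inv, ← Complex.exp_neg]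
      congr 2
      ring
    rw [this]
    refine mulOp_quadratic_gauss ?_ _ r hF
    have : (-(Real.pi * I / N) : ℂ) = ((-(Real.pi / N) : ℝ) : ℂ) * I := by push_cast; ring
    rw [this, Complex.re_ofReal_mul, I_re, mul_zero]

lemma elem_shiftOp (x : ℝ) (k : ZMod N) : Elem (shiftOp (x : ℂ) k) (shiftOp ((-x : ℝ) : ℂ) (-k)) := by
  have hp : ∀ (x : ℝ) (k : ZMod N), PointOp (shiftOp (x : ℂ) k) := fun x k =>
    ⟨fun _ _ => 1, fun t => t + x, Equiv.addRight k, measurePreserving_add_right _ x,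
      fun _ => aestronglyMeasurable_const, fun _ => ae_of_all _ fun _ => norm_one,
      fun F m => ae_of_all _ fun t => by
        rw [one_mul, ofReal_add]
        rfl⟩
  have hg : ∀ (z : ℂ) (k : ZMod N) (r : ℝ), 0 ≤ r → ∀ F ∈ gaussFnGt N r,
      shiftOp z k F ∈ gaussFnGt N r := fun z k r _ F hF => by
    have : shiftOp z k = termOp z k 0 fun _ => 1 := by
      ext F μ m
      rw [termOp_apply, zero_mul, Complex.exp_zero, one_mul, one_mul]
      rfl
    rw [this]
    exact termOp_gauss _ _ _ _ _ hF
  have hi : ∀ (z w : ℂ) (k l : ZMod N), z + w = 0 → k + l = 0 →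
      shiftOp (N := N) z k * shiftOp w l = 1 := fun z w k l h1 h2 => by
    ext F μ m
    change F (μ + z + w) (m + k + l) = F μ m
    rw [add_assoc, h1, add_zero, add_assoc, h2, add_zero]
  exact ⟨hi _ _ _ _ (by push_cast; ring) (by ring), hi _ _ _ _ (by push_cast; ring) (by ring),
    hp _ _, hp _ _, hg _ _, hg _ _, fun F hF => shiftOp_mem_merFn _ _ hF,
    fun F hF => shiftOp_mem_merFn _ _ hF⟩

lemma elem_parityOp : Elem (parityOp N) (parityOp N) := by
  have hi : parityOp N * parityOp N = 1 := by
    ext F μ m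
    change F (- -μ) (- -m) = F μ m
    rw [neg_neg, neg_neg]
  have hp : PointOp (parityOp N) :=
    ⟨fun _ _ => 1, fun t => -t, Equiv.neg _, Measure.measurePreserving_neg _,
      fun _ => aestronglyMeasurable_const, fun _ => ae_of_all _ fun _ => norm_one,
      fun F m => ae_of_all _ fun t => by
        rw [one_mul, ofReal_neg]
        rfl⟩
  exact ⟨hi, hi, hp, hp, fun r _ F hF => parityOp_gauss r hF, fun r _ F hF => parityOp_gauss r hF,
    fun F hF => parityOp_mem_merFn hF, fun F hF => parityOp_mem_merFn hF⟩

end LevelN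

namespace LevelN

open Filter Topology

set_option linter.unusedSectionVars false

variable {N : ℕ} [NeZero N]

/-! ### The twists by the quantum dilogarithm -/

/-- The functional equation of the quantum dilogarithm. -/
structure IsDilog (β : ℂ) (ε : ℤ) (c : ℂ) (φ : Fn N) : Prop where
  shift : ∀ w m, ∀ᵐ x : ℝ, φ (x + w + I * β) (m + -(ε : ZMod N)) =
    (1 + gq N β * (c * gy N β ε (x + w) m)) * φ (x + w) m
  ne : ∀ w : ℂ, ∀ m, ∀ᵐ x : ℝ, φ (x + w) m ≠ 0

section dilog

variable {b : ℂ} (hb : ‖b‖ = 1) (hre : 0 < b.re) (him : 0 < b.im)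
include hb hre him

lemma isDilog_one (c : ℂ) : IsDilog (N := N) b 1 c (dilogFn N b c) where
  shift w m := by
    have h := ae_exp_ne (γ := (2 * Real.pi / N : ℝ) * b)
      (by rw [Complex.re_ofReal_mul]; exact (mul_pos two_pi_div_pos hre).ne')
      (q N b * (c * (exp (-(2 * Real.pi * I / N * (m.val : ℂ))) *
        exp ((2 * Real.pi / N : ℝ) * b * w))))
    filter_upwards [h] with x hx
    rw [gy_one, Int.cast_one]
    refine dilogFn_shift hre him c _ m ?_
    rw [y_eq, mul_add, Complex.exp_add]
    convert hx using 2
    ring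
  ne := ae_dilogFn_ne hb hre him c

lemma isDilog_neg_one (c : ℂ) : IsDilog (N := N) b⁻¹ (-1) (conj c) (dilogFn N b c) where
  shift w m := ae_of_all _ fun x => by
    rw [gy_neg_one, Int.cast_neg, Int.cast_one, neg_neg]
    exact dilogFn_shift' hb hre him c _ m
  ne := ae_dilogFn_ne hb hre him c

end dilog

section twists

variable {β : ℂ} {ε : ℤ} {φ φ' : Fn N} {a c c' : ℂ}

/-- The S-cycle trace, conjugated by `T`. -/
noncomputable def preS (N : ℕ) (β : ℂ) (ε : ℤ) (a d : ℂ) : FnOp N :=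
  a⁻¹ • gweyl N β ε 0 1 + a • gweyl N β ε 0 (-1) +
    (a • gweyl N β ε 1 0 + (a + d) • gweyl N β ε 1 1 + d • gweyl N β ε 1 2)

/-- The normal form left after the dilogarithms have absorbed the quadratic polynomial in y; it
differs from `dehnExpr` only by rescalings with `a`. -/
noncomputable def midS (N : ℕ) (β : ℂ) (ε : ℤ) (a : ℂ) : FnOp N :=
  a⁻¹ • gweyl N β ε 0 1 + a • gweyl N β ε 0 (-1) + a • gweyl N β ε 1 0

/-- The T-cycle trace in terms of the parameters of the dilogarithms. -/
noncomputable def preT (N : ℕ) (β : ℂ) (ε : ℤ) (a c c' : ℂ) : FnOp N :=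
  a⁻¹ • gweyl N β ε 0 1 + a • gweyl N β ε 0 (-1) + ((-a) • gweyl N β ε (-1) (-1) +
    (-(a * (c + c'))) • gweyl N β ε (-1) 0 + (-(a * c * c')) • gweyl N β ε (-1) 1)

/-- Here the surviving shift term is e^(-U-Y), which parity followed by T⁻¹ turns into a multiple of
e^U. -/
noncomputable def midT (N : ℕ) (β : ℂ) (ε : ℤ) (a : ℂ) : FnOp N :=
  a⁻¹ • gweyl N β ε 0 1 + a • gweyl N β ε 0 (-1) + (-a) • gweyl N β ε (-1) (-1)

lemma gweyl_zero_apply (hε : ε * ε = 1) (γ : ℤ) (F : Fn N) (μ : ℂ) (m : ZMod N) :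
    gweyl N β ε 0 γ F μ m = gy N β ε μ m ^ γ * F μ m := by
  rw [gweyl_apply hε]
  simp

lemma mulOp_potential (hε : ε * ε = 1) (a : ℂ) :
    mulOp (fun μ m => a⁻¹ * gy N β ε μ m + a * (gy N β ε μ m)⁻¹) =
      a⁻¹ • gweyl N β ε 0 1 + a • gweyl N β ε 0 (-1) := by
  ext F μ m
  change _ = a⁻¹ * gweyl N β ε 0 1 F μ m + a * gweyl N β ε 0 (-1) F μ m
  rw [gweyl_zero_apply hε, gweyl_zero_apply hε, zpow_one, zpow_neg_one]
  change (a⁻¹ * gy N β ε μ m + a * (gy N β ε μ m)⁻¹) * F μ m = _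
  ring

lemma potential_mem (hε : ε * ε = 1) (a : ℂ) {S : Set ℂ} (hS : (0 : ℂ) ∈ S) :
    a⁻¹ • gweyl N β ε 0 1 + a • gweyl N β ε 0 (-1) ∈ termSpan N S :=
  add_mem (Submodule.smul_mem _ _ (gweyl_mem_termSpan hε _ _ (by simpa using hS)))
    (Submodule.smul_mem _ _ (gweyl_mem_termSpan hε _ _ (by simpa using hS)))

/-- The coefficients a, a + ac, ac of the shift terms are those of a(1 + cX)(1 + X). With X = q y,
normal ordering turns this factorisation into the two functional equations. -/
lemma twist_S (hε : ε * ε = 1) (h : IsDilog β ε c φ) (h' : IsDilog β ε 1 φ') (a : ℂ) :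
    Twist (I * β) (-(ε : ZMod N)) (φ * φ')
      (fun μ m => a⁻¹ * gy N β ε μ m + a * (gy N β ε μ m)⁻¹) (fun _ _ => a)
      (fun μ m => (1 + gq N β * (c * gy N β ε μ m)) * (1 + gq N β * (1 * gy N β ε μ m)))
      (preS N β ε a (a * c)) (midS N β ε a) := by
  have hE : ∀ γ : ℤ, gweyl N β ε 1 γ ∈ termSpan N {0, I * β} := fun γ =>
    gweyl_mem_termSpan hε _ _ (by simp)
  have e1 : mulOp (fun _ _ => a) * shiftOp (I * β) (-(ε : ZMod N)) = a • gweyl N β ε 1 0 := by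
    ext F μ m
    change a * F (μ + I * β) (m + -(ε : ZMod N)) = a * gweyl N β ε 1 0 F μ m
    rw [gweyl_apply hε]
    simp
  have e2 : mulOp ((fun _ _ => a) * fun μ m => (1 + gq N β * (c * gy N β ε μ m)) *
      (1 + gq N β * (1 * gy N β ε μ m))) * shiftOp (I * β) (-(ε : ZMod N)) =
      a • gweyl N β ε 1 0 + (a + a * c) • gweyl N β ε 1 1 + (a * c) • gweyl N β ε 1 2 := by
    ext F μ m
    change a * ((1 + gq N β * (c * gy N β ε μ m)) * (1 + gq N β * (1 * gy N β ε μ m))) *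
      F (μ + I * β) (m + -(ε : ZMod N)) = a * gweyl N β ε 1 0 F μ m +
      (a + a * c) * gweyl N β ε 1 1 F μ m + (a * c) * gweyl N β ε 1 2 F μ m
    rw [gweyl_apply hε, gweyl_apply hε, gweyl_apply hε]
    simp only [Int.cast_one, one_mul, mul_one, mul_zero, zpow_ofNat]
    ring
  refine ⟨?_, ?_, ?_, ?_, ?_, fun m => ?_, fun w m => ?_⟩
  · rw [e2, mulOp_potential hε]
    rfl
  · rw [e1, mulOp_potential hε]
    rfl
  · rw [mulOp_potential hε]
    exact potential_mem hε a (by simp)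
  · rw [e1]
    exact Submodule.smul_mem _ _ (hE 0)
  · rw [e2]
    exact add_mem (add_mem (Submodule.smul_mem _ _ (hE 0)) (Submodule.smul_mem _ _ (hE 1)))
      (Submodule.smul_mem _ _ (hE 2))
  · filter_upwards [h.shift 0 m, h'.shift 0 m] with x h1 h2
    rw [add_zero] at h1 h2
    change φ _ _ * φ' _ _ = _ * (φ _ _ * φ' _ _)
    rw [h1, h2]
    ring
  · filter_upwards [h.ne w m, h'.ne w m] with x h1 h2 using mul_ne_zero h1 h2

/-- The functional equation read from the shifted point back; there y is q⁻² times its old value, so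
q y becomes q⁻¹ y. -/
lemma IsDilog.shift_inv (hε : ε * ε = 1) (h : IsDilog β ε c φ) (m : ZMod N) :
    ∀ᵐ x : ℝ, (φ (x + -(I * β)) (m + (ε : ZMod N)))⁻¹ =
      (1 + (gq N β)⁻¹ * (c * gy N β ε x m)) * (φ x m)⁻¹ := by
  filter_upwards [h.shift (-(I * β)) (m + (ε : ZMod N)), h.ne 0 m] with x h1 h2
  rw [neg_add_cancel_right, add_neg_cancel_right] at h1
  rw [add_zero] at h2
  have h3 := gy_shift (N := N) (β := β) hε (-1) x m
  have e1 : (x : ℂ) + ((-1 : ℤ) : ℂ) * (I * β) = x + -(I * β) := by push_cast; ring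
  have e2 : m + -((ε : ZMod N) * ((-1 : ℤ) : ZMod N)) = m + (ε : ZMod N) := by push_cast; ring
  rw [e1, e2] at h3
  have h4 : (1 + gq N β * (c * gy N β ε (x + -(I * β)) (m + (ε : ZMod N)))) =
      1 + (gq N β)⁻¹ * (c * gy N β ε x m) := by
    rw [h3]
    have : gq N β ^ (2 * -1 : ℤ) = (gq N β)⁻¹ * (gq N β)⁻¹ := by
      rw [mul_neg, mul_one, zpow_neg, zpow_ofNat, sq, mul_inv]
    rw [this]
    have := gq_ne_zero (N := N) (β := β)
    field_simp
  rw [h4] at h1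
  rw [h1] at h2 ⊢
  rw [mul_inv, mul_inv_cancel_left₀ (left_ne_zero_of_mul h2)]

/-- The shift terms factor as -a q y⁻¹(1 + q⁻¹ c y)(1 + q⁻¹ c' y). The shift is downwards, so it is
the inverse dilogarithms that produce these factors. -/
lemma twist_T (hε : ε * ε = 1) (h : IsDilog β ε c φ) (h' : IsDilog β ε c' φ') (a : ℂ) :
    Twist (-(I * β)) (ε : ZMod N) ((fun μ m => (φ μ m)⁻¹) * fun μ m => (φ' μ m)⁻¹)
      (fun μ m => a⁻¹ * gy N β ε μ m + a * (gy N β ε μ m)⁻¹)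
      (fun μ m => -a * (gq N β * (gy N β ε μ m)⁻¹))
      (fun μ m => (1 + (gq N β)⁻¹ * (c * gy N β ε μ m)) * (1 + (gq N β)⁻¹ * (c' * gy N β ε μ m)))
      (preT N β ε a c c') (midT N β ε a) := by
  have hE : ∀ γ : ℤ, gweyl N β ε (-1) γ ∈ termSpan N {0, -(I * β)} := fun γ =>
    gweyl_mem_termSpan hε _ _ (by simp)
  have hE' : ∀ (γ : ℤ) (F : Fn N) (μ : ℂ) (m : ZMod N), gweyl N β ε (-1) γ F μ m =
      gq N β ^ (-γ) * gy N β ε μ m ^ γ * F (μ + -(I * β)) (m + (ε : ZMod N)) := fun γ F μ m => by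
    rw [gweyl_apply hε]
    simp
  have e1 : mulOp (fun μ m => -a * (gq N β * (gy N β ε μ m)⁻¹)) * shiftOp (-(I * β)) (ε : ZMod N) =
      (-a) • gweyl N β ε (-1) (-1) := by
    ext F μ m
    change -a * (gq N β * (gy N β ε μ m)⁻¹) * F (μ + -(I * β)) (m + (ε : ZMod N)) =
      -a * gweyl N β ε (-1) (-1) F μ m
    rw [hE']
    simp only [neg_neg, zpow_one, zpow_neg_one]
    ring
  have e2 : mulOp ((fun μ m => -a * (gq N β * (gy N β ε μ m)⁻¹)) *
      fun μ m => (1 + (gq N β)⁻¹ * (c * gy N β ε μ m)) * (1 + (gq N β)⁻¹ * (c' * gy N β ε μ m))) *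
      shiftOp (-(I * β)) (ε : ZMod N) =
      (-a) • gweyl N β ε (-1) (-1) + (-(a * (c + c'))) • gweyl N β ε (-1) 0 +
        (-(a * c * c')) • gweyl N β ε (-1) 1 := by
    ext F μ m
    change -a * (gq N β * (gy N β ε μ m)⁻¹) * ((1 + (gq N β)⁻¹ * (c * gy N β ε μ m)) *
      (1 + (gq N β)⁻¹ * (c' * gy N β ε μ m))) * F (μ + -(I * β)) (m + (ε : ZMod N)) =
      -a * gweyl N β ε (-1) (-1) F μ m + (-(a * (c + c'))) * gweyl N β ε (-1) 0 F μ m +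
      (-(a * c * c')) * gweyl N β ε (-1) 1 F μ m
    rw [hE', hE', hE']
    simp only [neg_neg, zpow_one, zpow_neg_one, neg_zero, zpow_zero]
    have := gq_ne_zero (N := N) (β := β)
    have := gy_ne_zero (N := N) (β := β) (ε := ε) μ m
    field_simp
    ring
  refine ⟨?_, ?_, ?_, ?_, ?_, fun m => ?_, fun w m => ?_⟩
  · rw [e2, mulOp_potential hε]
    rfl
  · rw [e1, mulOp_potential hε]
    rfl
  · rw [mulOp_potential hε]
    exact potential_mem hε a (by simp)
  · rw [e1]
    exact Submodule.smul_mem _ _ (hE _)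
  · rw [e2]
    exact add_mem (add_mem (Submodule.smul_mem _ _ (hE _)) (Submodule.smul_mem _ _ (hE _)))
      (Submodule.smul_mem _ _ (hE _))
  · filter_upwards [h.shift_inv hε m, h'.shift_inv hε m] with x h1 h2
    change (φ _ _)⁻¹ * (φ' _ _)⁻¹ = _ * ((φ _ _)⁻¹ * (φ' _ _)⁻¹)
    rw [h1, h2]
    ring
  · filter_upwards [h.ne w m, h'.ne w m] with x h1 h2
    exact mul_ne_zero (inv_ne_zero h1) (inv_ne_zero h2)

/-! ### Chains of elementary operators -/

lemma SemiconjBy.smul_right' {R : Type*} [Ring R] [Algebra ℂ R] {A X Z : R}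
    (h : SemiconjBy A X Z) (c : ℂ) : SemiconjBy A (c • X) (c • Z) := by
  change A * (c • X) = c • Z * A
  rw [mul_smul_comm, smul_mul_assoc, h.eq]

lemma semiconj_congr {A X X' Z Z' : FnOp N} (h : SemiconjBy A X Z) (hX : X' = X) (hZ : Z' = Z) :
    SemiconjBy A X' Z' := by
  rwa [hX, hZ]

lemma semiconj_weil (hε : ε * ε = 1) (α γ : ℤ) :
    SemiconjBy (weilOp N) (gweyl N β ε α γ) (((-1) ^ α : ℂ) • gweyl N β ε α (γ + α)) := by
  change _ = _
  rw [weilOp_mul_gweyl hε, smul_mul_assoc]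

lemma semiconj_shift (hε : ε * ε = 1) (x : ℝ) (k : ZMod N) (α γ : ℤ) :
    SemiconjBy (shiftOp (x : ℂ) k) (gweyl N β ε α γ) ((gy N β ε x k ^ γ) • gweyl N β ε α γ) := by
  change _ = _
  rw [shiftOp_mul_gweyl hε, smul_mul_assoc]

lemma semiconj_phase (hε : ε * ε = 1) (x : ℝ) (k : ZMod N) (α γ : ℤ) :
    SemiconjBy (phaseOp N x k) (gweyl N β ε α γ) ((gy N β ε x k ^ α) • gweyl N β ε α γ) := by
  change _ = _
  rw [phaseOp_mul_gweyl hε, smul_mul_assoc]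

lemma Elem.semiconj_inv {A A' X Z : FnOp N} (h : Elem A A') {c : ℂ} (hc : c ≠ 0)
    (hXZ : SemiconjBy A X (c • Z)) : SemiconjBy A' Z (c⁻¹ • X) := by
  have h1 : SemiconjBy A' (c • Z) X := h.intertwine_inv hXZ
  have h2 := SemiconjBy.smul_right' h1 c⁻¹
  rwa [smul_smul, inv_mul_cancel₀ hc, one_smul] at h2

/-- T multiplies e^(αU+γY) by (-1)^α and raises γ by α. It thus removes the minus signs and turns
the degrees -1, 0, 1 in Y of the shift terms into 0, 1, 2. -/
lemma semiconj_T_S (hε : ε * ε = 1) (a d : ℂ) :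
    SemiconjBy (weilOp N) (a⁻¹ • gweyl N β ε 0 1 + a • gweyl N β ε 0 (-1) - d • gweyl N β ε 1 1 -
      a • gweyl N β ε 1 (-1) - d • gweyl N β ε 1 0 - a • gweyl N β ε 1 0) (preS N β ε a d) := by
  have h := fun (c : ℂ) (α γ : ℤ) =>
    SemiconjBy.smul_right' (semiconj_weil (N := N) (β := β) hε α γ) c
  refine semiconj_congr ((((((h a⁻¹ 0 1).add_right (h a 0 (-1))).sub_right (h d 1 1)).sub_right
    (h a 1 (-1))).sub_right (h d 1 0)).sub_right (h a 1 0)) rfl ?_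
  simp only [preS, zpow_zero, one_smul, zpow_one, add_zero, zero_add, smul_smul, mul_neg, mul_one,
    neg_smul, sub_neg_eq_add, one_add_one_eq_two, neg_add_cancel, add_smul]
  abel

/-- The real shift rescales y by `a` and normalises the potential; the inverse phase rescales u by
a⁻¹ and normalises the kinetic term. -/
lemma semiconj_L_S (hε : ε * ε = 1) (x : ℝ) (k : ZMod N) :
    SemiconjBy ((mulOp fun z m => (phaseFn N x k z m)⁻¹) * shiftOp (x : ℂ) k)
      (midS N β ε (gy N β ε x k)) (dehnExpr (gweyl N β ε)) := by
  have h0 := gy_ne_zero (N := N) (β := β) (ε := ε) x k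
  set a := gy N β ε x k with ha
  have h1 := fun (c : ℂ) (α γ : ℤ) =>
    SemiconjBy.smul_right' (semiconj_shift (N := N) (β := β) hε x k α γ) c
  have h2 := fun (c : ℂ) (α γ : ℤ) => SemiconjBy.smul_right' ((elem_phaseOp x k).semiconj_inv
    (zpow_ne_zero α h0) (semiconj_phase (N := N) (β := β) hε x k α γ)) c
  refine SemiconjBy.mul_left (y := (1 : ℂ) • gweyl N β ε 0 (-1) + (1 : ℂ) • gweyl N β ε 0 1
    + a • gweyl N β ε 1 0) ?_ ?_
  · refine semiconj_congr (((h2 1 0 (-1)).add_right (h2 1 0 1)).add_right (h2 a 1 0)) rfl ?_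
    simp only [dehnExpr, zpow_zero, inv_one, one_smul, zpow_one, smul_smul, mul_inv_cancel₀ h0]
  · refine semiconj_congr (((h1 a⁻¹ 0 1).add_right (h1 a 0 (-1))).add_right (h1 a 1 0)) rfl ?_
    simp only [zpow_zero, one_smul, zpow_one, smul_smul, ← ha, inv_mul_cancel₀ h0, zpow_neg_one,
      mul_inv_cancel₀ h0]
    abel

/-- Parity reverses all exponents, T⁻¹ takes -e^(U+Y) to e^U, and the inverse shift and inverse
phase remove the factors `a` as in the S-cycle, the potential being reflected now. -/
lemma semiconj_L_T (hε : ε * ε = 1) (x : ℝ) (k : ZMod N) :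
    SemiconjBy ((mulOp fun z m => (phaseFn N x k z m)⁻¹) * shiftOp ((-x : ℝ) : ℂ) (-k) *
      (mulOp fun z m => (weilFn N z m)⁻¹) * parityOp N)
      (midT N β ε (gy N β ε x k)) (dehnExpr (gweyl N β ε)) := by
  have h0 := gy_ne_zero (N := N) (β := β) (ε := ε) x k
  set a := gy N β ε x k with ha
  have h1 := fun (c : ℂ) (α γ : ℤ) => SemiconjBy.smul_right' ((elem_shiftOp x k).semiconj_inv
    (zpow_ne_zero γ h0) (semiconj_shift (N := N) (β := β) hε x k α γ)) c
  have h2 := fun (c : ℂ) (α γ : ℤ) => SemiconjBy.smul_right' ((elem_phaseOp x k).semiconj_inv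
    (zpow_ne_zero α h0) (semiconj_phase (N := N) (β := β) hε x k α γ)) c
  have h3 := fun (c : ℂ) (α γ : ℤ) => SemiconjBy.smul_right' (elem_weilOp.semiconj_inv
    (zpow_ne_zero α (neg_ne_zero.2 one_ne_zero)) (semiconj_weil (N := N) (β := β) hε α γ)) c
  have h4 := fun (c : ℂ) (α γ : ℤ) => SemiconjBy.smul_right'
    (show SemiconjBy _ _ _ from parityOp_mul_gweyl (N := N) (β := β) hε α γ) c
  refine SemiconjBy.mul_left (y := a⁻¹ • gweyl N β ε 0 (-1) + a • gweyl N β ε 0 1 +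
    (-a) • gweyl N β ε 1 1) (SemiconjBy.mul_left (y := a⁻¹ • gweyl N β ε 0 (-1) +
    a • gweyl N β ε 0 1 + a • gweyl N β ε 1 0) (SemiconjBy.mul_left (y := (1 : ℂ) •
    gweyl N β ε 0 (-1) + (1 : ℂ) • gweyl N β ε 0 1 + a • gweyl N β ε 1 0) ?_ ?_) ?_) ?_
  · refine semiconj_congr (((h2 1 0 (-1)).add_right (h2 1 0 1)).add_right (h2 a 1 0)) rfl ?_
    simp only [dehnExpr, zpow_zero, inv_one, one_smul, zpow_one, smul_smul, mul_inv_cancel₀ h0]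
  · refine semiconj_congr (((h1 a⁻¹ 0 (-1)).add_right (h1 a 0 1)).add_right (h1 a 1 0)) rfl ?_
    simp only [zpow_zero, inv_one, one_smul, zpow_one, smul_smul, inv_mul_cancel₀ h0,
      zpow_neg_one, mul_inv_cancel₀ h0, inv_inv]
  · refine semiconj_congr (((h3 a⁻¹ 0 (-1)).add_right (h3 a 0 1)).add_right (h3 (-a) 1 0)) ?_ ?_
    · simp only [add_zero, zero_add]
    · simp only [zpow_zero, inv_one, one_smul, zpow_one, smul_smul, inv_neg, neg_mul_neg, mul_one]
  · refine semiconj_congr (((h4 a⁻¹ 0 1).add_right (h4 a 0 (-1))).add_right (h4 (-a) (-1) (-1))) rfl ?_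
    simp only [neg_zero, neg_neg]

lemma gweyl_mem_univ (hε : ε * ε = 1) (α γ : ℤ) : gweyl N β ε α γ ∈ termSpan N Set.univ :=
  gweyl_mem_termSpan hε α γ (Set.mem_univ _)

lemma dehnExpr_mem (hε : ε * ε = 1) : dehnExpr (gweyl N β ε) ∈ termSpan N Set.univ :=
  add_mem (add_mem (gweyl_mem_univ hε _ _) (gweyl_mem_univ hε _ _)) (gweyl_mem_univ hε _ _)

lemma traceSExpr_mem (hε : ε * ε = 1) (l₁ l₂ l₃ l₄ : ℂ) :
    traceSExpr (gweyl N β ε) l₁ l₂ l₃ l₄ ∈ termSpan N Set.univ := by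
  have h := fun (c : ℂ) (α γ : ℤ) => Submodule.smul_mem _ c (gweyl_mem_univ (N := N) (β := β) hε α γ)
  exact sub_mem (sub_mem (sub_mem (sub_mem (add_mem (h _ _ _) (h _ _ _)) (h _ _ _)) (h _ _ _))
    (h _ _ _)) (h _ _ _)

lemma traceTExpr_mem (hε : ε * ε = 1) (l₁ l₂ l₃ l₄ : ℂ) :
    traceTExpr (gweyl N β ε) l₁ l₂ l₃ l₄ ∈ termSpan N Set.univ := by
  have h := fun (c : ℂ) (α γ : ℤ) => Submodule.smul_mem _ c (gweyl_mem_univ (N := N) (β := β) hε α γ)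
  exact sub_mem (sub_mem (sub_mem (sub_mem (add_mem (h _ _ _) (h _ _ _)) (h _ _ _)) (h _ _ _))
    (h _ _ _)) (h _ _ _)

lemma termSpan_mono {S S' : Set ℂ} (h : S ⊆ S') : termSpan N S ≤ termSpan N S' :=
  Submodule.span_mono fun _ ⟨z, hz, k, γ, a, e⟩ => ⟨z, h hz, k, γ, a, e⟩

/-- With a = l₂l₃, c = (l₁l₂l₃l₄)⁻¹ and c' = l₃⁻² one has ac = (l₁l₄)⁻¹ and ac' = l₂/l₃; this
dictates the arguments of the dilogarithms in 𝔘_t. -/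
lemma traceTExpr_eq {l₁ l₂ l₃ l₄ : ℂ} (h₂ : l₂ ≠ 0) (h₃ : l₃ ≠ 0) :
    traceTExpr (gweyl N β ε) l₁ l₂ l₃ l₄ =
      preT N β ε (l₂ * l₃) (l₁ * l₂ * l₃ * l₄)⁻¹ (l₃ ^ 2)⁻¹ := by
  have e1 : (l₂ * l₃) * (l₁ * l₂ * l₃ * l₄)⁻¹ = (l₁ * l₄)⁻¹ := by
    simp only [mul_inv]
    field_simp
  have e2 : (l₂ * l₃) * (l₃ ^ 2)⁻¹ = l₂ / l₃ := by field_simp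
  have e3 : (l₂ * l₃) * (l₁ * l₂ * l₃ * l₄)⁻¹ * (l₃ ^ 2)⁻¹ = (l₁ * l₃ ^ 2 * l₄)⁻¹ := by
    rw [e1]
    simp only [mul_inv]
    ring
  rw [preT, e3, mul_add, e1, e2, traceTExpr]
  module

end twists

/-! ### Multiplication by quantum dilogarithms -/

lemma realises_mulOp_inv {M : Fn N} (h0 : ∀ m, ∀ᵐ x : ℝ, M x m ≠ 0) {W : Hilb N ≃ₗᵢ[ℂ] Hilb N}
    (hW : Realises W (mulOp M)) : Realises W⁻¹ (mulOp fun μ m => (M μ m)⁻¹) := by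
  refine hW.inv (fun F G hFG m => ?_) fun F m => ?_
  · filter_upwards [hFG m] with x hx
    change _ * F x m = _ * G x m
    rw [hx]
  · filter_upwards [h0 m] with x hx
    exact inv_mul_cancel_left₀ hx _

lemma Twist.conjugates_merGraph {s : ℂ} {k : ZMod N} {M R ρ π : Fn N} {X Z : FnOp N}
    (h : Twist s k M R ρ π X Z) (hM : ∀ m, Meromorphic fun z => M z m)
    {W : Hilb N ≃ₗᵢ[ℂ] Hilb N} (hW : Realises W (mulOp M)) :
    Conjugates W (merGraph X) (merGraph Z) :=
  conjugates_graphOn hW (realises_mulOp_inv (fun m => by simpa using h.ne 0 m) hW)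
    (fun _ hF => mulOp_mem_merFn hM hF) (fun _ hF => mulOp_mem_merFn (fun m => (hM m).inv) hF)
    (fun F _ m => h.map F m) (fun F _ m => h.map_inv F m)

section dilog

variable {b : ℂ} (hb : ‖b‖ = 1) (hre : 0 < b.re) (him : 0 < b.im)
include hb hre him

lemma meromorphic_dilogFn (c : ℂ) (m : ZMod N) : Meromorphic fun z => dilogFn N b c z m :=
  ((meromorphic_of_differentiable (differentiable_dilogDen hre him c m)).div
    (meromorphic_of_differentiable (differentiable_dilogNum hb hre him c m))).inv

lemma pointOp_dilogOp (c : ℂ) : PointOp (dilogOp N b c) := by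
  refine pointOp_mulOp (a := dilogFn N b c) (fun m => ?_) (norm_dilogFn hb hre him c)
  have h1 := (differentiable_dilogDen (N := N) hre him c m).continuous.comp
    Complex.continuous_ofReal
  have h2 := (differentiable_dilogNum (N := N) hb hre him c m).continuous.comp
    Complex.continuous_ofReal
  exact (h1.measurable.div h2.measurable).inv.aestronglyMeasurable

lemma pointOp_dilogInvOp (c : ℂ) : PointOp (dilogInvOp N b c) := by
  refine pointOp_mulOp (a := fun μ m => (dilogFn N b c μ m)⁻¹) (fun m => ?_) fun m => ?_
  · have h1 := (differentiable_dilogDen (N := N) hre him c m).continuous.comp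
      Complex.continuous_ofReal
    have h2 := (differentiable_dilogNum (N := N) hb hre him c m).continuous.comp
      Complex.continuous_ofReal
    exact (h1.measurable.div h2.measurable).inv.inv.aestronglyMeasurable
  · filter_upwards [norm_dilogFn hb hre him c m] with x hx
    rw [norm_inv, hx, inv_one]

lemma dilogInvOp_dilogOp (c : ℂ) (F : Fn N) (m : ZMod N) :
    ∀ᵐ x : ℝ, dilogInvOp N b c (dilogOp N b c F) x m = F x m := by
  filter_upwards [norm_dilogFn hb hre him c m] with x hx
  exact inv_mul_cancel_left₀ (norm_ne_zero_iff.1 (hx.symm ▸ one_ne_zero)) _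

lemma dilogOp_dilogInvOp (c : ℂ) (F : Fn N) (m : ZMod N) :
    ∀ᵐ x : ℝ, dilogOp N b c (dilogInvOp N b c F) x m = F x m := by
  filter_upwards [norm_dilogFn hb hre him c m] with x hx
  exact mul_inv_cancel_left₀ (norm_ne_zero_iff.1 (hx.symm ▸ one_ne_zero)) _

lemma exists_realises_dilogOp (c : ℂ) : ∃ W : Hilb N ≃ₗᵢ[ℂ] Hilb N, Realises W (dilogOp N b c) :=
  exists_realises (pointOp_dilogOp hb hre him c) (pointOp_dilogInvOp hb hre him c)
    (dilogInvOp_dilogOp hb hre him c) (dilogOp_dilogInvOp hb hre him c)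

lemma exists_realises_dilogInvOp (c : ℂ) :
    ∃ W : Hilb N ≃ₗᵢ[ℂ] Hilb N, Realises W (dilogInvOp N b c) :=
  exists_realises (pointOp_dilogInvOp hb hre him c) (pointOp_dilogOp hb hre him c)
    (dilogOp_dilogInvOp hb hre him c) (dilogInvOp_dilogOp hb hre him c)

lemma exists_isUs (l₁ l₂ l₃ l₄ : ℂ) (x₃ x₄ : ℝ) (k₃ k₄ : ZMod N) :
    ∃ 𝔘, IsUs N b l₁ l₂ l₃ l₄ x₃ x₄ k₃ k₄ 𝔘 := by
  obtain ⟨D, hD⟩ := (elem_phaseOp (N := N) (x₃ + x₄) (k₃ + k₄)).exists_realises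
  obtain ⟨S, hS⟩ := (elem_shiftOp (N := N) (x₃ + x₄) (k₃ + k₄)).exists_realises
  obtain ⟨T, hT⟩ := (elem_weilOp (N := N)).exists_realises
  obtain ⟨U, hU⟩ := exists_realises_dilogOp (N := N) hb hre him (l₁ / (l₂ * l₃ * l₄))
  obtain ⟨U', hU'⟩ := exists_realises_dilogOp (N := N) hb hre him 1
  exact ⟨_, D, S, U * U', T, hD, hS, hU.mul hU', hT, rfl⟩

lemma exists_isUt (l₁ l₂ l₃ l₄ : ℂ) (x₂ x₃ : ℝ) (k₂ k₃ : ZMod N) :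
    ∃ 𝔘, IsUt N b l₁ l₂ l₃ l₄ x₂ x₃ k₂ k₃ 𝔘 := by
  obtain ⟨D, hD⟩ := (elem_phaseOp (N := N) (x₂ + x₃) (k₂ + k₃)).exists_realises
  obtain ⟨S, hS⟩ := (elem_shiftOp (N := N) (x₂ + x₃) (k₂ + k₃)).exists_realises
  obtain ⟨T, hT⟩ := (elem_weilOp (N := N)).exists_realises
  obtain ⟨V, hV⟩ := (elem_parityOp (N := N)).exists_realises
  obtain ⟨U, hU⟩ := exists_realises_dilogInvOp (N := N) hb hre him (l₁ * l₂ * l₃ * l₄)⁻¹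
  obtain ⟨U', hU'⟩ := exists_realises_dilogInvOp (N := N) hb hre him (l₃ ^ 2)⁻¹
  exact ⟨_, D, S, U * U', T, V, hD, hS, hU.mul hU', hT, hV, rfl⟩

end dilog

end LevelN

namespace LevelN

open Filter Topology

set_option linter.unusedSectionVars false

variable {N : ℕ} [NeZero N]

/-! ### Chains of conjugations -/

/-- `X` is conjugated to `Z` by `A₂ M A₁`, where `A₁` and `A₂` are elementary operators and the
multiplication by `M` is a twist. -/
structure Chain (s : ℂ) (A₁ : FnOp N) (M : Fn N) (A₂ X Z : FnOp N) : Prop where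
  twist : ∃ k R ρ π X' Z', Twist s k M R ρ π X' Z' ∧ SemiconjBy A₁ X X' ∧ SemiconjBy A₂ Z' Z
  memX : X ∈ termSpan N Set.univ
  memZ : Z ∈ termSpan N Set.univ

/-- The factorization of a unitary that belongs to a chain. -/
structure Factors (W : Hilb N ≃ₗᵢ[ℂ] Hilb N) (A₁ A₁' : FnOp N) (M : Fn N) (A₂ A₂' : FnOp N) :
    Prop where
  elem₁ : Elem A₁ A₁'
  elem₂ : Elem A₂ A₂'
  mer : ∀ m, Meromorphic fun z => M z m
  fac : ∃ W₁ W' W₂, Realises W₁ A₁ ∧ Realises W' (mulOp M) ∧ Realises W₂ A₂ ∧ W = W₂ * W' * W₁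

section chain

variable {s : ℂ} {W : Hilb N ≃ₗᵢ[ℂ] Hilb N} {A₁ A₁' A₂ A₂' X Z : FnOp N} {M M₁ M₂ : Fn N}

lemma Chain.conjugates_merGraph (h : Chain s A₁ M A₂ X Z) (hW : Factors W A₁ A₁' M A₂ A₂') :
    Conjugates W (merGraph X) (merGraph Z) := by
  obtain ⟨k, R, ρ, π, X', Z', ht, h1, h2⟩ := h.twist
  obtain ⟨W₁, W', W₂, hW₁, hW', hW₂, rfl⟩ := hW.fac
  exact (hW.elem₁.conjugates_merGraph hW₁ h1).trans
    ((ht.conjugates_merGraph hW.mer hW').trans (hW.elem₂.conjugates_merGraph hW₂ h2))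

lemma Chain.conjugates_closedGraph (h : Chain s A₁ (M₁ * M₂) A₂ X Z)
    (hW : Factors W A₁ A₁' (M₁ * M₂) A₂ A₂') (hs : s.im ≠ 0) {p₁ p₂ : ℂ} {B₁ B₂ C₁ C₂ : Fn N}
    (hM₁ : StripMult s M₁ p₁ B₁ C₁) (hM₂ : StripMult s M₂ p₂ B₂ C₂) :
    Conjugates W (closedGraph X) (closedGraph Z) := by
  obtain ⟨k, R, ρ, π, X', Z', ht, h1, h2⟩ := h.twist
  obtain ⟨W₁, W', W₂, hW₁, hW', hW₂, rfl⟩ := hW.fac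
  exact (hW.elem₁.conjugates_closedGraph hW₁ h.memX
      (termSpan_mono (Set.subset_univ _) ht.X_mem) h1).trans
    ((conjugates_closedGraph_of_stripMult hs ht hM₁ hM₂ hW'
      (realises_mulOp_inv (fun m => by simpa using ht.ne 0 m) hW')).trans
      (hW.elem₂.conjugates_closedGraph hW₂ (termSpan_mono (Set.subset_univ _) ht.Z_mem) h.memZ h2))

end chain

/-! ### Quantised parameters -/

section quantised

variable {b l l' : ℂ}

lemma y_add (μ μ' : ℂ) (m m' : ZMod N) :
    y N b (μ + μ') (m + m') = y N b μ m * y N b μ' m' := by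
  rw [← gy_one, gy_add]

lemma Quantised.mul (h : Quantised N b l) (h' : Quantised N b l') : Quantised N b (l * l') := by
  obtain ⟨x, k, rfl⟩ := h
  obtain ⟨x', k', rfl⟩ := h'
  exact ⟨x + x', k + k', by rw [ofReal_add, y_add]⟩

lemma Quantised.inv (h : Quantised N b l) : Quantised N b l⁻¹ := by
  obtain ⟨x, k, rfl⟩ := h
  exact ⟨-x, -k, by rw [ofReal_neg, ← gy_one, gy_neg]⟩

lemma quantised_one : Quantised N b 1 := ⟨0, 0, by rw [ofReal_zero, ← gy_one, gy_zero]⟩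

end quantised

/-! ### The chains of the S-cycle and of the T-cycle -/

section cycles

variable {β : ℂ} {ε : ℤ} {φ φ' : Fn N}

lemma chain_S (hε : ε * ε = 1) {l₁ l₂ l₃ l₄ : ℂ} (h₃ : l₃ ≠ 0) (h₄ : l₄ ≠ 0)
    (x : ℝ) (k : ZMod N) (ha : l₃ * l₄ = gy N β ε x k)
    (h : IsDilog β ε (l₁ / (l₂ * l₃ * l₄)) φ) (h' : IsDilog β ε 1 φ') :
    Chain (I * β) (weilOp N) (φ * φ')
      ((mulOp fun z m => (phaseFn N x k z m)⁻¹) * shiftOp (x : ℂ) k)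
      (traceSExpr (gweyl N β ε) l₁ l₂ l₃ l₄) (dehnExpr (gweyl N β ε)) where
  twist := by
    refine ⟨_, _, _, _, _, _, twist_S hε h h' (l₃ * l₄), ?_, ?_⟩
    · have e : l₃ * l₄ * (l₁ / (l₂ * l₃ * l₄)) = l₁ / l₂ := by
        simp only [div_eq_mul_inv, mul_inv]
        field_simp
      rw [e]
      exact semiconj_T_S hε _ _
    · rw [ha]
      exact semiconj_L_S hε x k
  memX := traceSExpr_mem hε _ _ _ _
  memZ := dehnExpr_mem hε

lemma chain_T (hε : ε * ε = 1) {l₁ l₂ l₃ l₄ : ℂ} (h₂ : l₂ ≠ 0) (h₃ : l₃ ≠ 0)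
    (x : ℝ) (k : ZMod N) (ha : l₂ * l₃ = gy N β ε x k)
    (h : IsDilog β ε (l₁ * l₂ * l₃ * l₄)⁻¹ φ) (h' : IsDilog β ε (l₃ ^ 2)⁻¹ φ') :
    Chain (-(I * β)) 1 ((fun μ m => (φ μ m)⁻¹) * fun μ m => (φ' μ m)⁻¹)
      ((mulOp fun z m => (phaseFn N x k z m)⁻¹) * shiftOp ((-x : ℝ) : ℂ) (-k) *
        (mulOp fun z m => (weilFn N z m)⁻¹) * parityOp N)
      (traceTExpr (gweyl N β ε) l₁ l₂ l₃ l₄) (dehnExpr (gweyl N β ε)) where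
  twist := by
    refine ⟨_, _, _, _, _, _, twist_T hε h h' (l₂ * l₃), ?_, ?_⟩
    · rw [traceTExpr_eq h₂ h₃]
      exact SemiconjBy.one_left _
    · rw [ha]
      exact semiconj_L_T hε x k
  memX := traceTExpr_mem hε _ _ _ _
  memZ := dehnExpr_mem hε

lemma elem_one : Elem (1 : FnOp N) 1 :=
  ⟨one_mul _, one_mul _, mulOp_one (N := N) ▸ pointOp_mulOp
    (fun _ => aestronglyMeasurable_const) fun _ => ae_of_all _ fun _ => norm_one,
    mulOp_one (N := N) ▸ pointOp_mulOp
    (fun _ => aestronglyMeasurable_const) fun _ => ae_of_all _ fun _ => norm_one,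
    fun _ _ _ h => h, fun _ _ _ h => h, fun _ h => h, fun _ h => h⟩

variable {b : ℂ} (hb : ‖b‖ = 1) (hre : 0 < b.re) (him : 0 < b.im)
include hb hre him

lemma conj_y_real (x : ℝ) (k : ZMod N) : conj (y N b x k) = gy N b⁻¹ (-1) x k := by
  rw [conj_y hb, conj_ofReal, gy_neg_one]

lemma factors_S {l₁ l₂ l₃ l₄ : ℂ} {x₃ x₄ : ℝ} {k₃ k₄ : ZMod N} {𝔘 : Hilb N ≃ₗᵢ[ℂ] Hilb N}
    (h : IsUs N b l₁ l₂ l₃ l₄ x₃ x₄ k₃ k₄ 𝔘) :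
    Factors 𝔘 (weilOp N) (mulOp fun z m => (weilFn N z m)⁻¹)
      (dilogFn N b (l₁ / (l₂ * l₃ * l₄)) * dilogFn N b 1)
      ((mulOp fun z m => (phaseFn N (x₃ + x₄) (k₃ + k₄) z m)⁻¹) *
        shiftOp ((x₃ + x₄ : ℝ) : ℂ) (k₃ + k₄))
      (shiftOp ((-(x₃ + x₄) : ℝ) : ℂ) (-(k₃ + k₄)) * phaseOp N (x₃ + x₄) (k₃ + k₄)) where
  elem₁ := elem_weilOp
  elem₂ := (elem_phaseOp _ _).symm.mul (elem_shiftOp _ _)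
  mer m := (meromorphic_dilogFn hb hre him _ m).mul (meromorphic_dilogFn hb hre him _ m)
  fac := by
    obtain ⟨D, S, U', T, hD, hS, hU, hT, rfl⟩ := h
    exact ⟨T, U', D⁻¹ * S, hT, by rwa [dilogOp_eq, dilogOp_eq, mulOp_mul] at hU,
      ((elem_phaseOp _ _).realises_inv hD).mul hS, rfl⟩

lemma factors_T {l₁ l₂ l₃ l₄ : ℂ} {x₂ x₃ : ℝ} {k₂ k₃ : ZMod N} {𝔘 : Hilb N ≃ₗᵢ[ℂ] Hilb N}
    (h : IsUt N b l₁ l₂ l₃ l₄ x₂ x₃ k₂ k₃ 𝔘) :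
    Factors 𝔘 1 1
      ((fun μ m => (dilogFn N b (l₁ * l₂ * l₃ * l₄)⁻¹ μ m)⁻¹) *
        fun μ m => (dilogFn N b (l₃ ^ 2)⁻¹ μ m)⁻¹)
      ((mulOp fun z m => (phaseFn N (x₂ + x₃) (k₂ + k₃) z m)⁻¹) *
        shiftOp ((-(x₂ + x₃) : ℝ) : ℂ) (-(k₂ + k₃)) *
        (mulOp fun z m => (weilFn N z m)⁻¹) * parityOp N)
      (parityOp N * (weilOp N * (shiftOp ((x₂ + x₃ : ℝ) : ℂ) (k₂ + k₃) *
        phaseOp N (x₂ + x₃) (k₂ + k₃)))) where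
  elem₁ := elem_one
  elem₂ := (((elem_phaseOp _ _).symm.mul (elem_shiftOp _ _).symm).mul elem_weilOp.symm).mul
    elem_parityOp
  mer m := (meromorphic_dilogFn hb hre him _ m).inv.mul (meromorphic_dilogFn hb hre him _ m).inv
  fac := by
    obtain ⟨D, S, U', T, V, hD, hS, hU, hT, hV, rfl⟩ := h
    refine ⟨1, U', D⁻¹ * S⁻¹ * T⁻¹ * V, fun _ _ h => h,
      by rwa [dilogInvOp_eq, dilogInvOp_eq, mulOp_mul] at hU,
      ((((elem_phaseOp _ _).realises_inv hD).mul ((elem_shiftOp _ _).realises_inv hS)).mul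
        (elem_weilOp.realises_inv hT)).mul hV, rfl⟩

/-! ### The S-cycle: meromorphic and closed equivalence -/

section S

variable {l₁ l₂ l₃ l₄ : ℂ} {x₃ x₄ : ℝ} {k₃ k₄ : ZMod N} (h₃ : l₃ = y N b (x₃ : ℂ) k₃)
  (h₄ : l₄ = y N b (x₄ : ℂ) k₄)
include h₃ h₄

lemma chain_S_one : Chain (I * b) (weilOp N)
    (dilogFn N b (l₁ / (l₂ * l₃ * l₄)) * dilogFn N b 1)
    ((mulOp fun z m => (phaseFn N (x₃ + x₄) (k₃ + k₄) z m)⁻¹) *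
      shiftOp ((x₃ + x₄ : ℝ) : ℂ) (k₃ + k₄))
    (pairS N b l₁ l₂ l₃ l₄).1 (pairL N b).1 := by
  have h0 : l₃ ≠ 0 ∧ l₄ ≠ 0 := by
    rw [h₃, h₄]
    exact ⟨y_ne_zero _ _, y_ne_zero _ _⟩
  have := chain_S (N := N) (l₁ := l₁) (l₂ := l₂) (ε := 1) (by norm_num) h0.1 h0.2 (x₃ + x₄) (k₃ + k₄)
    (by rw [h₃, h₄, gy_one, ofReal_add, y_add]) (isDilog_one hb hre him _)
    (isDilog_one hb hre him _)
  rwa [gweyl_one] at this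

/-- The same multiplier satisfies the functional equation in ỹ with the conjugate parameter, so the
chain argument is repeated with b⁻¹, ε = -1 and conjugated lₐ. -/
lemma chain_S_two : Chain (I * b⁻¹) (weilOp N)
    (dilogFn N b (l₁ / (l₂ * l₃ * l₄)) * dilogFn N b 1)
    ((mulOp fun z m => (phaseFn N (x₃ + x₄) (k₃ + k₄) z m)⁻¹) *
      shiftOp ((x₃ + x₄ : ℝ) : ℂ) (k₃ + k₄))
    (pairS N b l₁ l₂ l₃ l₄).2 (pairL N b).2 := by
  have h0 : conj l₃ ≠ 0 ∧ conj l₄ ≠ 0 := by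
    rw [h₃, h₄]
    exact ⟨(map_ne_zero _).2 (y_ne_zero _ _), (map_ne_zero _).2 (y_ne_zero _ _)⟩
  have hd := isDilog_neg_one (N := N) hb hre him (l₁ / (l₂ * l₃ * l₄))
  have hd' := isDilog_neg_one (N := N) hb hre him 1
  rw [map_div₀, map_mul, map_mul] at hd
  rw [map_one] at hd'
  have := chain_S (N := N) (l₁ := conj l₁) (l₂ := conj l₂) (ε := -1) (by norm_num) h0.1 h0.2
    (x₃ + x₄) (k₃ + k₄)
    (by rw [h₃, h₄, conj_y_real hb hre him, conj_y_real hb hre him, ofReal_add, gy_add]) hd hd'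
  rwa [gweyl_neg_one] at this

lemma merEquiv_S {𝔘 : Hilb N ≃ₗᵢ[ℂ] Hilb N} (h : IsUs N b l₁ l₂ l₃ l₄ x₃ x₄ k₃ k₄ 𝔘) :
    MerEquiv 𝔘 (pairS N b l₁ l₂ l₃ l₄) (pairL N b) :=
  ⟨(chain_S_one hb hre him h₃ h₄).conjugates_merGraph (factors_S hb hre him h),
    (chain_S_two hb hre him h₃ h₄).conjugates_merGraph (factors_S hb hre him h)⟩

lemma closedEquiv_S {𝔘 : Hilb N ≃ₗᵢ[ℂ] Hilb N} (h : IsUs N b l₁ l₂ l₃ l₄ x₃ x₄ k₃ k₄ 𝔘)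
    (hN : Even N) (hq : Quantised N b (l₁ / l₂)) :
    ClosedEquiv 𝔘 (pairS N b l₁ l₂ l₃ l₄) (pairL N b) := by
  -- Both shifts have imaginary part Re b, so one strip serves both members of the pair.
  have e1 : (I * b).im = b.re := by simp
  have e2 : (I * b⁻¹).im = b.re := by rw [I_mul_im, inv_re hb]
  have q : Quantised N b (l₁ / (l₂ * l₃ * l₄)) := by
    have := (hq.mul (Quantised.inv ⟨x₃, k₃, h₃⟩)).mul (Quantised.inv ⟨x₄, k₄, h₄⟩)
    convert this using 1
    simp only [div_eq_mul_inv, mul_inv]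
    ring
  have hc := chain_S_one hb hre him (l₁ := l₁) (l₂ := l₂) h₃ h₄
  have hc' := chain_S_two hb hre him (l₁ := l₁) (l₂ := l₂) h₃ h₄
  have hf := factors_S hb hre him h
  have hs : ∀ c : ℂ, Quantised N b c → ∀ s : ℂ, s.im = b.re → ∃ p B C,
      StripMult s (dilogFn N b c) p B C := by
    rintro _ ⟨x, k, rfl⟩ s hs
    exact ⟨_, _, _, stripMult_dilogFn hN hb hre him x k hs⟩
  obtain ⟨_, _, _, s1⟩ := hs _ q _ e1
  obtain ⟨_, _, _, s2⟩ := hs _ q _ e2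
  obtain ⟨_, _, _, s3⟩ := hs 1 quantised_one _ e1
  obtain ⟨_, _, _, s4⟩ := hs 1 quantised_one _ e2
  exact ⟨hc.conjugates_closedGraph hf (e1.trans_ne hre.ne') s1 s3,
    hc'.conjugates_closedGraph hf (e2.trans_ne hre.ne') s2 s4⟩

end S

/-! ### The T-cycle: meromorphic and closed equivalence -/

section T

variable {l₁ l₂ l₃ l₄ : ℂ} {x₂ x₃ : ℝ} {k₂ k₃ : ZMod N} (h₂ : l₂ = y N b (x₂ : ℂ) k₂)
  (h₃ : l₃ = y N b (x₃ : ℂ) k₃)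
include h₂ h₃

lemma chain_T_one : Chain (-(I * b)) 1
    ((fun μ m => (dilogFn N b (l₁ * l₂ * l₃ * l₄)⁻¹ μ m)⁻¹) *
      fun μ m => (dilogFn N b (l₃ ^ 2)⁻¹ μ m)⁻¹)
    ((mulOp fun z m => (phaseFn N (x₂ + x₃) (k₂ + k₃) z m)⁻¹) *
      shiftOp ((-(x₂ + x₃) : ℝ) : ℂ) (-(k₂ + k₃)) *
      (mulOp fun z m => (weilFn N z m)⁻¹) * parityOp N)
    (pairT N b l₁ l₂ l₃ l₄).1 (pairL N b).1 := by
  have h0 : l₂ ≠ 0 ∧ l₃ ≠ 0 := by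
    rw [h₂, h₃]
    exact ⟨y_ne_zero _ _, y_ne_zero _ _⟩
  have := chain_T (N := N) (l₁ := l₁) (l₄ := l₄) (ε := 1) (by norm_num) h0.1 h0.2 (x₂ + x₃) (k₂ + k₃)
    (by rw [h₂, h₃, gy_one, ofReal_add, y_add]) (isDilog_one hb hre him _)
    (isDilog_one hb hre him _)
  rwa [gweyl_one] at this

lemma chain_T_two : Chain (-(I * b⁻¹)) 1
    ((fun μ m => (dilogFn N b (l₁ * l₂ * l₃ * l₄)⁻¹ μ m)⁻¹) *
      fun μ m => (dilogFn N b (l₃ ^ 2)⁻¹ μ m)⁻¹)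
    ((mulOp fun z m => (phaseFn N (x₂ + x₃) (k₂ + k₃) z m)⁻¹) *
      shiftOp ((-(x₂ + x₃) : ℝ) : ℂ) (-(k₂ + k₃)) *
      (mulOp fun z m => (weilFn N z m)⁻¹) * parityOp N)
    (pairT N b l₁ l₂ l₃ l₄).2 (pairL N b).2 := by
  have h0 : conj l₂ ≠ 0 ∧ conj l₃ ≠ 0 := by
    rw [h₂, h₃]
    exact ⟨(map_ne_zero _).2 (y_ne_zero _ _), (map_ne_zero _).2 (y_ne_zero _ _)⟩
  have hd := isDilog_neg_one (N := N) hb hre him (l₁ * l₂ * l₃ * l₄)⁻¹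
  have hd' := isDilog_neg_one (N := N) hb hre him (l₃ ^ 2)⁻¹
  rw [map_inv₀, map_mul, map_mul, map_mul] at hd
  rw [map_inv₀, map_pow] at hd'
  have := chain_T (N := N) (l₁ := conj l₁) (l₄ := conj l₄) (ε := -1) (by norm_num) h0.1 h0.2
    (x₂ + x₃) (k₂ + k₃)
    (by rw [h₂, h₃, conj_y_real hb hre him, conj_y_real hb hre him, ofReal_add, gy_add]) hd hd'
  rwa [gweyl_neg_one] at this

lemma merEquiv_T {𝔘 : Hilb N ≃ₗᵢ[ℂ] Hilb N} (h : IsUt N b l₁ l₂ l₃ l₄ x₂ x₃ k₂ k₃ 𝔘) :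
    MerEquiv 𝔘 (pairT N b l₁ l₂ l₃ l₄) (pairL N b) :=
  ⟨(chain_T_one hb hre him h₂ h₃).conjugates_merGraph (factors_T hb hre him h),
    (chain_T_two hb hre him h₂ h₃).conjugates_merGraph (factors_T hb hre him h)⟩

lemma closedEquiv_T {𝔘 : Hilb N ≃ₗᵢ[ℂ] Hilb N} (h : IsUt N b l₁ l₂ l₃ l₄ x₂ x₃ k₂ k₃ 𝔘)
    (hN : Even N) (hq : Quantised N b (l₁ * l₄)) :
    ClosedEquiv 𝔘 (pairT N b l₁ l₂ l₃ l₄) (pairL N b) := by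
  have e1 : (-(I * b)).im = -b.re := by simp
  have e2 : (-(I * b⁻¹)).im = -b.re := by rw [neg_im, I_mul_im, inv_re hb]
  have q1 : Quantised N b (l₁ * l₂ * l₃ * l₄)⁻¹ := by
    have := ((hq.mul ⟨x₂, k₂, h₂⟩).mul ⟨x₃, k₃, h₃⟩).inv
    convert this using 2
    ring
  have q2 : Quantised N b (l₃ ^ 2)⁻¹ := by
    rw [sq]
    exact (Quantised.mul ⟨x₃, k₃, h₃⟩ ⟨x₃, k₃, h₃⟩).inv
  have hs : ∀ c : ℂ, Quantised N b c → ∀ s : ℂ, s.im = -b.re → ∃ p B C,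
      StripMult s (fun μ m => (dilogFn N b c μ m)⁻¹) p B C := by
    rintro _ ⟨x, k, rfl⟩ s hs
    -- The shift is downwards and the dilogarithm is inverted; the two reversals match in
    -- `StripMult.inv`.
    refine ⟨_, _, _, (stripMult_dilogFn hN hb hre him x k (s := -s) ?_).inv ?_⟩
    · rw [neg_im, hs, neg_neg]
    · rw [neg_im, neg_neg]
  have hc := chain_T_one hb hre him (l₁ := l₁) (l₄ := l₄) h₂ h₃
  have hc' := chain_T_two hb hre him (l₁ := l₁) (l₄ := l₄) h₂ h₃
  have hf := factors_T hb hre him h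
  obtain ⟨_, _, _, s1⟩ := hs _ q1 _ e1
  obtain ⟨_, _, _, s2⟩ := hs _ q1 _ e2
  obtain ⟨_, _, _, s3⟩ := hs _ q2 _ e1
  obtain ⟨_, _, _, s4⟩ := hs _ q2 _ e2
  exact ⟨hc.conjugates_closedGraph hf (e1.trans_ne (neg_ne_zero.2 hre.ne')) s1 s3,
    hc'.conjugates_closedGraph hf (e2.trans_ne (neg_ne_zero.2 hre.ne')) s2 s4⟩

end T

end cycles

/-! ### Composition of equivalences -/

section equiv

variable {W W' : Hilb N ≃ₗᵢ[ℂ] Hilb N} {X X' X'' : FnOp N × FnOp N}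

lemma MerEquiv.symm (h : MerEquiv W X X') : MerEquiv W⁻¹ X' X := ⟨h.1.symm, h.2.symm⟩

lemma MerEquiv.trans (h : MerEquiv W X X') (h' : MerEquiv W' X' X'') : MerEquiv (W' * W) X X'' :=
  ⟨h.1.trans h'.1, h.2.trans h'.2⟩

lemma ClosedEquiv.symm (h : ClosedEquiv W X X') : ClosedEquiv W⁻¹ X' X := ⟨h.1.symm, h.2.symm⟩

lemma ClosedEquiv.trans (h : ClosedEquiv W X X') (h' : ClosedEquiv W' X' X'') :
    ClosedEquiv (W' * W) X X'' :=
  ⟨h.1.trans h'.1, h.2.trans h'.2⟩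

end equiv

end LevelN

namespace LevelN

open Filter Topology

set_option linter.unusedSectionVars false

variable {N : ℕ} [NeZero N]

/-! ### Hermitian conjugates -/

lemma isConjugatePair_add {S : Set ℂ} {X X' Y Y' : FnOp N} (hX : X ∈ termSpan N S)
    (hX' : X' ∈ termSpan N S) (hY : Y ∈ termSpan N S) (hY' : Y' ∈ termSpan N S)
    (h : IsConjugatePair (X, X')) (h' : IsConjugatePair (Y, Y')) :
    IsConjugatePair (X + Y, X' + Y') := by
  rintro f f' g g' ⟨F, hF, h1, h2⟩ ⟨G, hG, h3, h4⟩
  obtain ⟨f₁, hf₁⟩ := exists_rep_of_mem_gaussFn hX hF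
  obtain ⟨f₂, hf₂⟩ := exists_rep_of_mem_gaussFn hY hF
  obtain ⟨g₁, hg₁⟩ := exists_rep_of_mem_gaussFn hX' hG
  obtain ⟨g₂, hg₂⟩ := exists_rep_of_mem_gaussFn hY' hG
  have e1 : f' = f₁ + f₂ := h2.unique (hf₁.add hf₂)
  have e2 : g' = g₁ + g₂ := h4.unique (hg₁.add hg₂)
  rw [e1, e2, inner_add_left, inner_add_right,
    h f f₁ g g₁ ⟨F, hF, h1, hf₁⟩ ⟨G, hG, h3, hg₁⟩,
    h' f f₂ g g₂ ⟨F, hF, h1, hf₂⟩ ⟨G, hG, h3, hg₂⟩]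

lemma isConjugatePair_smul {S : Set ℂ} {X X' : FnOp N} (hX : X ∈ termSpan N S)
    (hX' : X' ∈ termSpan N S) (h : IsConjugatePair (X, X')) (c : ℂ) :
    IsConjugatePair (c • X, conj c • X') := by
  rintro f f' g g' ⟨F, hF, h1, h2⟩ ⟨G, hG, h3, h4⟩
  obtain ⟨f₁, hf₁⟩ := exists_rep_of_mem_gaussFn hX hF
  obtain ⟨g₁, hg₁⟩ := exists_rep_of_mem_gaussFn hX' hG
  have e1 : f' = c • f₁ := h2.unique (hf₁.smul c)
  have e2 : g' = conj c • g₁ := h4.unique (hg₁.smul _)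
  rw [e1, e2, inner_smul_left, inner_smul_right,
    h f f₁ g g₁ ⟨F, hF, h1, hf₁⟩ ⟨G, hG, h3, hg₁⟩]

lemma differentiable_conj_comp {f : ℂ → ℂ} (hf : Differentiable ℂ f) :
    Differentiable ℂ fun z => conj (f (conj z)) := fun z => by
  have := (hf (conj z)).conj_conj
  rwa [conj_conj] at this

lemma gaussBdd_conj {F : Fn N} (hF : F ∈ gaussFn N) (H : ℝ) (m : ZMod N) :
    GaussBdd (fun z : {z : ℂ // |z.im| ≤ H} => z.1.re) fun z => conj (F (conj z.1) m) := by
  have h := (gaussBdd_of_mem_gaussFn hF H m).comp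
    fun z : {z : ℂ // |z.im| ≤ H} => (⟨conj z.1, by simpa using z.2⟩ : {z : ℂ // |z.im| ≤ H})
  obtain ⟨C, δ, hδ, h⟩ := h
  refine ⟨C, δ, hδ, fun z => ?_⟩
  have := h z
  simpa using this

section

variable {b : ℂ} (hb : ‖b‖ = 1) (hre : 0 < b.re) (him : 0 < b.im)
include hb hre him

lemma conj_gq : conj (gq N b) = (gq N b⁻¹)⁻¹ := conj_q hb

/-- Since conj(ib) = -ib⁻¹, the conjugate of F(x + αib) is the analytic function conj F(conj(z - s))
at z = x, with s = αib⁻¹. Moving the contour by `s` transfers the shift to `G`, and re-indexing the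
sum transfers the step in m. The powers of q̃ agree after y is commuted past the shift. -/
lemma isConjugatePair_weyl (α γ : ℤ) :
    IsConjugatePair (gweyl N b 1 α γ, gweyl N b⁻¹ (-1) α γ) := by
  rintro f f' g g' ⟨F, hF, h1, h2⟩ ⟨G, hG, h3, h4⟩
  set s : ℂ := α * (I * b⁻¹) with hs
  -- The factor ỹ^γ is absorbed into `G`, which remains Gaussian; only a pure shift has to be
  -- transferred.
  have hG' : gweyl N b⁻¹ (-1) 0 γ G ∈ gaussFn N := by
    obtain ⟨a, ha⟩ : ∃ a, gweyl N b⁻¹ (-1) 0 γ = termOp (N := N) 0 0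
        (γ * ((2 * Real.pi / N : ℝ) * b⁻¹)) a := by
      refine ⟨fun m => exp (2 * Real.pi * I / N * (m.val : ℂ)) ^ γ, ?_⟩
      ext F μ m
      rw [gweyl_zero_apply (by norm_num), termOp_apply, gy_neg_one, yt_eq, mul_zpow,
        ← Complex.exp_int_mul ((2 * Real.pi / N : ℝ) * b⁻¹ * μ), add_zero, add_zero]
      congr 3
      ring
    rw [ha]
    exact termOp_gauss _ _ _ _ 0 hG
  have hG'e : ∀ z m, gweyl N b⁻¹ (-1) 0 γ G z m = gy N b⁻¹ (-1) z m ^ γ * G z m :=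
    fun z m => gweyl_zero_apply (by norm_num) _ _ _ _
  set K := gweyl N b⁻¹ (-1) 0 γ G with hK
  rw [inner_eq_of_rep_rep h2 h3, inner_eq_of_rep_rep h1 h4,
    ← Equiv.sum_comp (Equiv.addRight (α : ZMod N))]
  refine Finset.sum_congr rfl fun m _ => ?_
  set φ : ℂ → ℂ := fun z => (gq N b⁻¹ ^ (α * γ))⁻¹ * (conj (F (conj (z - s)) m) * K z (m + α)) with hφ
  have key := integral_add_eq_integral (s := s) (f := φ) ?_ ?_
  · have e1 : ∀ x : ℝ, conj (gweyl N b 1 α γ F x (m + α)) * G x (m + α) = φ x := fun x => by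
      simp only [hφ]
      rw [gweyl_apply (by norm_num), hG'e, map_mul, map_mul, map_zpow₀, map_zpow₀,
        conj_gq hb hre him, gy_one, conj_y_real hb hre him, inv_zpow, Int.cast_one, one_mul,
        add_neg_cancel_right]
      have : (x : ℂ) + α * (I * b) = conj (x - s) := by
        rw [hs, map_sub, map_mul, map_mul, conj_I, map_inv₀, conj_eq_inv hb, inv_inv, conj_ofReal]
        simp
      rw [this]
      ring
    have e2 : ∀ x : ℝ, conj (F x m) * gweyl N b⁻¹ (-1) α γ G x m = φ (x + s) := fun x => by
      have h5 := gy_shift (N := N) (β := b⁻¹) (ε := -1) (by norm_num) α x m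
      have h6 : m + -(((-1 : ℤ) : ZMod N) * (α : ZMod N)) = m + α := by push_cast; ring
      simp only [hφ]
      rw [gweyl_apply (by norm_num), hG'e, add_sub_cancel_right, conj_ofReal, h6]
      rw [h6] at h5
      rw [← hs] at h5
      rw [h5, mul_zpow, ← zpow_mul]
      have h7 : (gq N b⁻¹ ^ (α * γ))⁻¹ * gq N b⁻¹ ^ (2 * α * γ) = gq N b⁻¹ ^ (α * γ) := by
        rw [← zpow_neg, ← zpow_add₀ gq_ne_zero]
        congr 1
        ring
      rw [← hs]
      generalize gq N b⁻¹ ^ (α * γ) = u at h7 ⊢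
      generalize gq N b⁻¹ ^ (2 * α * γ) = v at h7 ⊢
      linear_combination (-(conj (F x m) * gy N b⁻¹ (-1) x m ^ γ * G (x + s) (m + α))) * h7
    simp only [Equiv.coe_addRight]
    simp_rw [e1, e2]
    exact key.symm
  · intro z _
    have h5 := (differentiable_conj_comp (differentiable_of_mem_gaussFn hF m)).comp
      (differentiable_id.sub_const s)
    exact ((h5 z).mul (differentiable_of_mem_gaussFn hG' (m + α) z)).const_mul _
  · obtain ⟨C, δ, hC, hδ, hbd⟩ := (gaussBdd_conj hF (|s.im| + |s.im|) m).exists_nonneg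
    refine GaussBdd.const_mul _ (GaussBdd.mul_bdd (C := C) ?_ fun z => ?_)
    · exact (gaussBdd_of_mem_gaussFn hG' |s.im| (m + α)).comp
        fun z : strip s.im => ⟨z.1, abs_im_le_of_mem_strip z.2⟩
    · refine (hbd ⟨z - s, ?_⟩).trans (mul_le_of_le_one_right hC ?_)
      · rw [sub_im]
        exact (abs_sub _ _).trans (add_le_add_left (abs_im_le_of_mem_strip z.2) _)
      · rw [Real.exp_le_one_iff, neg_mul, neg_nonpos]
        positivity

end

/-! ### Hermitian conjugation for the three pairs -/

section expr

variable {b : ℂ}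

lemma weyl_mem (α γ : ℤ) : weyl N b α γ ∈ termSpan N Set.univ := by
  rw [← gweyl_one]
  exact gweyl_mem_univ (by norm_num) _ _

lemma weylt_mem (α γ : ℤ) : weylt N b α γ ∈ termSpan N Set.univ := by
  rw [← gweyl_neg_one]
  exact gweyl_mem_univ (by norm_num) _ _

variable (hb : ‖b‖ = 1) (hre : 0 < b.re) (him : 0 < b.im)
include hb hre him

/-- The pairs of operators for which Hermitian conjugation on `𝒲` is established termwise. -/
lemma isConjugatePair_smul_weyl (c : ℂ) (α γ : ℤ) :
    IsConjugatePair (c • weyl N b α γ, conj c • weylt N b α γ) := by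
  rw [← gweyl_one, ← gweyl_neg_one]
  exact isConjugatePair_smul (gweyl_mem_univ (by norm_num) _ _) (gweyl_mem_univ (by norm_num) _ _)
    (isConjugatePair_weyl hb hre him α γ) c

lemma isConjugatePair_sum {ι : Type*} (s : Finset ι) (c : ι → ℂ) (α γ : ι → ℤ) :
    IsConjugatePair (∑ i ∈ s, c i • weyl N b (α i) (γ i), ∑ i ∈ s, conj (c i) • weylt N b (α i) (γ i)) := by
  classical
  induction s using Finset.induction_on with
  | empty =>
    have := isConjugatePair_smul_weyl (N := N) hb hre him 0 0 0
    simpa using this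
  | insert i s hi ih =>
    rw [Finset.sum_insert hi, Finset.sum_insert hi]
    exact isConjugatePair_add (Submodule.smul_mem _ _ (weyl_mem _ _))
      (Submodule.smul_mem _ _ (weylt_mem _ _))
      (Submodule.sum_mem _ fun _ _ => Submodule.smul_mem _ _ (weyl_mem _ _))
      (Submodule.sum_mem _ fun _ _ => Submodule.smul_mem _ _ (weylt_mem _ _))
      (isConjugatePair_smul_weyl hb hre him _ _ _) ih

theorem isConjugatePair_pairL : IsConjugatePair (pairL N b) := by
  have := isConjugatePair_sum (N := N) hb hre him Finset.univ (fun _ : Fin 3 => 1) ![0, 0, 1]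
    ![-1, 1, 0]
  simpa [Fin.sum_univ_succ, pairL, dehnExpr, add_assoc] using this

theorem isConjugatePair_pairS (l₁ l₂ l₃ l₄ : ℂ) : IsConjugatePair (pairS N b l₁ l₂ l₃ l₄) := by
  have := isConjugatePair_sum (N := N) hb hre him Finset.univ
    ![(l₃ * l₄)⁻¹, l₃ * l₄, -(l₁ / l₂), -(l₃ * l₄), -(l₁ / l₂), -(l₃ * l₄)]
    ![0, 0, 1, 1, 1, 1] ![1, -1, 1, -1, 0, 0]
  convert this using 1
  refine Prod.ext ?_ ?_
  · simp [Fin.sum_univ_succ, pairS, traceSExpr]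
    module
  · simp [Fin.sum_univ_succ, pairS, traceSExpr]
    module

theorem isConjugatePair_pairT (l₁ l₂ l₃ l₄ : ℂ) : IsConjugatePair (pairT N b l₁ l₂ l₃ l₄) := by
  have := isConjugatePair_sum (N := N) hb hre him Finset.univ
    ![(l₂ * l₃)⁻¹, l₂ * l₃, -(l₂ * l₃), -(l₁ * l₃ ^ 2 * l₄)⁻¹, -(l₂ / l₃), -(l₁ * l₄)⁻¹]
    ![0, 0, -1, -1, -1, -1] ![1, -1, -1, 1, 0, 0]
  convert this using 1
  refine Prod.ext ?_ ?_
  · simp [Fin.sum_univ_succ, pairT, traceTExpr]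
    module
  · simp [Fin.sum_univ_succ, pairT, traceTExpr]
    module

end expr

end LevelN

namespace LevelN

open Filter Topology

set_option linter.unusedSectionVars false

variable {N : ℕ} [NeZero N]

/-! ### A criterion for the weak form of unitary equivalence -/

/-- The relation is a closed condition in each of the two graph elements, so closures are taken one
variable at a time. -/
lemma IsConjugatePair.inner_closedGraph {X : FnOp N × FnOp N} (h : IsConjugatePair X)
    {f f' g g' : Hilb N} (hf : (f, f') ∈ closedGraph X.1) (hg : (g, g') ∈ closedGraph X.2) :
    inner ℂ f' g = inner ℂ f g' := by
  have h1 : ∀ p ∈ coreGraph X.1, ∀ r ∈ closedGraph X.2,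
      inner ℂ p.2 r.1 = inner ℂ p.1 r.2 := by
    intro p hp r hr
    have hc : IsClosed {r : Hilb N × Hilb N | inner ℂ p.2 r.1 = inner ℂ p.1 r.2} :=
      isClosed_eq (by fun_prop) (by fun_prop)
    exact closure_minimal (fun r hr => h p.1 p.2 r.1 r.2 hp hr) hc hr
  have hc : IsClosed {p : Hilb N × Hilb N | inner ℂ p.2 g = inner ℂ p.1 g'} :=
    isClosed_eq (by fun_prop) (by fun_prop)
  exact closure_minimal (fun p hp => h1 p hp _ hg) hc hf

lemma eq_of_forall_inner_eq {D : Set (Hilb N)} (hD : Dense D) {u v : Hilb N}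
    (h : ∀ d ∈ D, inner ℂ u d = (inner ℂ v d : ℂ)) : u = v := by
  have hc : IsClosed {d : Hilb N | inner ℂ u d = (inner ℂ v d : ℂ)} :=
    isClosed_eq (by fun_prop) (by fun_prop)
  have : ∀ d, inner ℂ u d = (inner ℂ v d : ℂ) := fun d => by
    have : d ∈ closure D := hD d
    exact closure_minimal h hc this
  exact ext_inner_right ℂ this

/-- It suffices to have a dense set of vectors on which all the operators are defined and
intertwined. -/
lemma denseEquiv_of_dense {W : Hilb N ≃ₗᵢ[ℂ] Hilb N} {X Z : FnOp N × FnOp N}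
    (hX : IsConjugatePair X) (hZ : IsConjugatePair Z) {D : Set (Hilb N)} (hD : Dense D)
    (h₁ : ∀ f ∈ D, ∃ g, (f, g) ∈ closedGraph X.1 ∧ (W f, W g) ∈ closedGraph Z.1)
    (h₂ : ∀ f ∈ D, ∃ g, (f, g) ∈ closedGraph X.2 ∧ (W f, W g) ∈ closedGraph Z.2) :
    DenseEquiv W X Z := by
  have hmem : ∀ {G : Submodule ℂ (Hilb N × Hilb N)} {f g : Hilb N}, (f, g) ∈ G → f ∈ dom G :=
    fun h => ⟨_, h, rfl⟩
  have hinv : ∀ f, W⁻¹ (W f) = f := W.symm_apply_apply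
  refine ⟨hD.mono fun f hf => ?_, fun f g h hf hh => ?_, fun f g h hf hh => ?_⟩
  · obtain ⟨g, h1, h2⟩ := h₁ f hf
    obtain ⟨g', h3, h4⟩ := h₂ f hf
    exact ⟨hmem h1, hmem h3, hmem h2, hmem h4⟩
  -- For d ∈ D with partner value d' = X̃d: ⟨h, Wd⟩ = ⟨Wf, Z̃Wd⟩ = ⟨Wf, Wd'⟩ = ⟨f, d'⟩ = ⟨g, d⟩. The
  -- other half exchanges the members of the pairs.
  · have : W.symm h = g := eq_of_forall_inner_eq hD fun d hd => by
      obtain ⟨d', h3, h4⟩ := h₂ d hd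
      rw [← W.inner_map_map, W.apply_symm_apply, hZ.inner_closedGraph hh h4, W.inner_map_map,
        hX.inner_closedGraph hf h3]
    rw [← this, W.apply_symm_apply]
  · have : W.symm h = g := eq_of_forall_inner_eq hD fun d hd => by
      obtain ⟨d', h3, h4⟩ := h₁ d hd
      rw [← W.inner_map_map, W.apply_symm_apply, ← inner_conj_symm,
        ← hZ.inner_closedGraph h4 hh, W.inner_map_map, hX.inner_closedGraph h3 hf,
        inner_conj_symm]
    rw [← this, W.apply_symm_apply]

/-! ### Density -/

-- Injectivity of the Fourier transform on L¹: a test function is the transform of a Schwartz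
-- function ψ, and the transform can be moved from ψ to `u`.
open FourierTransform ContDiff in
lemma ae_eq_zero_of_fourier_eq_zero {u : ℝ → ℂ} (hu : Integrable u)
    (h : ∀ ξ : ℝ, ∫ x : ℝ, Complex.exp (((-2 * Real.pi * x * ξ : ℝ) : ℂ) * I) * u x = 0) :
    ∀ᵐ x, u x = 0 := by
  refine ae_eq_zero_of_integral_contDiff_smul_eq_zero hu.locallyIntegrable fun g hg hgs => ?_
  have hg₁ : HasCompactSupport (Complex.ofRealCLM ∘ g) := hgs.comp_left rfl
  have hg₂ : ContDiff ℝ ∞ (Complex.ofRealCLM ∘ g) := by fun_prop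
  set φ := hg₁.toSchwartzMap hg₂ with hφ
  set ψ := 𝓕⁻ φ with hψ
  have e1 : ∀ x : ℝ, (𝓕 (ψ : ℝ → ℂ)) x = ((g x : ℝ) : ℂ) := fun x => by
    rw [← SchwartzMap.fourier_coe, hψ, FourierTransform.fourier_fourierInv_eq]
    rfl
  have e2 : ∀ ξ, 𝓕 u ξ = 0 := fun ξ => by
    rw [Real.fourier_real_eq_integral_exp_smul]
    exact h ξ
  have key : ∫ ξ, (𝓕 (ψ : ℝ → ℂ)) ξ • u ξ = ∫ x, ψ x • (𝓕 u) x := by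
    simpa using! (VectorFourier.integral_fourierIntegral_smul_eq_flip (L := innerₗ ℝ)
      Real.continuous_fourierChar continuous_inner ψ.integrable hu)
  simp only [e1, e2, smul_zero, integral_zero] at key
  rw [← key]
  rfl

/-- For p orthogonal to all these vectors, imaginary β show that the integrable function p̄ G
exp(-(A + 1)x²) has vanishing Fourier transform. Hence it is zero, and so is p, as G ≠ 0 almost
everywhere. -/
lemma dense_gauss {A : ℝ} {G : Fn N} (hG : ∀ m, ∀ᵐ x : ℝ, G x m ≠ 0)
    (hrep : ∀ h ∈ gaussFnGt N A, ∃ p, Rep (mulOp G h) p) :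
    Dense {p : Hilb N | ∃ h ∈ gaussFnGt N A, Rep (mulOp G h) p} := by
  let D : Submodule ℂ (Hilb N) :=
    { carrier := {p : Hilb N | ∃ h ∈ gaussFnGt N A, Rep (mulOp G h) p}
      add_mem' := by
        rintro p r ⟨h, hh, hp⟩ ⟨h', hh', hr⟩
        exact ⟨h + h', add_mem hh hh', by rw [map_add]; exact hp.add hr⟩
      zero_mem' := by
        obtain ⟨p, hp⟩ := hrep 0 (zero_mem _)
        refine ⟨0, zero_mem _, ?_⟩
        have := hp.smul 0
        rwa [zero_smul, zero_smul, ← map_zero (mulOp G)] at this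
      smul_mem' := by
        rintro c p ⟨h, hh, hp⟩
        exact ⟨c • h, Submodule.smul_mem _ _ hh, by rw [map_smul]; exact hp.smul c⟩ }
  have key : Dᗮ = ⊥ := by
    rw [eq_bot_iff]
    intro p hp
    rw [Submodule.mem_bot]
    ext1 k
    refine Lp.ext ?_
    set g : ℂ → Fn N := fun β μ m =>
      if m = k then exp (-((A + 1 : ℝ) : ℂ) * μ ^ 2 + β * μ) * (1 : Polynomial ℂ).eval μ else 0 with hg
    have hgm : ∀ β, g β ∈ gaussFnGt N A := fun β =>
      Submodule.subset_span ⟨_, β, 1, k, by rw [ofReal_re]; linarith, rfl⟩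
    have hin : ∀ β, ∫ x : ℝ, conj (p k x) * (G x k * exp (-((A + 1 : ℝ) : ℂ) * x ^ 2 + β * x)) = 0 := by
      intro β
      obtain ⟨r, hr⟩ := hrep _ (hgm β)
      have h1 := (Submodule.mem_orthogonal' D p).1 hp r ⟨_, hgm β, hr⟩
      rw [inner_eq_of_rep hr, Finset.sum_eq_single k] at h1
      · rw [← h1]
        refine integral_congr_ae (ae_of_all _ fun x => ?_)
        change _ = conj (p k x) * (G x k * g β x k)
        simp [hg]
      · intro m _ hm
        have : ∀ x : ℝ, mulOp G (g β) x m = 0 := fun x => by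
          change G x m * g β x m = 0
          simp [hg, hm]
        simp [this]
      · simp
    obtain ⟨r, hr⟩ := hrep _ (hgm 0)
    have hint : Integrable fun x : ℝ => conj (p k x) * (G x k * exp (-((A + 1 : ℝ) : ℂ) * x ^ 2)) := by
      have h1 := integrable_conj_mul (p k) ((Lp.memLp (r k)).ae_eq (hr k))
      refine h1.congr (ae_of_all _ fun x => ?_)
      change conj (p k x) * (G x k * g 0 x k) = _
      simp [hg]
    have h0 := ae_eq_zero_of_fourier_eq_zero hint fun ξ => by
      rw [← hin (((-2 * Real.pi * ξ : ℝ) : ℂ) * I)]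
      refine integral_congr_ae (ae_of_all _ fun x => ?_)
      simp only
      rw [Complex.exp_add]
      have : ((-2 * Real.pi * x * ξ : ℝ) : ℂ) * I = ((-2 * Real.pi * ξ : ℝ) : ℂ) * I * x := by
        push_cast
        ring
      rw [this]
      ring
    filter_upwards [h0, hG k, Lp.coeFn_zero ℂ 2 (volume : Measure ℝ)] with x h1 h2 h3
    have h4 : p k x = 0 := by
      have := (mul_eq_zero.1 h1).resolve_right (mul_ne_zero h2 (Complex.exp_ne_zero _))
      simpa using this
    rw [h4]
    exact h3.symm
  have h2 := (Submodule.topologicalClosure_eq_top_iff (K := D)).2 key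
  have h3 := Submodule.dense_iff_topologicalClosure_eq_top.2 h2
  exact h3

end LevelN

namespace LevelN

open Filter Topology

set_option linter.unusedSectionVars false

variable {N : ℕ} [NeZero N]

/-! ### Limits of exponential polynomials -/

/-- Multiplication by `g` preserves the Gaussian functions. -/
def GaussMul (g : Fn N) : Prop :=
  ∀ r : ℝ, 0 ≤ r → ∀ F ∈ gaussFnGt N r, mulOp g F ∈ gaussFnGt N r

/-- Limits of exponential polynomials that are bounded by `exp(A|z|² + O(|z|))`. -/
def ExpLim (A : ℝ) (g : Fn N) : Prop :=
  ∃ gs : ℕ → Fn N, (∀ n, GaussMul (gs n)) ∧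
    (∃ C c : ℝ, 0 ≤ C ∧ 0 ≤ c ∧
      ∀ n z m, ‖gs n z m‖ ≤ C * Real.exp (A * ‖z‖ ^ 2 + c * ‖z‖)) ∧
    ∀ z m, Tendsto (fun n => gs n z m) atTop (𝓝 (g z m))

lemma GaussMul.mul {g g' : Fn N} (h : GaussMul g) (h' : GaussMul g') : GaussMul (g * g') :=
  fun r hr F hF => by
    rw [← mulOp_mul]
    exact h r hr _ (h' r hr F hF)

lemma ExpLim.mul {A A' : ℝ} {g g' : Fn N} (h : ExpLim A g) (h' : ExpLim A' g') :
    ExpLim (A + A') (g * g') := by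
  obtain ⟨gs, h1, ⟨C, c, hC, hc, h2⟩, h3⟩ := h
  obtain ⟨gs', h1', ⟨C', c', hC', hc', h2'⟩, h3'⟩ := h'
  refine ⟨fun n => gs n * gs' n, fun n => (h1 n).mul (h1' n), ⟨C * C', c + c', by positivity,
    by positivity, fun n z m => ?_⟩, fun z m => (h3 z m).mul (h3' z m)⟩
  change ‖gs n z m * gs' n z m‖ ≤ _
  rw [norm_mul]
  refine (mul_le_mul (h2 n z m) (h2' n z m) (norm_nonneg _) (by positivity)).trans_eq ?_
  rw [mul_mul_mul_comm, ← Real.exp_add]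
  congr 2
  ring

/-- A Gaussian with Re α > A beats growth of order exp(A|z|²) on every horizontal line, uniformly in
n. -/
lemma gaussBdd_expLim {A C c : ℝ} (hC : 0 ≤ C) {gs : ℕ → Fn N}
    (h : ∀ n z m, ‖gs n z m‖ ≤ C * Real.exp (A * ‖z‖ ^ 2 + c * ‖z‖)) {F : Fn N}
    (hF : F ∈ gaussFnGt N A) (w : ℂ) (m : ZMod N) :
    GaussBdd (fun p : ℕ × ℝ => p.2) fun p => gs p.1 (p.2 + w) m * F (p.2 + w) m := by
  induction hF using Submodule.span_induction with
  | mem F hF =>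
    obtain ⟨α, β, P, k, hα, rfl⟩ := hF
    by_cases hm : m = k
    · obtain ⟨D, hD, hP⟩ := polynomial_growth P
      have h1 := gaussBdd_strip (β := β) |w.im| hα (C := C * D)
        (g := fun z => ((C * Real.exp (A * ‖z‖ ^ 2 + c * ‖z‖) : ℝ) : ℂ) * P.eval z) (c + 1)
        fun z => by
          rw [norm_mul, Complex.norm_real, Real.norm_eq_abs, abs_of_nonneg (by positivity)]
          refine (mul_le_mul_of_nonneg_left (hP z) (by positivity)).trans_eq ?_
          rw [mul_mul_mul_comm, ← Real.exp_add]
          congr 2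
          ring
      have h2 := (h1.line (S := {z | |z.im| ≤ |w.im|}) (w := w)
        (f := fun z => exp (-α * z ^ 2 + β * z) *
          (((C * Real.exp (A * ‖z‖ ^ 2 + c * ‖z‖) : ℝ) : ℂ) * P.eval z))
        (fun x => by simp)).comp (Prod.snd : ℕ × ℝ → ℝ)
      refine GaussBdd.mono h2 fun p => ?_
      simp only [hm, if_true, Function.comp_apply]
      rw [norm_mul, norm_mul, norm_mul, norm_mul, Complex.norm_real, Real.norm_eq_abs,
        abs_of_nonneg (by positivity), mul_left_comm]
      gcongr
      exact h _ _ _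
    · simpa only [hm, if_false, mul_zero] using GaussBdd.zero
  | zero => simpa using GaussBdd.zero
  | add F G _ _ h1 h2 =>
    simp only [Pi.add_apply, mul_add]
    exact h1.add h2
  | smul a F _ h1 =>
    simp only [Pi.smul_apply, smul_eq_mul, mul_left_comm _ a]
    exact h1.const_mul a

lemma ExpLim.gaussTendsto {A : ℝ} {g : Fn N} {gs : ℕ → Fn N}
    (hb : ∃ C c : ℝ, 0 ≤ C ∧ 0 ≤ c ∧
      ∀ n z m, ‖gs n z m‖ ≤ C * Real.exp (A * ‖z‖ ^ 2 + c * ‖z‖))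
    (hl : ∀ z m, Tendsto (fun n => gs n z m) atTop (𝓝 (g z m))) {F : Fn N}
    (hF : F ∈ gaussFnGt N A) :
    GaussTendsto Set.univ (fun n => mulOp (gs n) F) (mulOp g F) where
  bdd w _ m := by
    obtain ⟨C, c, hC, hc, h⟩ := hb
    exact gaussBdd_expLim hC h hF w m
  lim w _ m x := (hl _ _).mul_const _

/-- The products with Gaussian functions belong to the domains of the closed operators. -/
lemma ExpLim.repIn_closedGraph {A : ℝ} (hA : 0 ≤ A) {g : Fn N} (hg : ExpLim A g) {F : Fn N}
    (hF : F ∈ gaussFnGt N A) {X : FnOp N} (hX : X ∈ termSpan N Set.univ) :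
    RepIn (closedGraph X) (mulOp g F) (X (mulOp g F)) := by
  obtain ⟨gs, h1, h2, h3⟩ := hg
  exact RepIn.of_gaussTendsto (isClosed_closedGraph X) (Set.mem_univ _) hX
    (ExpLim.gaussTendsto h2 h3 hF) fun n =>
      LevelN.repIn_closedGraph hX (gaussFnGt_le hA (h1 n A hA F hF))

/-! ### Transport of multiplication operators -/

/-- Conjugation by `A` preserves the multiplications by limits of exponential polynomials. -/
def Transports (T : FnOp N) : Prop :=
  ∀ A g, ExpLim A g → ∃ g', ExpLim A g' ∧ T * mulOp g = mulOp g' * T ∧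
    ((∀ w : ℂ, ∀ m, ∀ᵐ x : ℝ, g (x + w) m ≠ 0) → ∀ w : ℂ, ∀ m, ∀ᵐ x : ℝ, g' (x + w) m ≠ 0)

lemma Transports.mul {T T' : FnOp N} (h : Transports T) (h' : Transports T') :
    Transports (T * T') := by
  intro A g hg
  obtain ⟨g', h1, h2, h3⟩ := h' A g hg
  obtain ⟨g'', h4, h5, h6⟩ := h A g' h1
  refine ⟨g'', h4, ?_, fun h0 => h6 (h3 h0)⟩
  rw [mul_assoc, h2, ← mul_assoc, h5, mul_assoc]

lemma transports_mulOp (a : Fn N) : Transports (mulOp a) := fun A g hg =>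
  ⟨g, hg, by rw [mulOp_mul, mulOp_mul, mul_comm], fun h => h⟩

lemma transports_shiftOp (x : ℝ) (k : ZMod N) : Transports (shiftOp (x : ℂ) k) := by
  rintro A g ⟨gs, h1, ⟨C, c, hC, hc, h2⟩, h3⟩
  have hcomm : ∀ g : Fn N, shiftOp (x : ℂ) k * mulOp g =
      mulOp (fun z m => g (z + x) (m + k)) * shiftOp (x : ℂ) k := fun g => rfl
  have hE := elem_shiftOp x k
  refine ⟨fun z m => g (z + x) (m + k), ⟨fun n z m => gs n (z + x) (m + k),
    fun n r hr F hF => ?_, ?_, fun z m => h3 _ _⟩, hcomm g, fun h0 w m => ?_⟩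
  · have e : mulOp (fun z m => gs n (z + x) (m + k)) =
        shiftOp (x : ℂ) k * mulOp (gs n) * shiftOp ((-x : ℝ) : ℂ) (-k) := by
      rw [hcomm, mul_assoc, hE.right, mul_one]
    rw [e]
    exact hE.gauss r hr _ (h1 n r hr _ (hE.gauss' r hr F hF))
  -- |z + x|² differs from |z|² by at most 2|x||z| + x², so translation leaves the quadratic rate
  -- `A` untouched and changes only the linear one.
  · refine ⟨C * Real.exp (|A| * x ^ 2 + c * |x|), 2 * |A| * |x| + c, by positivity, by positivity,
      fun n z m => (h2 n _ _).trans ?_⟩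
    rw [mul_assoc, ← Real.exp_add]
    refine mul_le_mul_of_nonneg_left (Real.exp_le_exp.2 ?_) hC
    have e1 : ‖z + x‖ ≤ ‖z‖ + |x| := by
      simpa using norm_add_le z (x : ℂ)
    have e2 : ‖z‖ ≤ ‖z + x‖ + |x| := by
      have := norm_sub_le (z + x) (x : ℂ)
      simpa using this
    have e3 : |‖z + x‖ ^ 2 - ‖z‖ ^ 2| ≤ 2 * |x| * ‖z‖ + x ^ 2 := by
      rw [← sq_abs x, abs_le]
      have := norm_nonneg z
      have := norm_nonneg (z + x)
      have := abs_nonneg x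
      constructor <;> nlinarith
    have e4 : A * (‖z + x‖ ^ 2 - ‖z‖ ^ 2) ≤ |A| * (2 * |x| * ‖z‖ + x ^ 2) := by
      refine (le_abs_self _).trans ?_
      rw [abs_mul]
      exact mul_le_mul_of_nonneg_left e3 (abs_nonneg A)
    nlinarith [mul_le_mul_of_nonneg_left e1 hc]
  · filter_upwards [h0 (w + x) (m + k)] with t ht
    rwa [add_assoc]

lemma transports_parityOp : Transports (parityOp N) := by
  rintro A g ⟨gs, h1, ⟨C, c, hC, hc, h2⟩, h3⟩
  have hcomm : ∀ g : Fn N, parityOp N * mulOp g =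
      mulOp (fun z m => g (-z) (-m)) * parityOp N := fun g => rfl
  refine ⟨fun z m => g (-z) (-m), ⟨fun n z m => gs n (-z) (-m), fun n r hr F hF => ?_,
    ⟨C, c, hC, hc, fun n z m => ?_⟩, fun z m => h3 _ _⟩, hcomm g, fun h0 w m => ?_⟩
  · have e : mulOp (fun z m => gs n (-z) (-m)) = parityOp N * mulOp (gs n) * parityOp N := by
      rw [hcomm, mul_assoc, elem_parityOp.right, mul_one]
    rw [e]
    exact parityOp_gauss r (h1 n r hr _ (parityOp_gauss r hF))
  · have := h2 n (-z) (-m)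
    rwa [norm_neg] at this
  · have := (Measure.measurePreserving_neg (volume : Measure ℝ)).quasiMeasurePreserving.ae
      (h0 (-w) (-m))
    filter_upwards [this] with t ht
    rw [ofReal_neg, ← neg_add] at ht
    exact ht

/-! ### Infinite products are limits of exponential polynomials -/

/-- Only about τ/(2L) of the factors are large, each at most exp(τ + 1), and the remaining ones
contribute at most exp σ. A number of factors linear in τ with exponents linear in τ gives a
quadratic exponent. -/
lemma prod_one_add_growth {ρ : ℝ} (h0 : 0 < ρ) (h1 : ρ < 1) : ∃ B, 0 ≤ B ∧ ∀ (n : ℕ) (t τ : ℝ),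
    0 ≤ t → 0 ≤ τ → t ≤ Real.exp τ →
    ∏ j ∈ Finset.range n, (1 + ρ ^ (2 * j + 1) * t) ≤ Real.exp (B * (τ + 1) ^ 2) := by
  set L := -Real.log ρ with hL
  have hLpos : 0 < L := by
    rw [hL, neg_pos]
    exact Real.log_neg h0 h1
  have hs : Summable fun j : ℕ => ρ ^ (2 * j + 1) := by
    have h2 : ρ ^ 2 < 1 := by nlinarith
    have := (summable_geometric_of_lt_one (sq_nonneg ρ) h2).mul_left ρ
    refine this.congr fun j => ?_
    rw [pow_succ ρ (2 * j), pow_mul, mul_comm]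
  set σ := ∑' j : ℕ, ρ ^ (2 * j + 1) with hσ
  have hσ0 : 0 ≤ σ := tsum_nonneg fun j => by positivity
  refine ⟨1 / (2 * L) + 1 + σ, by positivity, fun n t τ ht hτ htτ => ?_⟩
  -- The index from which ρ^(2k) t ≤ 1, so that the tail no longer depends on t.
  set k := ⌈τ / (2 * L)⌉₊ with hk
  have hk1 : τ / (2 * L) ≤ k := Nat.le_ceil _
  have hk2 : (k : ℝ) ≤ τ / (2 * L) + 1 := (Nat.ceil_lt_add_one (by positivity)).le
  have hρk : ρ ^ (2 * k) * t ≤ 1 := by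
    have e : ρ ^ (2 * k) = Real.exp (-(2 * k * L)) := by
      rw [← Real.exp_log h0, ← Real.exp_nat_mul]
      congr 1
      rw [hL]
      push_cast
      ring
    calc ρ ^ (2 * k) * t ≤ Real.exp (-(2 * k * L)) * Real.exp τ := by rw [e]; gcongr
      _ = Real.exp (τ - 2 * k * L) := by rw [← Real.exp_add]; congr 1; ring
      _ ≤ 1 := by
        rw [Real.exp_le_one_iff]
        rw [div_le_iff₀ (by positivity)] at hk1
        linarith
  have hfac : ∀ j, 1 ≤ 1 + ρ ^ (2 * j + 1) * t := fun j => by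
    have : 0 ≤ ρ ^ (2 * j + 1) * t := by positivity
    linarith
  have s1 : ∏ j ∈ Finset.range n, (1 + ρ ^ (2 * j + 1) * t) ≤
      ∏ j ∈ Finset.range (k + n), (1 + ρ ^ (2 * j + 1) * t) := by
    rw [add_comm k n, Finset.prod_range_add]
    refine le_mul_of_one_le_right (Finset.prod_nonneg fun j _ => zero_le_one.trans (hfac j)) ?_
    exact (Finset.prod_const_one (M := ℝ) (s := Finset.range k)).symm.trans_le
      (Finset.prod_le_prod (fun _ _ => zero_le_one) fun j _ => hfac _)
  have s2 : ∏ j ∈ Finset.range k, (1 + ρ ^ (2 * j + 1) * t) ≤ Real.exp (k * (τ + 1)) := by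
    calc ∏ j ∈ Finset.range k, (1 + ρ ^ (2 * j + 1) * t)
        ≤ ∏ _j ∈ Finset.range k, Real.exp (τ + 1) := by
          refine Finset.prod_le_prod (fun j _ => zero_le_one.trans (hfac j)) fun j _ => ?_
          have e1 : ρ ^ (2 * j + 1) * t ≤ 1 * t :=
            mul_le_mul_of_nonneg_right (pow_le_one₀ h0.le h1.le) ht
          have e2 := Real.add_one_le_exp (1 : ℝ)
          have e3 := Real.one_le_exp hτ
          rw [Real.exp_add]
          nlinarith
      _ = Real.exp (k * (τ + 1)) := by
          rw [Finset.prod_const, Finset.card_range, Real.exp_nat_mul]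
  have s3 : ∏ j ∈ Finset.range n, (1 + ρ ^ (2 * (k + j) + 1) * t) ≤ Real.exp σ := by
    calc ∏ j ∈ Finset.range n, (1 + ρ ^ (2 * (k + j) + 1) * t)
        ≤ ∏ j ∈ Finset.range n, Real.exp (ρ ^ (2 * j + 1)) := by
          refine Finset.prod_le_prod (fun j _ => zero_le_one.trans (hfac _)) fun j _ => ?_
          have : ρ ^ (2 * (k + j) + 1) * t ≤ ρ ^ (2 * j + 1) := by
            calc ρ ^ (2 * (k + j) + 1) * t = ρ ^ (2 * j + 1) * (ρ ^ (2 * k) * t) := by ring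
              _ ≤ ρ ^ (2 * j + 1) * 1 := by gcongr
              _ = _ := mul_one _
          have h3 := Real.add_one_le_exp (ρ ^ (2 * j + 1))
          linarith
      _ = Real.exp (∑ j ∈ Finset.range n, ρ ^ (2 * j + 1)) := (Real.exp_sum _ _).symm
      _ ≤ Real.exp σ := Real.exp_le_exp.2 (hs.sum_le_tsum _ fun j _ => by positivity)
  rw [Finset.prod_range_add] at s1
  refine s1.trans ((mul_le_mul s2 s3 (Finset.prod_nonneg fun j _ => zero_le_one.trans (hfac _))
    (Real.exp_nonneg _)).trans ?_)
  rw [← Real.exp_add, Real.exp_le_exp]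
  have h5 : (k : ℝ) * (τ + 1) ≤ (τ / (2 * L) + 1) * (τ + 1) := by gcongr
  have h6 : τ / (2 * L) = 1 / (2 * L) * τ := by ring
  have h7 : 0 < 1 / (2 * L) := by positivity
  rw [h6] at h5
  nlinarith [mul_nonneg h7.le hτ, mul_nonneg hσ0 hτ, mul_nonneg hσ0 (mul_nonneg hτ hτ)]

lemma norm_qprodFin_le (r : ℂ) (n : ℕ) (u : ℂ) :
    ‖qprodFin r n u‖ ≤ ∏ j ∈ Finset.range n, (1 + ‖r‖ ^ (2 * j + 1) * ‖u‖) := by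
  rw [qprodFin, norm_prod]
  refine Finset.prod_le_prod (fun _ _ => norm_nonneg _) fun j _ => ?_
  refine (norm_add_le _ _).trans_eq ?_
  rw [norm_one, norm_mul, norm_pow]

lemma gaussMul_qprodFin (r γ : ℂ) (a : ZMod N → ℂ) (n : ℕ) :
    GaussMul fun z m => qprodFin r n (a m * exp (γ * z)) := by
  induction n with
  | zero =>
    intro t ht F hF
    have : (fun z m => qprodFin r 0 (a m * exp (γ * z)) : Fn N) = 1 := by
      ext z m
      simp [qprodFin]
    rw [this, mulOp_one]
    exact hF
  | succ n ih =>
    have h1 : GaussMul (fun z m => 1 + r ^ (2 * n + 1) * (a m * exp (γ * z)) : Fn N) := by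
      intro t ht F hF
      have : mulOp (fun z m => 1 + r ^ (2 * n + 1) * (a m * exp (γ * z))) F =
          F + termOp 0 0 γ (fun m => r ^ (2 * n + 1) * a m) F := by
        ext z m
        change (1 + r ^ (2 * n + 1) * (a m * exp (γ * z))) * F z m =
          F z m + termOp 0 0 γ (fun m => r ^ (2 * n + 1) * a m) F z m
        rw [termOp_apply, add_zero, add_zero]
        ring
      rw [this]
      exact add_mem hF (termOp_gauss _ _ _ _ _ hF)
    have := ih.mul h1
    convert this using 1
    ext z m
    exact Finset.prod_range_succ _ _

/-- The partial products are the approximants. Here log |a exp(γz)| ≤ |γ||z| + K, so the quadratic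
growth in τ becomes a rate B|γ|² with linear and constant corrections. -/
lemma expLim_qprod {r : ℂ} (h0 : r ≠ 0) (h1 : ‖r‖ < 1) (γ : ℂ) (a : ZMod N → ℂ) :
    ∃ A, 0 ≤ A ∧ ExpLim A fun z m => qprod r (a m * exp (γ * z)) := by
  obtain ⟨B, hB, hgr⟩ := prod_one_add_growth (norm_pos_iff.2 h0) h1
  obtain ⟨K, hK0, hK⟩ : ∃ K : ℝ, 0 ≤ K ∧ ∀ m, ‖a m‖ ≤ Real.exp K := by
    refine ⟨∑ m, ‖a m‖, by positivity, fun m => ?_⟩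
    have h2 : ‖a m‖ ≤ ∑ m, ‖a m‖ :=
      Finset.single_le_sum (f := fun m => ‖a m‖) (fun _ _ => norm_nonneg _) (Finset.mem_univ m)
    have h3 := Real.add_one_le_exp (∑ m, ‖a m‖)
    linarith
  refine ⟨B * ‖γ‖ ^ 2, by positivity, fun n z m => qprodFin r n (a m * exp (γ * z)),
    gaussMul_qprodFin r γ a, ⟨Real.exp (B * (K + 1) ^ 2), 2 * B * ‖γ‖ * (K + 1), by positivity,
      by positivity, fun n z m => ?_⟩, fun z m => tendsto_qprodFin h1 _⟩
  refine (norm_qprodFin_le _ _ _).trans ((hgr n _ (‖γ‖ * ‖z‖ + K) (norm_nonneg _) (by positivity)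
    ?_).trans_eq ?_)
  · rw [norm_mul, Complex.norm_exp, add_comm, Real.exp_add]
    gcongr
    · exact hK m
    · rw [← norm_mul]
      exact re_le_norm _
  · rw [← Real.exp_add]
    congr 1
    ring

section dilog

variable {b : ℂ} (hb : ‖b‖ = 1) (hre : 0 < b.re) (him : 0 < b.im)
include hb hre him

lemma expLim_dilogDen (c : ℂ) : ∃ A, 0 ≤ A ∧ ExpLim A (dilogDen N b c) := by
  have := expLim_qprod (N := N) (r := q N b) (Complex.exp_ne_zero _) (norm_q_lt hre him)
    ((2 * Real.pi / N : ℝ) * b) fun m => c * exp (-(2 * Real.pi * I / N * (m.val : ℂ)))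
  simp only [mul_assoc c, ← y_eq] at this
  exact this

lemma expLim_dilogNum (c : ℂ) : ∃ A, 0 ≤ A ∧ ExpLim A (dilogNum N b c) := by
  have := expLim_qprod (N := N) (r := (qt N b)⁻¹) (inv_ne_zero (Complex.exp_ne_zero _))
    (norm_qt_inv_lt hb hre him)
    ((2 * Real.pi / N : ℝ) * b⁻¹) fun m => conj c * exp (2 * Real.pi * I / N * (m.val : ℂ))
  simp only [mul_assoc (conj c), ← yt_eq] at this
  exact this

end dilog

end LevelN

namespace LevelN

open Filter Topology

set_option linter.unusedSectionVars false

variable {N : ℕ} [NeZero N]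

/-! ### Joint cores -/

lemma ExpLim.mono {A A' : ℝ} (h : A ≤ A') {g : Fn N} (hg : ExpLim A g) : ExpLim A' g := by
  obtain ⟨gs, h1, ⟨C, c, hC, hc, h2⟩, h3⟩ := hg
  refine ⟨gs, h1, ⟨C, c, hC, hc, fun n z m => (h2 n z m).trans ?_⟩, h3⟩
  refine mul_le_mul_of_nonneg_left (Real.exp_le_exp.2 ?_) hC
  have := mul_le_mul_of_nonneg_right h (sq_nonneg ‖z‖)
  linarith

lemma expLim_one : ExpLim 0 (1 : Fn N) :=
  ⟨fun _ => 1, fun _ _ _ F hF => by rwa [mulOp_one], ⟨1, 0, zero_le_one, le_rfl, fun n z m => by simp⟩,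
    fun _ _ => tendsto_const_nhds⟩

/-- The vectors `G h` with Gaussian `h` are mapped by `W⁻¹` to the domain of `X`, which acts on
their images as `Z` does. -/
def CoreFor (W : Hilb N ≃ₗᵢ[ℂ] Hilb N) (X Z : FnOp N) (G : Fn N) (B : ℝ) : Prop :=
  ∀ h ∈ gaussFnGt N B, ∀ p g : Hilb N, Rep (mulOp G h) p → Rep (Z (mulOp G h)) g →
    (W⁻¹ p, W⁻¹ g) ∈ closedGraph X

lemma coreFor_one {G : Fn N} {B : ℝ} (hB : 0 ≤ B) (hG : ExpLim B G) {Z : FnOp N}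
    (hZ : Z ∈ termSpan N Set.univ) : CoreFor 1 Z Z G B := fun h hh p g hp hg => by
  rw [inv_one]
  exact (hG.repIn_closedGraph hB hh hZ).mem hp hg

/-- Multiplication of a dense set by an a.e. nonvanishing function. -/
lemma denseEquiv_of_coreFor {W W' : Hilb N ≃ₗᵢ[ℂ] Hilb N} {X X' Z : FnOp N × FnOp N}
    (hX : IsConjugatePair X) (hX' : IsConjugatePair X') (hZ₁ : Z.1 ∈ termSpan N Set.univ)
    (hZ₂ : Z.2 ∈ termSpan N Set.univ) {G : Fn N} {B : ℝ} (hB : 0 ≤ B) (hG : ExpLim B G)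
    (hG0 : ∀ m, ∀ᵐ x : ℝ, G x m ≠ 0) (h₁ : CoreFor W X.1 Z.1 G B) (h₂ : CoreFor W X.2 Z.2 G B)
    (h₁' : CoreFor W' X'.1 Z.1 G B) (h₂' : CoreFor W' X'.2 Z.2 G B) :
    DenseEquiv (W'⁻¹ * W) X X' := by
  have hd := dense_gauss hG0 fun h hh => by
    obtain ⟨p, g, hp, -⟩ := hG.repIn_closedGraph hB hh hZ₁
    exact ⟨p, hp⟩
  have hinv : ∀ f, W (W⁻¹ f) = f := W.apply_symm_apply
  -- The dense set is the image under W⁻¹ of the vectors Gh. Since W'⁻¹W sends W⁻¹(Gh) to W'⁻¹(Gh),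
  -- both core properties are used at the same h.
  refine denseEquiv_of_dense hX hX'
    ((W⁻¹).surjective.denseRange.dense_image (W⁻¹).continuous hd) ?_ ?_
  · rintro _ ⟨p, ⟨h, hh, hp⟩, rfl⟩
    obtain ⟨p', g, hp', hg, -⟩ := hG.repIn_closedGraph hB hh hZ₁
    refine ⟨W⁻¹ g, h₁ h hh p g hp hg, ?_⟩
    change (W'⁻¹ (W (W⁻¹ p)), W'⁻¹ (W (W⁻¹ g))) ∈ _
    rw [hinv, hinv]
    exact h₁' h hh p g hp hg
  · rintro _ ⟨p, ⟨h, hh, hp⟩, rfl⟩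
    obtain ⟨p', g, hp', hg, -⟩ := hG.repIn_closedGraph hB hh hZ₂
    refine ⟨W⁻¹ g, h₂ h hh p g hp hg, ?_⟩
    change (W'⁻¹ (W (W⁻¹ p)), W'⁻¹ (W (W⁻¹ g))) ∈ _
    rw [hinv, hinv]
    exact h₂' h hh p g hp hg

section chain

variable {s : ℂ} {W : Hilb N ≃ₗᵢ[ℂ] Hilb N} {A₁ A₁' A₂ A₂' X Z : FnOp N} {M P Q K : Fn N}

/-- Because MQ = P, inverting the multiplier takes PKF to QKF. Both are free of denominators, and
growth at rate `B` puts the latter into the domain of the closure before the twist; the factor K is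
reserved for the needs of another chain. -/
lemma Chain.mem_closedGraph (h : Chain s A₁ M A₂ X Z) (hW : Factors W A₁ A₁' M A₂ A₂') {B : ℝ}
    (hB : 0 ≤ B) (hQ : ExpLim B (Q * K))
    (hM : ∀ w m, ∀ᵐ x : ℝ, M (x + w) m * Q (x + w) m = P (x + w) m) {F : Fn N}
    (hF : F ∈ gaussFnGt N B) {p g : Hilb N} (hp : Rep (A₂ (mulOp (P * K) F)) p)
    (hg : Rep (Z (A₂ (mulOp (P * K) F))) g) : (W⁻¹ p, W⁻¹ g) ∈ closedGraph X := by
  obtain ⟨k, R, ρ, π, X', Z', ht, h1, h2⟩ := h.twist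
  obtain ⟨W₁, W', W₂, hW₁, hW', hW₂, rfl⟩ := hW.fac
  have hX' := termSpan_mono (Set.subset_univ _) ht.X_mem
  have hline : ∀ w m, ∀ᵐ x : ℝ, mulOp M (mulOp (Q * K) F) (x + w) m =
      mulOp (P * K) F (x + w) m := fun w m => by
    filter_upwards [hM w m] with x hx
    change M _ _ * (Q _ _ * K _ _ * F _ _) = P _ _ * K _ _ * F _ _
    rw [← hx]
    ring
  obtain ⟨f₀, g₀, hf₀, hg₀, hmem⟩ := hQ.repIn_closedGraph hB hF hX'
  have e1 : W₂ (W' f₀) = p := by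
    have h3 := (hW' _ _ hf₀).congr (G := mulOp (P * K) F) fun m => by simpa using hline 0 m
    exact (hW₂ _ _ h3).unique hp
  have e2 : W₂ (W' g₀) = g := by
    have h3 := (hW' _ _ hg₀).congr (G := Z' (mulOp (P * K) F)) fun m => by
      filter_upwards [ht.map (mulOp (Q * K) F) m,
        ae_congr_of_mem_termSpan ht.Z_mem (fun w _ m => hline w m) m] with x h4 h5
      rw [h4, h5]
    have h6 := hW₂ _ _ h3
    have h7 : A₂ (Z' (mulOp (P * K) F)) = Z (A₂ (mulOp (P * K) F)) :=
      LinearMap.congr_fun h2 (mulOp (P * K) F)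
    rw [h7] at h6
    exact h6.unique hg
  have e3 : ∀ f, (W₂ * W' * W₁)⁻¹ (W₂ (W' f)) = W₁⁻¹ f := fun f => by
    have h3 : (W₂ * W' * W₁) (W₁⁻¹ f) = W₂ (W' f) := by
      change W₂ (W' (W₁ (W₁⁻¹ f))) = _
      have : W₁ (W₁⁻¹ f) = f := W₁.apply_symm_apply f
      rw [this]
    rw [← h3]
    exact (W₂ * W' * W₁).symm_apply_apply _
  rw [← e1, ← e2, e3, e3]
  exact ((hW.elem₁.conjugates_closedGraph hW₁ h.memX hX' h1).symm _ _).1 hmem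

end chain

/-- The vectors on which all the operators of a chain are defined. -/
lemma exists_coreFor {s₁ s₂ : ℂ} {W : Hilb N ≃ₗᵢ[ℂ] Hilb N} {A₁ A₁' A₂ A₂' : FnOp N}
    {X Z : FnOp N × FnOp N} {M P Q : Fn N} (h₁ : Chain s₁ A₁ M A₂ X.1 Z.1)
    (h₂ : Chain s₂ A₁ M A₂ X.2 Z.2) (hW : Factors W A₁ A₁' M A₂ A₂') (hT : Transports A₂)
    (hT' : Transports A₂') {a a' : ℝ} (hP : ExpLim a P) (hQ : ExpLim a' Q)
    (hM : ∀ w m, ∀ᵐ x : ℝ, M (x + w) m * Q (x + w) m = P (x + w) m)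
    (hP0 : ∀ w : ℂ, ∀ m, ∀ᵐ x : ℝ, P (x + w) m ≠ 0) :
    ∃ a G, ExpLim a G ∧ (∀ w : ℂ, ∀ m, ∀ᵐ x : ℝ, G (x + w) m ≠ 0) ∧
      ∀ a' G', ExpLim a' G' → ∃ B, 0 ≤ B ∧ ∀ B', B ≤ B' →
        CoreFor W X.1 Z.1 (G * G') B' ∧ CoreFor W X.2 Z.2 (G * G') B' := by
  obtain ⟨G, hG, hGP, hG0⟩ := hT a P hP
  refine ⟨a, G, hG, hG0 hP0, fun c G' hG' => ?_⟩
  obtain ⟨K, hK, hKG, -⟩ := hT' c G' hG'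
  refine ⟨max 0 (a' + c), le_max_left _ _, fun B' hB' => ?_⟩
  have hB0 : 0 ≤ B' := (le_max_left _ _).trans hB'
  have hQK : ExpLim B' (Q * K) :=
    (hQ.mul hK).mono ((le_max_right _ _).trans hB')
  -- `A₂` carries multiplication by P to that by G, and `A₂'` carries G' back to K, so PK on the
  -- side of the twist is GG' on the side of L.
  have key : ∀ h, A₂ (mulOp (P * K) (A₂' h)) = mulOp (G * G') h := fun h => by
    have : A₂ * mulOp (P * K) * A₂' = mulOp (G * G') := by
      rw [← mulOp_mul, mul_assoc, mul_assoc, ← hKG, ← mul_assoc, hGP, mul_assoc, ← mul_assoc A₂,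
        hW.elem₂.right, one_mul, mulOp_mul]
    rw [← this]
    rfl
  constructor
  · intro h hh p g hp hg
    rw [← key] at hp hg
    exact h₁.mem_closedGraph hW hB0 hQK hM (hW.elem₂.gauss' B' hB0 h hh) hp hg
  · intro h hh p g hp hg
    rw [← key] at hp hg
    exact h₂.mem_closedGraph hW hB0 hQK hM (hW.elem₂.gauss' B' hB0 h hh) hp hg

/-! ### Common dense domains and property (D) -/

section cycles

variable {b : ℂ} (hb : ‖b‖ = 1) (hre : 0 < b.re) (him : 0 < b.im)
include hb hre him

lemma pairL_mem : (pairL N b).1 ∈ termSpan N Set.univ ∧ (pairL N b).2 ∈ termSpan N Set.univ := by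
  constructor
  · change dehnExpr (weyl N b) ∈ _
    rw [← gweyl_one]
    exact dehnExpr_mem (by norm_num)
  · change dehnExpr (weylt N b) ∈ _
    rw [← gweyl_neg_one]
    exact dehnExpr_mem (by norm_num)

/-- The multiplier is num/den for each dilogarithm, so P is the product of the numerators and Q that
of the denominators. -/
lemma exists_coreFor_S {l₁ l₂ l₃ l₄ : ℂ} {x₃ x₄ : ℝ} {k₃ k₄ : ZMod N}
    (h₃ : l₃ = y N b (x₃ : ℂ) k₃) (h₄ : l₄ = y N b (x₄ : ℂ) k₄) {𝔘 : Hilb N ≃ₗᵢ[ℂ] Hilb N}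
    (h : IsUs N b l₁ l₂ l₃ l₄ x₃ x₄ k₃ k₄ 𝔘) :
    ∃ a G, ExpLim a G ∧ (∀ w : ℂ, ∀ m, ∀ᵐ x : ℝ, G (x + w) m ≠ 0) ∧
      ∀ a' G', ExpLim a' G' → ∃ B, 0 ≤ B ∧ ∀ B', B ≤ B' →
        CoreFor 𝔘 (pairS N b l₁ l₂ l₃ l₄).1 (pairL N b).1 (G * G') B' ∧
        CoreFor 𝔘 (pairS N b l₁ l₂ l₃ l₄).2 (pairL N b).2 (G * G') B' := by
  set c := l₁ / (l₂ * l₃ * l₄)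
  obtain ⟨n₁, -, hn₁⟩ := expLim_dilogNum (N := N) hb hre him c
  obtain ⟨n₂, -, hn₂⟩ := expLim_dilogNum (N := N) hb hre him 1
  obtain ⟨d₁, -, hd₁⟩ := expLim_dilogDen (N := N) hb hre him c
  obtain ⟨d₂, -, hd₂⟩ := expLim_dilogDen (N := N) hb hre him 1
  refine exists_coreFor (chain_S_one hb hre him h₃ h₄) (chain_S_two hb hre him h₃ h₄)
    (factors_S hb hre him h) ((transports_mulOp _).mul (transports_shiftOp _ _))
    ((transports_shiftOp _ _).mul (transports_mulOp _)) (hn₁.mul hn₂) (hd₁.mul hd₂)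
    (fun w m => ?_) fun w m => ?_
  · filter_upwards [ae_dilogDen_ne hre him c w m, ae_dilogDen_ne hre him 1 w m] with x e1 e2
    change (dilogDen N b c _ _ / dilogNum N b c _ _)⁻¹ *
      (dilogDen N b 1 _ _ / dilogNum N b 1 _ _)⁻¹ * (dilogDen N b c _ _ * dilogDen N b 1 _ _) =
      dilogNum N b c _ _ * dilogNum N b 1 _ _
    rw [inv_div, inv_div]
    field_simp
  · filter_upwards [ae_dilogNum_ne hb hre him c w m, ae_dilogNum_ne hb hre him 1 w m]
      with x e1 e2 using mul_ne_zero e1 e2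

/-- The dilogarithms occur inverted, so denominators and numerators exchange their roles. -/
lemma exists_coreFor_T {l₁ l₂ l₃ l₄ : ℂ} {x₂ x₃ : ℝ} {k₂ k₃ : ZMod N}
    (h₂ : l₂ = y N b (x₂ : ℂ) k₂) (h₃ : l₃ = y N b (x₃ : ℂ) k₃) {𝔘 : Hilb N ≃ₗᵢ[ℂ] Hilb N}
    (h : IsUt N b l₁ l₂ l₃ l₄ x₂ x₃ k₂ k₃ 𝔘) :
    ∃ a G, ExpLim a G ∧ (∀ w : ℂ, ∀ m, ∀ᵐ x : ℝ, G (x + w) m ≠ 0) ∧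
      ∀ a' G', ExpLim a' G' → ∃ B, 0 ≤ B ∧ ∀ B', B ≤ B' →
        CoreFor 𝔘 (pairT N b l₁ l₂ l₃ l₄).1 (pairL N b).1 (G * G') B' ∧
        CoreFor 𝔘 (pairT N b l₁ l₂ l₃ l₄).2 (pairL N b).2 (G * G') B' := by
  set c := (l₁ * l₂ * l₃ * l₄)⁻¹
  set c' := (l₃ ^ 2)⁻¹
  obtain ⟨n₁, -, hn₁⟩ := expLim_dilogNum (N := N) hb hre him c
  obtain ⟨n₂, -, hn₂⟩ := expLim_dilogNum (N := N) hb hre him c'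
  obtain ⟨d₁, -, hd₁⟩ := expLim_dilogDen (N := N) hb hre him c
  obtain ⟨d₂, -, hd₂⟩ := expLim_dilogDen (N := N) hb hre him c'
  refine exists_coreFor (chain_T_one hb hre him h₂ h₃) (chain_T_two hb hre him h₂ h₃)
    (factors_T hb hre him h)
    ((((transports_mulOp _).mul (transports_shiftOp _ _)).mul (transports_mulOp _)).mul
      transports_parityOp)
    (transports_parityOp.mul ((transports_mulOp _).mul ((transports_shiftOp _ _).mul
      (transports_mulOp _)))) (hd₁.mul hd₂) (hn₁.mul hn₂)
    (fun w m => ?_) fun w m => ?_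
  · filter_upwards [ae_dilogNum_ne hb hre him c w m, ae_dilogNum_ne hb hre him c' w m]
      with x e1 e2
    change ((dilogDen N b c _ _ / dilogNum N b c _ _)⁻¹)⁻¹ *
      ((dilogDen N b c' _ _ / dilogNum N b c' _ _)⁻¹)⁻¹ *
      (dilogNum N b c _ _ * dilogNum N b c' _ _) = dilogDen N b c _ _ * dilogDen N b c' _ _
    rw [inv_inv, inv_inv]
    field_simp
  · filter_upwards [ae_dilogDen_ne hre him c w m, ae_dilogDen_ne hre him c' w m]
      with x e1 e2 using mul_ne_zero e1 e2

/-- The comparison unitary is the identity acting on the L-side, and no additional factor G' is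
required. -/
theorem denseEquiv_S {l₁ l₂ l₃ l₄ : ℂ} {x₃ x₄ : ℝ} {k₃ k₄ : ZMod N}
    (h₃ : l₃ = y N b (x₃ : ℂ) k₃) (h₄ : l₄ = y N b (x₄ : ℂ) k₄) {𝔘 : Hilb N ≃ₗᵢ[ℂ] Hilb N}
    (h : IsUs N b l₁ l₂ l₃ l₄ x₃ x₄ k₃ k₄ 𝔘) :
    DenseEquiv 𝔘 (pairS N b l₁ l₂ l₃ l₄) (pairL N b) := by
  obtain ⟨a, G, hG, hG0, hc⟩ := exists_coreFor_S hb hre him h₃ h₄ h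
  obtain ⟨B, hB, hc⟩ := hc 0 1 expLim_one
  obtain ⟨h1, h2⟩ := hc (max a B) (le_max_right _ _)
  have hB0 : 0 ≤ max a B := hB.trans (le_max_right _ _)
  rw [mul_one] at h1 h2
  have hG' := hG.mono (le_max_left a B)
  have hL := pairL_mem (N := N) hb hre him
  have := denseEquiv_of_coreFor (W' := 1) (isConjugatePair_pairS hb hre him l₁ l₂ l₃ l₄)
    (isConjugatePair_pairL hb hre him) hL.1 hL.2 hB0 hG' (fun m => by simpa using hG0 0 m) h1 h2
    (coreFor_one hB0 hG' hL.1) (coreFor_one hB0 hG' hL.2)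
  rwa [inv_one, one_mul] at this

theorem denseEquiv_T {l₁ l₂ l₃ l₄ : ℂ} {x₂ x₃ : ℝ} {k₂ k₃ : ZMod N}
    (h₂ : l₂ = y N b (x₂ : ℂ) k₂) (h₃ : l₃ = y N b (x₃ : ℂ) k₃) {𝔘 : Hilb N ≃ₗᵢ[ℂ] Hilb N}
    (h : IsUt N b l₁ l₂ l₃ l₄ x₂ x₃ k₂ k₃ 𝔘) :
    DenseEquiv 𝔘 (pairT N b l₁ l₂ l₃ l₄) (pairL N b) := by
  obtain ⟨a, G, hG, hG0, hc⟩ := exists_coreFor_T hb hre him h₂ h₃ h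
  obtain ⟨B, hB, hc⟩ := hc 0 1 expLim_one
  obtain ⟨h1, h2⟩ := hc (max a B) (le_max_right _ _)
  have hB0 : 0 ≤ max a B := hB.trans (le_max_right _ _)
  rw [mul_one] at h1 h2
  have hG' := hG.mono (le_max_left a B)
  have hL := pairL_mem (N := N) hb hre him
  have := denseEquiv_of_coreFor (W' := 1) (isConjugatePair_pairT hb hre him l₁ l₂ l₃ l₄)
    (isConjugatePair_pairL hb hre him) hL.1 hL.2 hB0 hG' (fun m => by simpa using hG0 0 m) h1 h2
    (coreFor_one hB0 hG' hL.1) (coreFor_one hB0 hG' hL.2)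
  rwa [inv_one, one_mul] at this

/-- Property (D) cannot simply be composed, since the dense sets of the two cycles may have too
small an intersection. The product GG' provides vectors on the L-side that pull back into both
domains. -/
theorem denseEquiv_A {l₁ l₂ l₃ l₄ : ℂ} {x₂ x₃ x₄ : ℝ} {k₂ k₃ k₄ : ZMod N}
    (h₂ : l₂ = y N b (x₂ : ℂ) k₂) (h₃ : l₃ = y N b (x₃ : ℂ) k₃) (h₄ : l₄ = y N b (x₄ : ℂ) k₄)
    {𝔘s 𝔘t : Hilb N ≃ₗᵢ[ℂ] Hilb N} (hs : IsUs N b l₁ l₂ l₃ l₄ x₃ x₄ k₃ k₄ 𝔘s)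
    (ht : IsUt N b l₁ l₂ l₃ l₄ x₂ x₃ k₂ k₃ 𝔘t) :
    DenseEquiv (𝔘s⁻¹ * 𝔘t) (pairT N b l₁ l₂ l₃ l₄) (pairS N b l₁ l₂ l₃ l₄) := by
  obtain ⟨a, G, hG, hG0, hc⟩ := exists_coreFor_S hb hre him h₃ h₄ hs
  obtain ⟨a', G', hG', hG0', hc'⟩ := exists_coreFor_T hb hre him h₂ h₃ ht
  obtain ⟨B, hB, hc⟩ := hc a' G' hG'
  obtain ⟨B', hB', hc'⟩ := hc' a G hG
  set C := max (a + a') (max B B') with hC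
  have hBC : B ≤ C := (le_max_left _ _).trans (le_max_right _ _)
  obtain ⟨h1, h2⟩ := hc C hBC
  obtain ⟨h1', h2'⟩ := hc' C ((le_max_right _ _).trans (le_max_right _ _))
  rw [mul_comm G'] at h1' h2'
  have hL := pairL_mem (N := N) hb hre him
  exact denseEquiv_of_coreFor (isConjugatePair_pairT hb hre him l₁ l₂ l₃ l₄)
    (isConjugatePair_pairS hb hre him l₁ l₂ l₃ l₄) hL.1 hL.2 (hB.trans hBC)
    ((hG.mul hG').mono (le_max_left _ _))
    (fun m => by
      filter_upwards [hG0 0 m, hG0' 0 m] with x e1 e2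
      rw [add_zero] at e1 e2
      exact mul_ne_zero e1 e2) h1' h2' h1 h2

end cycles

end LevelN

/-! ### The main theorem -/

theorem mainTheorem7 (N : ℕ) [NeZero N] (b : ℂ) (hb : ‖b‖ = 1) (hre : 0 < b.re) (him : 0 < b.im)
    (l₁ l₂ l₃ l₄ : ℂ) (h₁ : l₁ ≠ 0) (h₂ : l₂ ≠ 0) (h₃ : l₃ ≠ 0) (h₄ : l₄ ≠ 0) :
    -- the tilded operators are the Hermitian conjugates
    LevelN.IsConjugatePair (LevelN.pairL N b) ∧
    LevelN.IsConjugatePair (LevelN.pairS N b l₁ l₂ l₃ l₄) ∧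
    LevelN.IsConjugatePair (LevelN.pairT N b l₁ l₂ l₃ l₄) ∧
    -- the S-cycle
    (∀ (x₃ x₄ : ℝ) (k₃ k₄ : ZMod N),
      l₃ = LevelN.y N b (x₃ : ℂ) k₃ → l₄ = LevelN.y N b (x₄ : ℂ) k₄ →
      ∃ 𝔘s : LevelN.Hilb N ≃ₗᵢ[ℂ] LevelN.Hilb N,
        LevelN.IsUs N b l₁ l₂ l₃ l₄ x₃ x₄ k₃ k₄ 𝔘s ∧
        LevelN.MerEquiv 𝔘s (LevelN.pairS N b l₁ l₂ l₃ l₄) (LevelN.pairL N b) ∧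
        LevelN.DenseEquiv 𝔘s (LevelN.pairS N b l₁ l₂ l₃ l₄) (LevelN.pairL N b) ∧
        (Even N → LevelN.Quantised N b (l₁ / l₂) →
          LevelN.ClosedEquiv 𝔘s (LevelN.pairS N b l₁ l₂ l₃ l₄) (LevelN.pairL N b))) ∧
    -- the T-cycle
    (∀ (x₂ x₃ : ℝ) (k₂ k₃ : ZMod N),
      l₂ = LevelN.y N b (x₂ : ℂ) k₂ → l₃ = LevelN.y N b (x₃ : ℂ) k₃ →
      ∃ 𝔘t : LevelN.Hilb N ≃ₗᵢ[ℂ] LevelN.Hilb N,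
        LevelN.IsUt N b l₁ l₂ l₃ l₄ x₂ x₃ k₂ k₃ 𝔘t ∧
        LevelN.MerEquiv 𝔘t (LevelN.pairT N b l₁ l₂ l₃ l₄) (LevelN.pairL N b) ∧
        LevelN.DenseEquiv 𝔘t (LevelN.pairT N b l₁ l₂ l₃ l₄) (LevelN.pairL N b) ∧
        (Even N → LevelN.Quantised N b (l₁ * l₄) →
          LevelN.ClosedEquiv 𝔘t (LevelN.pairT N b l₁ l₂ l₃ l₄) (LevelN.pairL N b))) ∧
    -- the A-move
    (∀ (x₂ x₃ x₄ : ℝ) (k₂ k₃ k₄ : ZMod N),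
      l₂ = LevelN.y N b (x₂ : ℂ) k₂ → l₃ = LevelN.y N b (x₃ : ℂ) k₃ →
      l₄ = LevelN.y N b (x₄ : ℂ) k₄ →
      ∀ 𝔘s 𝔘t : LevelN.Hilb N ≃ₗᵢ[ℂ] LevelN.Hilb N,
        LevelN.IsUs N b l₁ l₂ l₃ l₄ x₃ x₄ k₃ k₄ 𝔘s →
        LevelN.IsUt N b l₁ l₂ l₃ l₄ x₂ x₃ k₂ k₃ 𝔘t →
        LevelN.MerEquiv (𝔘s⁻¹ * 𝔘t)
          (LevelN.pairT N b l₁ l₂ l₃ l₄) (LevelN.pairS N b l₁ l₂ l₃ l₄) ∧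
        LevelN.DenseEquiv (𝔘s⁻¹ * 𝔘t)
          (LevelN.pairT N b l₁ l₂ l₃ l₄) (LevelN.pairS N b l₁ l₂ l₃ l₄) ∧
        (Even N → LevelN.Quantised N b l₁ →
          LevelN.ClosedEquiv (𝔘s⁻¹ * 𝔘t)
            (LevelN.pairT N b l₁ l₂ l₃ l₄) (LevelN.pairS N b l₁ l₂ l₃ l₄))) := by
  refine ⟨LevelN.isConjugatePair_pairL hb hre him,
    LevelN.isConjugatePair_pairS hb hre him l₁ l₂ l₃ l₄,
    LevelN.isConjugatePair_pairT hb hre him l₁ l₂ l₃ l₄, ?_, ?_, ?_⟩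
  · intro x₃ x₄ k₃ k₄ e₃ e₄
    obtain ⟨𝔘, h⟩ := LevelN.exists_isUs hb hre him l₁ l₂ l₃ l₄ x₃ x₄ k₃ k₄
    exact ⟨𝔘, h, LevelN.merEquiv_S hb hre him e₃ e₄ h, LevelN.denseEquiv_S hb hre him e₃ e₄ h,
      LevelN.closedEquiv_S hb hre him e₃ e₄ h⟩
  · intro x₂ x₃ k₂ k₃ e₂ e₃
    obtain ⟨𝔘, h⟩ := LevelN.exists_isUt hb hre him l₁ l₂ l₃ l₄ x₂ x₃ k₂ k₃
    exact ⟨𝔘, h, LevelN.merEquiv_T hb hre him e₂ e₃ h, LevelN.denseEquiv_T hb hre him e₂ e₃ h,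
      LevelN.closedEquiv_T hb hre him e₂ e₃ h⟩
  · intro x₂ x₃ x₄ k₂ k₃ k₄ e₂ e₃ e₄ 𝔘s 𝔘t hs ht
    refine ⟨(LevelN.merEquiv_T hb hre him e₂ e₃ ht).trans
      (LevelN.merEquiv_S hb hre him e₃ e₄ hs).symm,
      LevelN.denseEquiv_A hb hre him e₂ e₃ e₄ hs ht, fun hN hq => ?_⟩
    -- Quantisation of l₁ together with that of l₂ and l₄ supplies the extra conditions of both
    -- cycles, on l₁/l₂ and on l₁l₄; equality of closed operators then composes.
    have q₁ : LevelN.Quantised N b (l₁ / l₂) := by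
      rw [div_eq_mul_inv]
      exact hq.mul (LevelN.Quantised.inv ⟨x₂, k₂, e₂⟩)
    exact (LevelN.closedEquiv_T hb hre him e₂ e₃ ht hN (hq.mul ⟨x₄, k₄, e₄⟩)).trans
      (LevelN.closedEquiv_S hb hre him e₃ e₄ hs hN q₁).symm
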